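/- **Setting.** Let $\alpha:(0,\infty)\to\mathbb C$ have finite moments of all orders, i.e. $\int_0^\infty z^n|\alpha(z)|\,dz<\infty$ for all $n\ge 0$. Let $\Delta_n(u)=\prod_{1\le i<j\le n}(u_j-u_i)$. For $\kappa\in(\mathbb C\setminus[0,\infty))^k$ and $\lambda\in\mathbb C^l$ put $r_{\kappa,\lambda}(z)=\prod_{i=1}^l(z-\lambda_i)/\prod_{i=1}^k(z-\kappa_i)$, and let $$Z^{(N,\mathrm B)}_{k|l}(\kappa,\lambda)=\frac1{N!}\int_{\mathbb R_+^N}d[z]\,\frac{\Delta_N^2(z)}{\prod_{i<j}(z_i+z_j)}\prod_{j=1}^N\alpha(z_j)\,r_{\kappa,\lambda}(z_j),$$ $$Z^{(N,\mathrm C)}_{k_1|l_1;k_2|l_2}(\kappa_1,\lambda_1;\kappa_2,\lambda_2)=\frac1{(N!)^2}\int_{\mathbb R_+^{2N}}d[x]d[y]\,\frac{\Delta_N^2(x)\Delta_N^2(y)}{\prod_{i,j=1}^N(x_i+y_j)}\prod_{j=1}^N\alpha(x_j)\alpha(y_j)\,y_j\,r_{\kappa_1,\lambda_1}(x_j)\,r_{\kappa_2,\lambda_2}(y_j),$$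 $$\widehat Z^{(L)}=\frac1{(L!)^2}\int_{\mathbb R_+^{2L}}d[x]d[y]\,\frac{\Delta_L^2(x)\Delta_L^2(y)}{\prod_{i,j=1}^L(x_i+y_j)}\Big(\prod_{j=1}^L\alpha(x_j)\alpha(y_j)y_j\Big)\sum_{j=1}^L(x_j-y_j).$$ Write $Z^{(N,\mathrm B)}_0=Z^{(N,\mathrm B)}_{0|0}$, $Z^{(N,\mathrm C)}_0=Z^{(N,\mathrm C)}_{0|0;0|0}$ and $\mathrm B_{k|l}(\kappa;\lambda)=\Delta_k(\kappa)\Delta_l(\lambda)/\prod_{i,j}(\kappa_i-\lambda_j)$. Arguments belonging to an index $0$ are omitted. Define the kernels $$\widehat K_{11}^{(L)}(\kappa,\kappa')=\frac{Z^{(L,\mathrm C)}_{1|0;1|0}(\kappa;\kappa')-Z^{(L,\mathrm C)}_{1|0;1|0}(\kappa';\kappa)}{2Z^{(L-1,\mathrm C)}_0},\qquad \widehat K_{01}^{(L)}(\kappa,\lambda)=\frac{Z^{(L,\mathrm C)}_{0|0;1|1}(\kappa,\lambda)+Z^{(L,\mathrm C)}_{1|1;0|0}(\kappa,\lambda)}{2Z^{(L,\mathrm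 C)}_0\,(\lambda-\kappa)},$$ $$\widehat K_{00}^{(L)}(\lambda,\lambda')=\frac{Z^{(L,\mathrm C)}_{0|1;0|1}(\lambda';\lambda)-Z^{(L,\mathrm C)}_{0|1;0|1}(\lambda;\lambda')}{2Z^{(L+1,\mathrm C)}_0},$$ $$\widehat K_1^{(L)}(\kappa)=-\frac{Z^{(L,\mathrm C)}_{0|0;1|0}(\kappa)+Z^{(L,\mathrm C)}_{1|0;0|0}(\kappa)}{2Z^{(L,\mathrm C)}_0},\qquad \widehat K_0^{(L)}(\lambda)=\frac{Z^{(L,\mathrm C)}_{0|0;0|1}(\lambda)-Z^{(L,\mathrm C)}_{0|1;0|0}(\lambda)}{2Z^{(L+1,\mathrm C)}_0},$$ with $\widehat K_{00}^{(-1)}=0$ and $\widehat K_0^{(-1)}=0$. **(0)** If $\alpha\ge0$ almost everywhere and $\alpha$ is not almost everywhere zero, then $Z^{(L,\mathrm B)}_0>0$ for all $L\ge0$. **(1)** Suppose that $Z^{(L,\mathrm B)}_0$ is a positive real number for all $L\ge0$ (in particular this holds in the case (0)). Then $Z^{(L,\mathrm C)}_0>0$ for all $L\ge 0$, and $\widehat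 Z^{(L)}$ is real and nonzero for all $L\ge1$. Let $s=\operatorname{sign}\widehat Z^{(L)}$ for any $L\ge 1$. Let $N,k,l\ge0$ be integers, and let $\kappa_1,\dots,\kappa_k\in\mathbb C\setminus[0,\infty)$ and $\lambda_1,\dots,\lambda_l\in\mathbb C$ be pairwise different. If $k+l$ is even and $M=N+l-k\ge0$, then $$Z^{(N,\mathrm B)}_{k|l}(\kappa,\lambda)=(-1)^{\frac{k(k-1)}2+\frac{l(l-1)}2}\,2^{N/2}\,\frac{\sqrt{Z^{(M,\mathrm C)}_0}}{\mathrm B_{k|l}(\kappa;\lambda)}\;\mathrm{Pf}\begin{bmatrix}-s\widehat K_{11}^{(M+1)}(\kappa_i,\kappa_j)&-\widehat K_{01}^{(M)}(\kappa_i,\lambda_j)\\ \widehat K_{01}^{(M)}(\kappa_j,\lambda_i)&-s\widehat K_{00}^{(M-1)}(\lambda_i,\lambda_j)\end{bmatrix}.$$ If $k+l$ is odd and $M=N+l-k+1\ge0$, then $$Z^{(N,\mathrm B)}_{k|l}(\kappa,\lambda)=(-1)^{\frac{k(k-1)}2+\frac{l(l-1)}2}\,2^{N/2}\,\frac{\sqrt{Z^{(M,\mathrm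 C)}_0}}{\mathrm B_{k|l}(\kappa;\lambda)}\;\mathrm{Pf}\begin{bmatrix}-s\widehat K_{11}^{(M+1)}(\kappa_i,\kappa_j)&-\widehat K_{01}^{(M)}(\kappa_i,\lambda_j)&-\widehat K_1^{(M)}(\kappa_i)\\ \widehat K_{01}^{(M)}(\kappa_j,\lambda_i)&-s\widehat K_{00}^{(M-1)}(\lambda_i,\lambda_j)&-s\widehat K_0^{(M-1)}(\lambda_i)\\ \widehat K_1^{(M)}(\kappa_j)&s\widehat K_0^{(M-1)}(\lambda_j)&0\end{bmatrix}.$$ Here $i,j$ run over $1,\dots,k$ in the first block and over $1,\dots,l$ in the second block. **(2)** For every $\alpha$ as in the setting (not necessarily real), every $N\ge0$ ($N\ge2$ in the first formula), and pairwise different $\kappa,\kappa_1,\kappa_2\in\mathbb C\setminus[0,\infty)$, $\lambda,\lambda_1,\lambda_2\in\mathbb C$, each of the following holds whenever the constants $Z^{(\cdot,\mathrm B)}_0$, $Z^{(\cdot,\mathrm C)}_0$, $\widehat Z^{(\cdot)}$ in its denominators are nonzero: $$\frac{Z^{(N,\mathrm B)}_{2|0}(\kappa_1,\kappa_2)}{Z^{(N,\mathrm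 B)}_0}=\frac1{\kappa_2-\kappa_1}\,\frac{Z^{(N-1,\mathrm C)}_{1|0;1|0}(\kappa_1;\kappa_2)-Z^{(N-1,\mathrm C)}_{1|0;1|0}(\kappa_2;\kappa_1)}{\widehat Z^{(N-1)}},$$ $$\frac{Z^{(N,\mathrm B)}_{1|1}(\kappa,\lambda)}{Z^{(N,\mathrm B)}_0}=\frac{Z^{(N,\mathrm C)}_{0|0;1|1}(\kappa,\lambda)+Z^{(N,\mathrm C)}_{1|1;0|0}(\kappa,\lambda)}{2Z^{(N,\mathrm C)}_0},$$ $$\frac{Z^{(N,\mathrm B)}_{0|2}(\lambda_1,\lambda_2)}{Z^{(N,\mathrm B)}_0}=\frac1{\lambda_1-\lambda_2}\,\frac{Z^{(N+1,\mathrm C)}_{0|1;0|1}(\lambda_1;\lambda_2)-Z^{(N+1,\mathrm C)}_{0|1;0|1}(\lambda_2;\lambda_1)}{\widehat Z^{(N+1)}},$$ $$\frac{Z^{(N,\mathrm B)}_{1|0}(\kappa)}{Z^{(N,\mathrm B)}_0}=\frac{Z^{(N,\mathrm C)}_{0|0;1|0}(\kappa)+Z^{(N,\mathrm C)}_{1|0;0|0}(\kappa)}{2Z^{(N,\mathrm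 C)}_0},\qquad \frac{Z^{(N,\mathrm B)}_{0|1}(\lambda)}{Z^{(N,\mathrm B)}_0}=\frac{Z^{(N+1,\mathrm C)}_{0|1;0|0}(\lambda)-Z^{(N+1,\mathrm C)}_{0|0;0|1}(\lambda)}{\widehat Z^{(N+1)}}.$$ -/

import Mathlib

open MeasureTheory
open scoped ComplexOrder

namespace CauchyBures

/-- The open orthant `(0, ∞)^N`. -/
def orthant (N : ℕ) : Set (Fin N → ℝ) :=
  Set.univ.pi fun _ => Set.Ioi 0

/-- The Vandermonde product `Δ_n(u) = ∏_{i<j} (u_j - u_i)`. -/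
def vand {R : Type*} [CommRing R] {n : ℕ} (u : Fin n → R) : R :=
  ∏ i, ∏ j ∈ Finset.Ioi i, (u j - u i)

/-- The ratio of products `∏_i (z - lam_i) / ∏_i (z - kap_i)`. -/
noncomputable def charRatio {k l : ℕ} (kap : Fin k → ℂ) (lam : Fin l → ℂ) (z : ℝ) : ℂ :=
  (∏ i, ((z : ℂ) - lam i)) / ∏ i, ((z : ℂ) - kap i)

/-- The joint density of the Cauchy-like two-matrix model (without normalization):
`Δ(x)² Δ(y)² / ∏_{i,j} (x_i + y_j) * ∏_j α(x_j) α(y_j) y_j`. -/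
noncomputable def cauchyDensity (α : ℝ → ℂ) {N : ℕ} (x y : Fin N → ℝ) : ℂ :=
  ((vand x ^ 2 * vand y ^ 2 / ∏ i, ∏ j, (x i + y j) : ℝ) : ℂ) *
    ∏ j, (α (x j) * α (y j) * (y j : ℂ))

/-- The partition function `Z^{(N,C)}_{k₁|l₁;k₂|l₂}[α](kap₁, lam₁; kap₂, lam₂)` of the
Cauchy-like two-matrix model. -/
noncomputable def ZC (α : ℝ → ℂ) (N : ℕ) {k₁ l₁ k₂ l₂ : ℕ}
    (kap₁ : Fin k₁ → ℂ) (lam₁ : Fin l₁ → ℂ) (kap₂ : Fin k₂ → ℂ) (lam₂ : Fin l₂ → ℂ) : ℂ :=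
  1 / (N.factorial : ℂ) ^ 2 *
    ∫ p : (Fin N → ℝ) × (Fin N → ℝ) in orthant N ×ˢ orthant N,
      cauchyDensity α p.1 p.2 *
        ∏ j, (charRatio kap₁ lam₁ (p.1 j) * charRatio kap₂ lam₂ (p.2 j))

/-- The normalization constant `Z^{(N,C)}_{0|0;0|0}[α]`. -/
noncomputable def ZC₀ (α : ℝ → ℂ) (N : ℕ) : ℂ :=
  ZC α N ![] ![] ![] ![]

/-- The unnormalized mean of `∑_j (x_j - y_j)` in the Cauchy-like two-matrix model. -/
noncomputable def ZHat (α : ℝ → ℂ) (L : ℕ) : ℂ :=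
  1 / (L.factorial : ℂ) ^ 2 *
    ∫ p : (Fin L → ℝ) × (Fin L → ℝ) in orthant L ×ˢ orthant L,
      cauchyDensity α p.1 p.2 * ((∑ j, (p.1 j - p.2 j) : ℝ) : ℂ)

/-- The partition function `Z^{(N,B)}_{k|l}[α](kap, lam)` of the Bures-like ensemble. -/
noncomputable def ZB (α : ℝ → ℂ) (N : ℕ) {k l : ℕ} (kap : Fin k → ℂ) (lam : Fin l → ℂ) : ℂ :=
  1 / (N.factorial : ℂ) *
    ∫ z : Fin N → ℝ in orthant N,
      ((vand z ^ 2 / ∏ i, ∏ j ∈ Finset.Ioi i, (z i + z j) : ℝ) : ℂ) *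
        ∏ j, (α (z j) * charRatio kap lam (z j))

/-- The normalization constant `Z^{(N,B)}_{0|0}[α]`. -/
noncomputable def ZB₀ (α : ℝ → ℂ) (N : ℕ) : ℂ :=
  ZB α N ![] ![]

/-- The mixed Cauchy-Vandermonde quantity
`B_{k|l}(kap; lam) = Δ_k(kap) Δ_l(lam) / ∏_{i,j} (kap_i - lam_j)`. -/
noncomputable def berB {k l : ℕ} (kap : Fin k → ℂ) (lam : Fin l → ℂ) : ℂ :=
  vand kap * vand lam / ∏ i, ∏ j, (kap i - lam j)

/-- The kernel with two characteristic polynomials in the denominator. -/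
noncomputable def K11 (α : ℝ → ℂ) (L : ℕ) (kap₁ kap₂ : ℂ) : ℂ :=
  (ZC α L ![kap₁] ![] ![kap₂] ![] - ZC α L ![kap₂] ![] ![kap₁] ![]) / (2 * ZC₀ α (L - 1))

/-- The kernel with one characteristic polynomial in the numerator and one in the denominator. -/
noncomputable def K01 (α : ℝ → ℂ) (L : ℕ) (kap lam : ℂ) : ℂ :=
  (ZC α L ![] ![] ![kap] ![lam] + ZC α L ![kap] ![lam] ![] ![]) / (2 * ZC₀ α L * (lam - kap))

/-- The kernel with two characteristic polynomials in the numerator. It vanishes for `L = 0`, so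
that `K00 α (M - 1)` with truncated subtraction is zero for `M = 0`. -/
noncomputable def K00 (α : ℝ → ℂ) (L : ℕ) (lam₁ lam₂ : ℂ) : ℂ :=
  (ZC α L ![] ![lam₂] ![] ![lam₁] - ZC α L ![] ![lam₁] ![] ![lam₂]) / (2 * ZC₀ α (L + 1))

/-- The kernel with a single characteristic polynomial in the denominator. -/
noncomputable def K1 (α : ℝ → ℂ) (L : ℕ) (kap : ℂ) : ℂ :=
  -((ZC α L ![] ![] ![kap] ![] + ZC α L ![kap] ![] ![] ![]) / (2 * ZC₀ α L))

/-- The kernel with a single characteristic polynomial in the numerator. It vanishes for `L = 0`. -/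
noncomputable def K0 (α : ℝ → ℂ) (L : ℕ) (lam : ℂ) : ℂ :=
  (ZC α L ![] ![] ![] ![lam] - ZC α L ![] ![lam] ![] ![]) / (2 * ZC₀ α (L + 1))

/-- The Pfaffian: for `n = 2m` it is
`1 / (2^m m!) * ∑_σ sgn σ ∏_{i<m} A_{σ(2i), σ(2i+1)}`; it is zero for odd `n`. -/
noncomputable def pfaffian {n : ℕ} (A : Matrix (Fin n) (Fin n) ℂ) : ℂ :=
  if Even n then
    1 / (2 ^ (n / 2) * ((n / 2).factorial : ℂ)) *
      ∑ σ : Equiv.Perm (Fin n), ((Equiv.Perm.sign σ : ℤ) : ℂ) *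
        ∏ i : Fin (n / 2), A (σ ⟨2 * i, by omega⟩) (σ ⟨2 * i + 1, by omega⟩)
  else 0

/-- The antisymmetric kernel matrix for `k + l` even, with `M = N + l - k`. -/
noncomputable def kernelEven (α : ℝ → ℂ) (s : ℂ) (M : ℕ) {k l : ℕ}
    (kap : Fin k → ℂ) (lam : Fin l → ℂ) : Matrix (Fin k ⊕ Fin l) (Fin k ⊕ Fin l) ℂ :=
  Matrix.fromBlocks
    (Matrix.of fun i j => -s * K11 α (M + 1) (kap i) (kap j))
    (Matrix.of fun i j => -K01 α M (kap i) (lam j))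
    (Matrix.of fun i j => K01 α M (kap j) (lam i))
    (Matrix.of fun i j => -s * K00 α (M - 1) (lam i) (lam j))

/-- The antisymmetric kernel matrix for `k + l` odd, with `M = N + l - k + 1`. -/
noncomputable def kernelOdd (α : ℝ → ℂ) (s : ℂ) (M : ℕ) {k l : ℕ}
    (kap : Fin k → ℂ) (lam : Fin l → ℂ) :
    Matrix ((Fin k ⊕ Fin l) ⊕ Fin 1) ((Fin k ⊕ Fin l) ⊕ Fin 1) ℂ :=
  Matrix.fromBlocks
    (kernelEven α s M kap lam)
    (Matrix.of fun i _ =>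
      Sum.elim (fun a => -K1 α M (kap a)) (fun b => -s * K0 α (M - 1) (lam b)) i)
    (Matrix.of fun _ j =>
      Sum.elim (fun a => K1 α M (kap a)) (fun b => s * K0 α (M - 1) (lam b)) j)
    0

/-- The sign `s` of the real number `ZHat α L`. -/
noncomputable def meanSign (α : ℝ → ℂ) (L : ℕ) : ℂ :=
  (Real.sign (ZHat α L).re : ℂ)

/-- All moments of `α` on `(0, ∞)` exist. -/
def HasAllMoments (α : ℝ → ℂ) : Prop :=
  ∀ n : ℕ, IntegrableOn (fun z : ℝ => (z : ℂ) ^ n * α z) (Set.Ioi 0)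

/-- The points `kap` lie off the closed half line `[0, ∞)`, and all the points `kap`, `lam` are
pairwise different. -/
def Admissible {k l : ℕ} (kap : Fin k → ℂ) (lam : Fin l → ℂ) : Prop :=
  (∀ i, ∀ t : ℝ, 0 ≤ t → kap i ≠ t) ∧
    Function.Injective kap ∧ Function.Injective lam ∧ ∀ i j, kap i ≠ lam j

end CauchyBures

/-! Everything rests on the pointwise identity `(y - x) / (x + y) + 1 = 2 * y / (x + y)`. By Schur's
Pfaffian identity (`pfaffian_schur_identity`) and de Bruijn's formula, a Bures partition function is
a Gram Pfaffian of the alternating form `aForm` with kernel `(y - x) / (x + y)`, bordered by the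
moment functional `bForm` when the number of variables is odd (`ZB_eq_buresPf`). By the Cauchy
determinant and Andréief's formula, a two-matrix partition function is a Gram determinant of `cForm`
with kernel `y / (x + y)` (`ZC_eq_cauchyDet`). The identity says that `2 cForm = aForm + bForm ⊗
bForm` (`aForm_add_mul`).

An alternating matrix of odd size is degenerate, so certain minors of an alternating matrix are
products of two Pfaffians (`det_submatrix_eq_pfaffian_mul`). For a rank one perturbation of an
alternating form this gives `detGram_add_rank_one_cons`: the mixed determinant of the families `p,
h` and `q, h` equals `Pf(p, h) Pf(q, h) + Pf(h) Pf(p, q, h)`. The first product is symmetric in `p,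
q`, the second antisymmetric. Hence sums and differences of Cauchy partition functions with
exchanged arguments are products of two Bures partition functions. Suitable polynomial families
yield the formulas for one and two points, and also `2^n ZC₀ n = (ZB₀ n)^2` and `2^n ZHat (n+1) =
-ZB₀ n * ZB₀ (n+2)`. If all `ZB₀` are positive, then so is `ZC₀`, and `ZHat` is negative, so the
sign `s` is `-1`.

For general `k, l`, the weight `α / ∏ (z - κ_a)` turns all functions involved into polynomials of
degree below `M + k`. The Pfaffian `bigPf` of the form on this space, bordered by evaluations at the
`λ_b` (and by the top coefficient if `k + l` is odd), is computed in two bases. Splitting off the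
multiples of `∏ (X - κ_a)` gives, by the Schur complement, `ZB₀ M` times the Pfaffian of
`pointKernel`. Splitting off the multiples of `∏ (X - λ_b)`, which the evaluations annihilate, gives
the wanted Bures partition function times a Vandermonde determinant. Comparing the two gives
`ZB_zero_mul_pfOn_even` and `ZB_zero_mul_pfOn_odd`. Applied to just two points (one of them possibly
infinity) these same identities express every entry of `pointKernel` as a Bures partition function,
hence through the quadratic relations as one of the kernels `K11`, `K01`, `K00`, `K1`, `K0`. Powers
of `√2` are absorbed by a diagonal scaling. -/

namespace CauchyBures

/-! ### Pfaffians -/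

/-- The standard symplectic matrix on `Fin m × Fin 2`. -/
def sympl (m : ℕ) : Matrix (Fin m × Fin 2) (Fin m × Fin 2) ℂ :=
  fun a b => if a.1 = b.1 then ((b.2 : ℕ) : ℂ) - ((a.2 : ℕ) : ℂ) else 0

/-- The unnormalized Pfaffian of a matrix whose indices are grouped into pairs. -/
noncomputable def pairPf {m : ℕ} (A : Matrix (Fin m × Fin 2) (Fin m × Fin 2) ℂ) : ℂ :=
  ∑ σ : Equiv.Perm (Fin m × Fin 2), ((Equiv.Perm.sign σ : ℤ) : ℂ) *
    ∏ t, A (σ (t, 0)) (σ (t, 1))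

theorem prod_pairs {m : ℕ} (f : Fin m × Fin 2 → ℂ) :
    ∏ a, f a = ∏ t, (f (t, 0) * f (t, 1)) := by
  rw [Fintype.prod_prod_type]
  simp [Fin.prod_univ_two]

/-- A Cauchy–Binet argument: after expanding the product, the sum over `σ` for a fixed choice `g` of
inner indices is the determinant of `U` with columns selected by `g`. It vanishes unless `g` is a
permutation, and then it equals `sign g * det U`. -/
theorem pairPf_mul_mul_transpose {m : ℕ} (U J : Matrix (Fin m × Fin 2) (Fin m × Fin 2) ℂ) :
    pairPf (U * J * U.transpose) = U.det * pairPf J := by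
  have expand : ∀ σ : Equiv.Perm (Fin m × Fin 2),
      ∏ t, (U * J * U.transpose) (σ (t, 0)) (σ (t, 1)) =
        ∑ g : Fin m × Fin 2 → Fin m × Fin 2,
          (∏ t, J (g (t, 0)) (g (t, 1))) * ∏ a, U (σ a) (g a) := by
    intro σ
    have h1 : ∀ t, (U * J * U.transpose) (σ (t, 0)) (σ (t, 1)) =
        ∑ p : (Fin m × Fin 2) × (Fin m × Fin 2),
          J p.1 p.2 * (U (σ (t, 0)) p.1 * U (σ (t, 1)) p.2) := by
      intro t
      rw [Fintype.sum_prod_type_right]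
      simp only [Matrix.mul_apply, Matrix.transpose_apply, Finset.sum_mul]
      exact Finset.sum_congr rfl fun y _ => Finset.sum_congr rfl fun x _ => by ring
    simp only [h1]
    rw [Finset.prod_univ_sum, Fintype.piFinset_univ]
    -- Choosing a pair of indices for every `t` amounts to choosing a function on `Fin m × Fin 2`.
    refine Fintype.sum_equiv
      (((Equiv.curry (Fin m) (Fin 2) (Fin m × Fin 2)).trans
        (Equiv.arrowCongr (Equiv.refl _) (finTwoArrowEquiv _))).symm) _ _ ?_
    intro g
    rw [prod_pairs, ← Finset.prod_mul_distrib]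
    rfl
  have hdet : ∀ g : Fin m × Fin 2 → Fin m × Fin 2,
      ∑ σ : Equiv.Perm (Fin m × Fin 2), ((Equiv.Perm.sign σ : ℤ) : ℂ) * ∏ a, U (σ a) (g a) =
        (U.submatrix id g).det := by
    intro g
    rw [Matrix.det_apply']
    rfl
  unfold pairPf
  simp only [expand, Finset.mul_sum]
  rw [Finset.sum_comm]
  have step : ∀ g : Fin m × Fin 2 → Fin m × Fin 2,
      ∑ σ : Equiv.Perm (Fin m × Fin 2), ((Equiv.Perm.sign σ : ℤ) : ℂ) *
        ((∏ t, J (g (t, 0)) (g (t, 1))) * ∏ a, U (σ a) (g a)) =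
      (∏ t, J (g (t, 0)) (g (t, 1))) * (U.submatrix id g).det := by
    intro g
    rw [← hdet, Finset.mul_sum]
    exact Finset.sum_congr rfl fun σ _ => by ring
  simp only [step]
  have hzero : ∀ g : Fin m × Fin 2 → Fin m × Fin 2, ¬ Function.Bijective g →
      (U.submatrix id g).det = 0 := by
    intro g hg
    have hinj : ¬ Function.Injective g := fun h => hg (Finite.injective_iff_bijective.mp h)
    simp only [Function.Injective, not_forall] at hinj
    obtain ⟨a, b, hab, hne⟩ := hinj
    exact Matrix.det_zero_of_column_eq hne fun i => by simp [hab]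
  rw [← Finset.sum_subset (Finset.subset_univ
    (Finset.univ.filter fun g : Fin m × Fin 2 → Fin m × Fin 2 => Function.Bijective g))
    (fun g _ hg => by rw [hzero g (by simpa using hg), mul_zero])]
  refine (Finset.sum_bij (fun (σ : Equiv.Perm (Fin m × Fin 2)) _ => (σ : _ → _)) ?_ ?_ ?_ ?_).symm
  · intro σ _
    simp
  · intro σ _ τ _ h
    exact DFunLike.coe_injective h
  · intro g hg
    exact ⟨Equiv.ofBijective g (by simpa using hg), Finset.mem_univ _, rfl⟩
  · intro σ _
    rw [Matrix.det_permute']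
    ring

theorem sympl_prod_wreath {m : ℕ} (π : Equiv.Perm (Fin m)) (τ : Fin m → Equiv.Perm (Fin 2)) :
    ∏ t, sympl m (π t, τ t 0) (π t, τ t 1) = ∏ t, ((Equiv.Perm.sign (τ t) : ℤ) : ℂ) := by
  refine Finset.prod_congr rfl fun t _ => ?_
  have : ∀ s : Equiv.Perm (Fin 2), ((s 1 : ℕ) : ℤ) - ((s 0 : ℕ) : ℤ) = (Equiv.Perm.sign s : ℤ) := by
    decide
  simp only [sympl, if_true]
  rw [← this]
  push_cast
  rfl

/-- Only permutations that preserve the pairing contribute: they permute the pairs and flip inside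
each pair. Permuting the pairs acts on two copies and is even, while the flips give a sign that the
entries of `sympl` cancel. So each of the `2 ^ m * m!` terms is one. -/
theorem pairPf_sympl (m : ℕ) : pairPf (sympl m) = 2 ^ m * (m.factorial : ℂ) := by
  let Φ : Equiv.Perm (Fin m) × (Fin m → Equiv.Perm (Fin 2)) → Equiv.Perm (Fin m × Fin 2) :=
    fun p => (Equiv.prodCongrLeft fun _ => p.1) * Equiv.prodCongrRight p.2
  have hΦ : ∀ p t c, Φ p (t, c) = (p.1 t, p.2 t c) := by
    intro p t c
    rfl
  have hsign : ∀ p, Equiv.Perm.sign (Φ p) = ∏ t, Equiv.Perm.sign (p.2 t) := by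
    intro p
    simp only [Φ, map_mul, Equiv.Perm.sign_prodCongrLeft, Equiv.Perm.sign_prodCongrRight]
    simp
  have hcard : ∑ p : Equiv.Perm (Fin m) × (Fin m → Equiv.Perm (Fin 2)), (1 : ℂ) =
      2 ^ m * (m.factorial : ℂ) := by
    simp [Fintype.card_prod, Fintype.card_perm, mul_comm]
  rw [← hcard, pairPf]
  symm
  refine Finset.sum_bij_ne_zero (fun p _ _ => Φ p) (fun _ _ _ => Finset.mem_univ _) ?_ ?_ ?_
  · rintro ⟨π, τ⟩ _ _ ⟨π', τ'⟩ _ _ h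
    have h' : ∀ t c, (π t, τ t c) = (π' t, τ' t c) := fun t c => by
      have := DFunLike.congr_fun h (t, c)
      simpa only [hΦ] using this
    have h1 : π = π' := Equiv.ext fun t => congrArg Prod.fst (h' t 0)
    have h2 : τ = τ' := funext fun t => Equiv.ext fun c => congrArg Prod.snd (h' t c)
    rw [h1, h2]
  · intro g _ hg
    have hJ : ∀ t, sympl m (g (t, 0)) (g (t, 1)) ≠ 0 := by
      intro t ht
      exact hg (by rw [Finset.prod_eq_zero (Finset.mem_univ t) ht, mul_zero])
    have hfst : ∀ t, (g (t, 0)).1 = (g (t, 1)).1 := by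
      intro t
      by_contra h
      exact hJ t (by simp [sympl, h])
    have hc : ∀ c : Fin 2, c = 0 ∨ c = 1 := by decide
    have hg1 : ∀ t c, (g (t, c)).1 = (g (t, 0)).1 := by
      intro t c
      rcases hc c with rfl | rfl
      · rfl
      · exact (hfst t).symm
    have hτ : ∀ t, Function.Injective fun c => (g (t, c)).2 := by
      intro t c d hcd
      have : g (t, c) = g (t, d) := Prod.ext ((hg1 t c).trans (hg1 t d).symm) hcd
      exact congrArg Prod.snd (g.injective this)
    have hπ : Function.Surjective fun t => (g (t, 0)).1 := by
      intro s
      obtain ⟨⟨t, c⟩, h⟩ := g.surjective (s, 0)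
      exact ⟨t, by simp only [← hg1 t c, h]⟩
    refine ⟨(Equiv.ofBijective _ (Finite.surjective_iff_bijective.mp hπ), fun t =>
      Equiv.ofBijective _ (Finite.injective_iff_bijective.mp (hτ t))), Finset.mem_univ _,
      one_ne_zero, ?_⟩
    ext1 ⟨t, c⟩
    rw [hΦ]
    exact Prod.ext (hg1 t c).symm rfl
  · intro p _ _
    have h := sympl_prod_wreath p.1 p.2
    simp only [hΦ, h, hsign]
    push_cast
    rw [← Finset.prod_mul_distrib]
    symm
    refine Finset.prod_eq_one fun t _ => ?_
    rcases Int.units_eq_one_or (Equiv.Perm.sign (p.2 t)) with h | h <;> simp [h]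

theorem pfaffian_eq_pairPf {m : ℕ} (A : Matrix (Fin (m * 2)) (Fin (m * 2)) ℂ) :
    pfaffian A = 1 / (2 ^ m * (m.factorial : ℂ)) *
      pairPf (A.submatrix finProdFinEquiv finProdFinEquiv) := by
  have hm : m * 2 / 2 = m := Nat.mul_div_cancel m two_pos
  rw [pfaffian, if_pos (even_two.mul_left m), pairPf]
  congr 1
  · simp only [hm]
  refine Fintype.sum_equiv (finProdFinEquiv (m := m) (n := 2)).symm.permCongr _ _ fun σ => ?_
  rw [Equiv.Perm.sign_permCongr]
  congr 1
  refine Fintype.prod_equiv (finCongr hm) _ _ fun i => ?_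
  simp only [Matrix.submatrix_apply, Equiv.permCongr_apply, Equiv.symm_symm,
    Equiv.apply_symm_apply]
  congr 2 <;> refine Fin.ext ?_ <;> simp [finProdFinEquiv, add_comm]

theorem pfaffian_of_odd {n : ℕ} (hn : ¬ Even n) (A : Matrix (Fin n) (Fin n) ℂ) :
    pfaffian A = 0 := by
  rw [pfaffian, if_neg hn]

/-- The Pfaffian of a matrix that is pulled back from the standard symplectic matrix. -/
theorem pfaffian_mul_sympl {m : ℕ} (U : Matrix (Fin (m * 2)) (Fin m × Fin 2) ℂ) :
    pfaffian (U * sympl m * U.transpose) = (U.submatrix finProdFinEquiv id).det := by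
  have h := pairPf_mul_mul_transpose (U.submatrix finProdFinEquiv id) (sympl m)
  rw [pairPf_sympl] at h
  rw [pfaffian_eq_pairPf]
  have h2 : (U * sympl m * U.transpose).submatrix (finProdFinEquiv (m := m) (n := 2))
      (finProdFinEquiv (m := m) (n := 2)) =
      U.submatrix finProdFinEquiv id * sympl m * (U.submatrix finProdFinEquiv id).transpose := by
    ext i j
    simp [Matrix.mul_apply]
  rw [h2, h]
  have : (2 ^ m * (m.factorial : ℂ)) ≠ 0 := by positivity
  field_simp

/-- An alternating matrix supported on at most `2 m + 1` indices is a sum of `m` elementary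
alternating matrices. -/
theorem exists_wedge_sum {ι : Type*} [DecidableEq ι] (m : ℕ) :
    ∀ (s : Finset ι) (A : ι → ι → ℂ), s.card ≤ 2 * m + 1 → (∀ i j, A i j = -A j i) →
      (∀ i j, i ∉ s → A i j = 0) →
      ∃ u v : Fin m → ι → ℂ, ∀ i j, A i j = ∑ t, (u t i * v t j - v t i * u t j) := by
  induction m with
  | zero =>
    intro s A hs hA hsupp
    refine ⟨fun _ _ => 0, fun _ _ => 0, fun i j => ?_⟩
    have hd : ∀ i, A i i = 0 := fun i => by
      have := hA i i
      exact self_eq_neg.mp this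
    by_cases hi : i ∈ s
    · by_cases hj : j ∈ s
      · have : i = j := Finset.card_le_one.mp (by omega) i hi j hj
        simp [this, hd]
      · simp [hA i j, hsupp j i hj]
    · simp [hsupp i j hi]
  | succ m ih =>
    intro s A hs hA hsupp
    by_cases hzero : ∀ i j, A i j = 0
    · exact ⟨fun _ _ => 0, fun _ _ => 0, fun i j => by simp [hzero]⟩
    push Not at hzero
    obtain ⟨p, q, hpq⟩ := hzero
    have hd : ∀ i, A i i = 0 := fun i => self_eq_neg.mp (hA i i)
    have hp : p ∈ s := by
      by_contra h
      exact hpq (hsupp p q h)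
    have hq : q ∈ s := by
      by_contra h
      exact hpq (by rw [hA, hsupp q p h, neg_zero])
    have hne : q ≠ p := by
      rintro rfl
      exact hpq (hd q)
    -- Subtracting the elementary alternating matrix built from rows `p` and `q` kills both rows, so
    -- the support loses two indices. A leftover single index carries only a zero diagonal entry,
    -- whence the bound `2 * m + 1`.
    let B : ι → ι → ℂ := fun i j => A i j - (A p i * A q j - A q i * A p j) / A p q
    have hqp : A q p = -A p q := hA q p
    obtain ⟨u, v, huv⟩ := ih ((s.erase p).erase q) B
      (by
        rw [Finset.card_erase_of_mem (Finset.mem_erase.mpr ⟨hne, hq⟩),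
          Finset.card_erase_of_mem hp]
        omega)
      (fun i j => by
        simp only [B]
        rw [hA i j]
        ring)
      (fun i j hi => by
        simp only [Finset.mem_erase, not_and, B] at hi ⊢
        by_cases h1 : i = q
        · subst h1
          rw [hd]
          field_simp
          ring
        · by_cases h2 : i = p
          · subst h2
            rw [hd, hqp]
            field_simp
            ring
          · have hi' := hi h1 h2
            rw [hsupp i j hi', hA p i, hA q i, hsupp i p hi', hsupp i q hi']
            simp)
    refine ⟨Fin.cons (fun i => A p i / A p q) u, Fin.cons (fun i => A q i) v, fun i j => ?_⟩
    rw [Fin.sum_univ_succ]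
    simp only [Fin.cons_zero, Fin.cons_succ]
    rw [← huv]
    simp only [B]
    field_simp
    ring

theorem mul_sympl_mul_transpose_apply {m : ℕ} {ι : Type*} [Fintype ι]
    (U V : Matrix ι (Fin m × Fin 2) ℂ) (i j : ι) :
    (U * sympl m * V.transpose) i j =
      ∑ t, (U i (t, 0) * V j (t, 1) - U i (t, 1) * V j (t, 0)) := by
  have h : ∀ a : Fin m × Fin 2, (U * sympl m) i a =
      U i (a.1, 0) * ((a.2 : ℕ) : ℂ) + U i (a.1, 1) * (((a.2 : ℕ) : ℂ) - 1) := by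
    intro a
    rw [Matrix.mul_apply, Fintype.sum_prod_type, Finset.sum_eq_single a.1]
    · simp [sympl, Fin.sum_univ_two]
    · intro b _ hb
      simp [sympl, hb]
    · simp
  rw [Matrix.mul_apply, Fintype.sum_prod_type]
  refine Finset.sum_congr rfl fun t _ => ?_
  rw [Fin.sum_univ_two, h, h]
  simp
  ring

/-- The bound `2 * m + 1`, not `2 * m`, matters: an alternating matrix of odd size has a kernel and
factors through one dimension less. All the bilinear Pfaffian identities come from this extra index.
-/
theorem exists_eq_mul_sympl {m : ℕ} {ι : Type*} [Fintype ι] [DecidableEq ι]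
    (hι : Fintype.card ι ≤ 2 * m + 1) (A : Matrix ι ι ℂ) (hA : A.transpose = -A) :
    ∃ U : Matrix ι (Fin m × Fin 2) ℂ, A = U * sympl m * U.transpose := by
  obtain ⟨u, v, h⟩ := exists_wedge_sum m Finset.univ A (by simpa using hι)
    (fun i j => by
      have := congrFun (congrFun hA j) i
      simpa using this) (fun i j hi => absurd (Finset.mem_univ i) hi)
  refine ⟨Matrix.of fun i a => if a.2 = 0 then u a.1 i else v a.1 i, ?_⟩
  ext i j
  rw [h, mul_sympl_mul_transpose_apply]
  simp

/-- The Pfaffian of a matrix whose indices are enumerated by `e`. -/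
noncomputable def pfOn {ι : Type*} {n : ℕ} (e : ι ≃ Fin n) (A : Matrix ι ι ℂ) : ℂ :=
  pfaffian (A.submatrix e.symm e.symm)

theorem pfaffian_submatrix_perm {n : ℕ} (σ : Equiv.Perm (Fin n)) (A : Matrix (Fin n) (Fin n) ℂ) :
    pfaffian (A.submatrix σ σ) = ((Equiv.Perm.sign σ : ℤ) : ℂ) * pfaffian A := by
  by_cases hn : Even n
  · rw [pfaffian, pfaffian, if_pos hn, if_pos hn, mul_left_comm]
    congr 1
    rw [Finset.mul_sum]
    refine Fintype.sum_equiv (Equiv.mulLeft σ) _ _ fun τ => ?_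
    simp only [Equiv.coe_mulLeft, map_mul, Matrix.submatrix_apply, Equiv.Perm.mul_apply]
    rw [← mul_assoc]
    congr 1
    push_cast
    rw [← mul_assoc]
    rcases Int.units_eq_one_or (Equiv.Perm.sign σ) with h | h <;> simp [h]
  · simp [pfaffian_of_odd hn]

/-- Changes the index type while keeping the order of the enumeration, so that no sign appears.
Comparing values in `ℕ` allows `n` and `n'` to be equal only propositionally. -/
theorem pfOn_congr {ι ι' : Type*} {n n' : ℕ} (e : ι ≃ Fin n) (e' : ι' ≃ Fin n') (σ : ι' ≃ ι)
    (h : ∀ i, ((e' i : Fin n') : ℕ) = e (σ i)) (A : Matrix ι ι ℂ) :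
    pfOn e A = pfOn e' (A.submatrix σ σ) := by
  obtain rfl : n = n' := by
    have := Fintype.card_congr (e.symm.trans (σ.symm.trans e'))
    simpa using this
  have : e' = σ.trans e := Equiv.ext fun i => Fin.ext (h i)
  subst this
  unfold pfOn
  congr 1
  ext i j
  simp

theorem pfOn_self {n : ℕ} (A : Matrix (Fin n) (Fin n) ℂ) : pfOn (Equiv.refl _) A = pfaffian A := rfl

theorem exists_eq_mul_sympl_equiv {ι : Type*} [Fintype ι] [DecidableEq ι] {n : ℕ} (hn : Even n)
    (hι : Fintype.card ι ≤ n + 1) (A : Matrix ι ι ℂ) (hA : A.transpose = -A) :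
    ∃ m, n = m * 2 ∧ ∃ U : Matrix ι (Fin m × Fin 2) ℂ, A = U * sympl m * U.transpose := by
  obtain ⟨m, rfl⟩ := hn
  exact ⟨m, by ring, exists_eq_mul_sympl (by omega) A hA⟩

/-- Write `A = U J Uᵀ` where `U` has only `n` columns, although there may be `n + 1` indices. Then
the rows selected by `f` and `g` form square matrices `U_f`, `U_g`, the minor is `det U_f * det J *
det U_g` with `det J = 1`, and these determinants are the two Pfaffians. -/
theorem det_submatrix_eq_pfaffian_mul {ι : Type*} [Fintype ι] [DecidableEq ι] {n : ℕ} (hn : Even n)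
    (hι : Fintype.card ι ≤ n + 1) (A : Matrix ι ι ℂ) (hA : A.transpose = -A) (f g : Fin n → ι) :
    (A.submatrix f g).det = pfaffian (A.submatrix f f) * pfaffian (A.submatrix g g) := by
  obtain ⟨m, rfl, U, rfl⟩ := exists_eq_mul_sympl_equiv hn hι A hA
  have hsub : ∀ f g : Fin (m * 2) → ι, (U * sympl m * U.transpose).submatrix f g =
      U.submatrix f id * sympl m * (U.submatrix g id).transpose := by
    intro f g
    ext i j
    simp [Matrix.mul_apply]
  have hdet : ∀ f g : Fin (m * 2) → ι, ((U * sympl m * U.transpose).submatrix f g).det =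
      ((U.submatrix f id).submatrix finProdFinEquiv id).det * (sympl m).det *
        ((U.submatrix g id).submatrix finProdFinEquiv id).det := by
    intro f g
    rw [hsub, ← Matrix.det_submatrix_equiv_self (finProdFinEquiv (m := m) (n := 2)),
      ← Matrix.det_transpose ((U.submatrix g id).submatrix finProdFinEquiv id),
      ← Matrix.det_mul, ← Matrix.det_mul]
    rfl
  have hJ : (sympl m).det = 1 := by
    have hb : sympl m = (Matrix.blockDiagonal fun _ : Fin m => (!![0, 1; -1, 0] :
        Matrix (Fin 2) (Fin 2) ℂ)).submatrix Prod.swap Prod.swap := by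
      ext ⟨a, c⟩ ⟨b, d⟩
      by_cases h : a = b
      · subst h
        fin_cases c <;> fin_cases d <;> simp [sympl, Matrix.blockDiagonal_apply]
      · simp [sympl, Matrix.blockDiagonal_apply, h]
    rw [hb]
    have := Matrix.det_submatrix_equiv_self (Equiv.prodComm (Fin m) (Fin 2))
      (Matrix.blockDiagonal fun _ : Fin m => (!![0, 1; -1, 0] : Matrix (Fin 2) (Fin 2) ℂ))
    rw [show (Prod.swap : Fin m × Fin 2 → _) = Equiv.prodComm (Fin m) (Fin 2) from rfl, this,
      Matrix.det_blockDiagonal]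
    simp [Matrix.det_fin_two]
  rw [hdet, hJ, hsub f f, hsub g g, pfaffian_mul_sympl, pfaffian_mul_sympl, mul_one]

theorem pfaffian_sq {n : ℕ} (hn : Even n) (A : Matrix (Fin n) (Fin n) ℂ) (hA : A.transpose = -A) :
    pfaffian A ^ 2 = A.det := by
  have := det_submatrix_eq_pfaffian_mul hn (by simp) A hA id id
  simpa [sq] using this.symm

/-- Factoring `A` through `sympl` turns both Pfaffians into determinants, so this is
multiplicativity of `det`. For odd `n` both sides vanish by convention. -/
theorem pfOn_mul_mul_transpose {ι ι' : Type*} [Fintype ι] [Fintype ι'] {n : ℕ} (e : ι ≃ Fin n)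
    (e' : ι' ≃ Fin n) (B : Matrix ι ι' ℂ) (A : Matrix ι' ι' ℂ) (hA : A.transpose = -A) :
    pfOn e (B * A * B.transpose) = (B.submatrix e.symm e'.symm).det * pfOn e' A := by
  classical
  by_cases hn : Even n
  · obtain ⟨m, rfl, U, rfl⟩ := exists_eq_mul_sympl_equiv hn
      (by simp [Fintype.card_congr e']) A hA
    have h1 : (B * (U * sympl m * U.transpose) * B.transpose).submatrix e.symm e.symm =
        (B.submatrix e.symm e'.symm * U.submatrix e'.symm id) * sympl m *
        (B.submatrix e.symm e'.symm * U.submatrix e'.symm id).transpose := by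
      rw [Matrix.submatrix_mul_equiv B U e.symm e'.symm id]
      have : B * (U * sympl m * U.transpose) * B.transpose =
          (B * U) * sympl m * (B * U).transpose := by
        rw [Matrix.transpose_mul]
        simp only [Matrix.mul_assoc]
      rw [this]
      ext i j
      simp [Matrix.mul_apply]
    have h2 : (U * sympl m * U.transpose).submatrix e'.symm e'.symm =
        U.submatrix e'.symm id * sympl m * (U.submatrix e'.symm id).transpose := by
      ext i j
      simp [Matrix.mul_apply]
    rw [pfOn, pfOn, h1, h2, pfaffian_mul_sympl, pfaffian_mul_sympl]
    rw [← Matrix.det_submatrix_equiv_self (finProdFinEquiv (m := m) (n := 2))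
      (B.submatrix e.symm e'.symm), ← Matrix.det_mul]
    congr 1
    exact (Matrix.submatrix_mul_equiv _ _ finProdFinEquiv finProdFinEquiv id).symm
  · simp [pfOn, pfaffian_of_odd hn]

theorem pfOn_mul_mul_transpose_self {ι : Type*} [Fintype ι] [DecidableEq ι] {n : ℕ} (e : ι ≃ Fin n)
    (B A : Matrix ι ι ℂ) (hA : A.transpose = -A) :
    pfOn e (B * A * B.transpose) = B.det * pfOn e A := by
  rw [pfOn_mul_mul_transpose e e B A hA, Matrix.det_submatrix_equiv_self]

/-- The enumeration of a disjoint union that lists the left summand first. -/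
def sumEnum {ι ι' : Type*} {m n : ℕ} (e : ι ≃ Fin m) (e' : ι' ≃ Fin n) : ι ⊕ ι' ≃ Fin (m + n) :=
  (e.sumCongr e').trans finSumFinEquiv

@[simp]
theorem sumEnum_inl {ι ι' : Type*} {m n : ℕ} (e : ι ≃ Fin m) (e' : ι' ≃ Fin n) (i : ι) :
    sumEnum e e' (Sum.inl i) = Fin.castAdd n (e i) := rfl

@[simp]
theorem sumEnum_inr {ι ι' : Type*} {m n : ℕ} (e : ι ≃ Fin m) (e' : ι' ≃ Fin n) (i : ι') :
    sumEnum e e' (Sum.inr i) = Fin.natAdd m (e' i) := rfl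

/-- Both blocks factor through standard symplectic matrices, and the block sum of these is again
standard in the order given by `sumEnum`. The claim reduces to the determinant of a block diagonal
matrix. -/
theorem pfOn_fromBlocks_diag {ι ι' : Type*} [Fintype ι] [Fintype ι'] [DecidableEq ι]
    [DecidableEq ι'] {m n : ℕ} (e : ι ≃ Fin m) (e' : ι' ≃ Fin n) (hm : Even m)
    (A : Matrix ι ι ℂ) (D : Matrix ι' ι' ℂ) (hA : A.transpose = -A) (hD : D.transpose = -D) :
    pfOn (sumEnum e e') (Matrix.fromBlocks A 0 0 D) = pfOn e A * pfOn e' D := by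
  by_cases hn : Even n
  · obtain ⟨p, rfl, U, rfl⟩ := exists_eq_mul_sympl_equiv hm (by simp [Fintype.card_congr e]) A hA
    obtain ⟨q, rfl, V, rfl⟩ := exists_eq_mul_sympl_equiv hn (by simp [Fintype.card_congr e']) D hD
    let s : (Fin p × Fin 2) ⊕ (Fin q × Fin 2) ≃ Fin (p + q) × Fin 2 :=
      (Equiv.sumProdDistrib _ _ _).symm.trans (finSumFinEquiv.prodCongr (Equiv.refl _))
    have hval : ∀ a, ((sumEnum (finProdFinEquiv (m := p) (n := 2))
        (finProdFinEquiv (m := q) (n := 2)) a : Fin _) : ℕ) = finProdFinEquiv (s a) := by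
      rintro (⟨a, c⟩ | ⟨a, c⟩)
      · simp [s, finProdFinEquiv]
      · simp [s, finProdFinEquiv]
        ring
    let J : Matrix ((Fin p × Fin 2) ⊕ (Fin q × Fin 2)) ((Fin p × Fin 2) ⊕ (Fin q × Fin 2)) ℂ :=
      Matrix.fromBlocks (sympl p) 0 0 (sympl q)
    have hsT : ∀ r, (sympl r).transpose = -sympl r := by
      intro r
      ext a b
      simp only [sympl, Matrix.transpose_apply, Matrix.neg_apply, eq_comm (a := b.1)]
      split_ifs <;> simp
    have hJ : J = (sympl (p + q)).submatrix s s := by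
      ext a b
      rcases a with ⟨a, c⟩ | ⟨a, c⟩ <;> rcases b with ⟨b, d⟩ | ⟨b, d⟩ <;>
        simp [J, s, sympl, Fin.ext_iff] <;> omega
    have hfull : ∀ r, pfOn (finProdFinEquiv (m := r) (n := 2)) (sympl r) = 1 := by
      intro r
      have h := pairPf_sympl r
      rw [pfOn, pfaffian_eq_pairPf]
      simp only [Matrix.submatrix_submatrix, Equiv.symm_comp_self, Matrix.submatrix_id_id]
      rw [h]
      have : (2 ^ r * (r.factorial : ℂ)) ≠ 0 := by positivity
      field_simp
    have hJ1 : pfOn (sumEnum (finProdFinEquiv (m := p) (n := 2))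
        (finProdFinEquiv (m := q) (n := 2))) J = 1 := by
      rw [hJ, ← pfOn_congr finProdFinEquiv _ s hval, hfull]
    have hblk : Matrix.fromBlocks (U * sympl p * U.transpose) 0 0 (V * sympl q * V.transpose) =
        Matrix.fromBlocks U 0 0 V * J * (Matrix.fromBlocks U 0 0 V).transpose := by
      simp [J, Matrix.fromBlocks_multiply, Matrix.fromBlocks_transpose]
    have hJT : J.transpose = -J := by
      simp [J, Matrix.fromBlocks_transpose, hsT, Matrix.fromBlocks_neg]
    rw [hblk, pfOn_mul_mul_transpose _ (sumEnum (finProdFinEquiv (m := p) (n := 2))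
        (finProdFinEquiv (m := q) (n := 2))) _ _ hJT, hJ1,
      pfOn_mul_mul_transpose e finProdFinEquiv U _ (hsT p),
      pfOn_mul_mul_transpose e' finProdFinEquiv V _ (hsT q), hfull, hfull]
    simp only [mul_one]
    rw [← Matrix.det_fromBlocks_zero₂₁ (U.submatrix e.symm finProdFinEquiv.symm) 0
      (V.submatrix e'.symm finProdFinEquiv.symm),
      ← Matrix.det_submatrix_equiv_self (finSumFinEquiv (m := p * 2) (n := q * 2))]
    congr 1
    ext i j
    rcases i with i | i <;> rcases j with j | j <;> simp [sumEnum]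
  · have hmn : ¬ Even (m + n) := by
      rw [Nat.even_add]
      tauto
    simp [pfOn, pfaffian_of_odd hn, pfaffian_of_odd hmn]

/-- The Schur complement formula for Pfaffians. -/
theorem pfOn_schur {ι ι' : Type*} [Fintype ι] [Fintype ι'] [DecidableEq ι]
    [DecidableEq ι'] {m n : ℕ} (e : ι ≃ Fin m) (e' : ι' ≃ Fin n) (hm : Even m)
    (P : Matrix ι ι ℂ) (Q : Matrix ι ι' ℂ) (S : Matrix ι' ι' ℂ) (hP : P.transpose = -P)
    (hS : S.transpose = -S) (hdet : P.det ≠ 0) :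
    pfOn (sumEnum e e') (Matrix.fromBlocks P Q (-Q.transpose) S) =
      pfOn e P * pfOn e' (S + Q.transpose * P⁻¹ * Q) := by
  have hu : IsUnit P.det := isUnit_iff_ne_zero.mpr hdet
  have hinv : P⁻¹.transpose = -P⁻¹ := by
    rw [Matrix.transpose_nonsing_inv, hP]
    refine Matrix.inv_eq_left_inv ?_
    rw [neg_mul_neg, Matrix.nonsing_inv_mul _ hu]
  have hT : (S + Q.transpose * P⁻¹ * Q).transpose = -(S + Q.transpose * P⁻¹ * Q) := by
    simp only [Matrix.transpose_add, Matrix.transpose_mul, hS, hinv, Matrix.transpose_transpose,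
      Matrix.neg_mul, Matrix.mul_neg, neg_add, Matrix.mul_assoc]
  rw [← pfOn_fromBlocks_diag e e' hm P _ hP hT]
  -- Since `P⁻¹` is alternating, one unipotent congruence clears both off-diagonal blocks.
  have hfac : Matrix.fromBlocks P Q (-Q.transpose) S =
      Matrix.fromBlocks 1 0 (-(Q.transpose * P⁻¹)) 1 *
        Matrix.fromBlocks P 0 0 (S + Q.transpose * P⁻¹ * Q) *
        (Matrix.fromBlocks 1 0 (-(Q.transpose * P⁻¹)) 1).transpose := by
    simp only [Matrix.fromBlocks_transpose, Matrix.fromBlocks_multiply, Matrix.transpose_neg,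
      Matrix.transpose_mul, hinv, Matrix.transpose_transpose, Matrix.transpose_one,
      Matrix.transpose_zero]
    congr 1
    · simp
    · simp [← Matrix.mul_assoc, Matrix.mul_nonsing_inv _ hu]
    · simp [Matrix.mul_assoc, Matrix.nonsing_inv_mul _ hu]
    · simp [Matrix.mul_assoc, Matrix.nonsing_inv_mul _ hu]
  have hDT : (Matrix.fromBlocks P 0 0 (S + Q.transpose * P⁻¹ * Q)).transpose =
      -Matrix.fromBlocks P 0 0 (S + Q.transpose * P⁻¹ * Q) := by
    simp only [Matrix.fromBlocks_transpose, hP, hT, Matrix.transpose_zero, Matrix.fromBlocks_neg,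
      neg_zero]
  rw [hfac, pfOn_mul_mul_transpose_self _ _ _ hDT, Matrix.det_fromBlocks_zero₁₂]
  simp

/-- Elimination of the first two indices in a Pfaffian. -/
theorem pfaffian_pivot {n : ℕ} (A : Matrix (Fin (n + 2)) (Fin (n + 2)) ℂ) (hA : A.transpose = -A)
    (h01 : A 0 1 ≠ 0) :
    pfaffian A = A 0 1 * pfaffian (Matrix.of fun i j : Fin n =>
      A i.succ.succ j.succ.succ -
        (A 0 i.succ.succ * A 1 j.succ.succ - A 1 i.succ.succ * A 0 j.succ.succ) / A 0 1) := by
  have hA' : ∀ i j, A i j = -A j i := fun i j => by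
    have := congrFun (congrFun hA j) i
    simpa using this
  have hd : ∀ i, A i i = 0 := fun i => self_eq_neg.mp (hA' i i)
  let σ : Fin 2 ⊕ Fin n → Fin (n + 2) := Sum.elim (fun c => Fin.castLE (by omega) c)
    fun i => i.succ.succ
  let P : Matrix (Fin 2) (Fin 2) ℂ := !![0, A 0 1; -A 0 1, 0]
  let Q : Matrix (Fin 2) (Fin n) ℂ := Matrix.of fun c j => A (σ (Sum.inl c)) j.succ.succ
  let S : Matrix (Fin n) (Fin n) ℂ := Matrix.of fun i j => A i.succ.succ j.succ.succ
  have hσ : Function.Bijective σ := by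
    rw [Fintype.bijective_iff_injective_and_card]
    refine ⟨?_, by simp [add_comm]⟩
    rintro (i | i) (j | j) h <;> simp [σ, Fin.ext_iff] at h ⊢ <;> omega
  have hblock : A.submatrix (Equiv.ofBijective σ hσ) (Equiv.ofBijective σ hσ) =
      Matrix.fromBlocks P Q (-Q.transpose) S := by
    ext i j
    rcases i with i | i <;> rcases j with j | j
    · fin_cases i <;> fin_cases j
      · exact hd 0
      · rfl
      · exact hA' 1 0
      · exact hd 1
    · rfl
    · exact hA' _ _
    · rfl
  have hS : S.transpose = -S := by
    ext i j
    exact hA' _ _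
  have hP : P.transpose = -P := by
    ext i j
    fin_cases i <;> fin_cases j <;> simp [P]
  have hdet : P.det = A 0 1 * A 0 1 := by
    simp [P, Matrix.det_fin_two]
  rw [← pfOn_self, pfOn_congr (Equiv.refl _) (sumEnum (Equiv.refl (Fin 2)) (Equiv.refl (Fin n)))
    (Equiv.ofBijective σ hσ) (by
      rintro (i | i)
      · simp [σ]
      · simp [σ]
        omega) A, hblock,
    pfOn_schur _ _ even_two P Q S hP hS (by rw [hdet]; exact mul_ne_zero h01 h01), pfOn_self,
    pfOn_self]
  congr 1
  · rw [pfaffian, if_pos even_two]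
    have : ∀ f : Equiv.Perm (Fin 2) → ℂ, ∑ σ, f σ = f 1 + f (Equiv.swap 0 1) := by
      intro f
      rw [show (Finset.univ : Finset (Equiv.Perm (Fin 2))) = {1, Equiv.swap 0 1} by decide,
        Finset.sum_pair (by decide)]
    rw [this]
    simp [P]
    ring
  · congr 1
    have hinv : P⁻¹ = !![0, -(A 0 1)⁻¹; (A 0 1)⁻¹, 0] := by
      refine Matrix.inv_eq_right_inv ?_
      ext i j
      fin_cases i <;> fin_cases j <;> simp [P, h01]
    ext i j
    rw [hinv]
    simp [S, Q, σ, Matrix.mul_apply, Fin.sum_univ_two]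
    have e1 : (Fin.castLE (by omega : 2 ≤ n + 2) 1) = 1 := rfl
    rw [e1]
    field_simp
    ring

theorem pfaffian_diagonal_mul_mul_diagonal {n : ℕ} (c : Fin n → ℂ) (A : Matrix (Fin n) (Fin n) ℂ)
    (hA : A.transpose = -A) :
    pfaffian (Matrix.of fun i j => c i * A i j * c j) = (∏ i, c i) * pfaffian A := by
  have h := pfOn_mul_mul_transpose_self (Equiv.refl (Fin n)) (Matrix.diagonal c) A hA
  rw [pfOn_self, Matrix.det_diagonal, pfOn_self] at h
  rw [← h]
  congr 1
  ext i j
  simp [Matrix.diagonal_transpose, Matrix.mul_diagonal, Matrix.diagonal_mul]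

/-- The matching pairs `i` with `l + i`; bringing partners next to each other takes `l (l - 1) / 2`
transpositions. -/
theorem pfaffian_one_block (l : ℕ) :
    pfOn (sumEnum (Equiv.refl (Fin l)) (Equiv.refl (Fin l))) (Matrix.fromBlocks 0 1 (-1) 0) =
      (-1) ^ (l * (l - 1) / 2) := by
  let kk : ℕ → ℕ → ℕ → ℂ := fun l i j => if j = i + l then 1 else if i = j + l then -1 else 0
  have main : ∀ l, pfaffian (Matrix.of fun i j : Fin (l + l) => kk l i j) =
      (-1) ^ (l * (l - 1) / 2) := by
    intro l
    induction l with
    | zero => simp [pfaffian]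
    | succ l ih =>
      -- `ρ` lists index `0`, its partner `l + 1`, and the rest in order. Moving the partner past
      -- `l` indices costs `(-1) ^ l`, and eliminating this pair leaves the same matrix for `l`.
      let ρ : Equiv.Perm (Fin (l + l + 1 + 1)) :=
        Equiv.Perm.decomposeFin.symm (0, (Fin.cycleRange (⟨l, by omega⟩ : Fin (l + l + 1))).symm)
      have hρ0 : ρ 0 = 0 := by simp [ρ]
      have hρ1 : ((ρ 1 : Fin _) : ℕ) = l + 1 := by
        have : ρ 1 = Fin.succ ((Fin.cycleRange (⟨l, by omega⟩ : Fin (l + l + 1))).symm 0) := by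
          simp [ρ]
        rw [this, Fin.cycleRange_symm_zero]
        simp
      have hρ2 : ∀ i : Fin (l + l), ((ρ i.succ.succ : Fin _) : ℕ) =
          if (i : ℕ) < l then (i : ℕ) + 1 else i + 2 := by
        intro i
        have : ρ i.succ.succ =
            Fin.succ ((Fin.cycleRange (⟨l, by omega⟩ : Fin (l + l + 1))).symm i.succ) := by
          simp [ρ]
        rw [this, Fin.cycleRange_symm_succ]
        by_cases h : (i : ℕ) < l
        · simp [Fin.succAbove, Fin.lt_def, h]
        · simp [Fin.succAbove, Fin.lt_def, h]
      have hsign : Equiv.Perm.sign ρ = (-1) ^ l := by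
        simp [ρ, Fin.sign_cycleRange]
      let K : Matrix (Fin (l + l + 1 + 1)) (Fin (l + l + 1 + 1)) ℂ :=
        Matrix.of fun i j => kk (l + 1) i j
      have hkT : ∀ l i j, l ≠ 0 → kk l i j = -kk l j i := by
        intro l i j hl
        simp only [kk]
        split_ifs <;> first | omega | simp
      have hK : pfaffian (Matrix.of fun i j : Fin (l + 1 + (l + 1)) => kk (l + 1) i j) =
          pfaffian K := by
        have := pfOn_congr (Equiv.refl (Fin (l + 1 + (l + 1)))) (Equiv.refl (Fin (l + l + 1 + 1)))
          (finCongr (by omega)) (by intro i; simp)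
          (Matrix.of fun i j : Fin (l + 1 + (l + 1)) => kk (l + 1) i j)
        rw [pfOn_self, pfOn_self] at this
        rw [this]
        rfl
      have hperm := pfaffian_submatrix_perm ρ K
      have h01 : (K.submatrix ρ ρ) 0 1 = 1 := by
        simp [K, kk, hρ0, hρ1]
      have hpiv := pfaffian_pivot (K.submatrix ρ ρ)
        (by
          ext i j
          exact hkT _ _ _ (by omega))
        (by rw [h01]; exact one_ne_zero)
      have h0 : ∀ i : Fin (l + l), (K.submatrix ρ ρ) 0 i.succ.succ = 0 := by
        intro i
        have := i.2
        simp only [K, kk, Matrix.submatrix_apply, Matrix.of_apply, hρ0, hρ2, Fin.val_zero]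
        split_ifs <;> first | omega | rfl | contradiction
      rw [h01, one_mul] at hpiv
      have hrest : (Matrix.of fun i j : Fin (l + l) =>
          (K.submatrix ρ ρ) i.succ.succ j.succ.succ -
            ((K.submatrix ρ ρ) 0 i.succ.succ * (K.submatrix ρ ρ) 1 j.succ.succ -
              (K.submatrix ρ ρ) 1 i.succ.succ * (K.submatrix ρ ρ) 0 j.succ.succ) / 1) =
          Matrix.of fun i j : Fin (l + l) => kk l i j := by
        ext i j
        simp only [Matrix.of_apply, h0, zero_mul, mul_zero, sub_zero, zero_div]
        have := i.2
        have := j.2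
        simp only [K, kk, Matrix.submatrix_apply, Matrix.of_apply, hρ2]
        split_ifs <;> first | omega | rfl
      rw [hrest, ih, hperm, hsign] at hpiv
      rw [hK]
      have hlin : (((-1 : ℤˣ) ^ l : ℤˣ) : ℤ) = (-1) ^ l := by simp
      rw [hlin] at hpiv
      push_cast at hpiv
      have hsq : ((-1 : ℂ) ^ l) * (-1) ^ l = 1 := by
        rw [← mul_pow]
        simp
      have hexp : (l + 1) * (l + 1 - 1) / 2 = l + l * (l - 1) / 2 := by
        rcases l with _ | l
        · rfl
        · simp only [Nat.add_sub_cancel]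
          rw [show (l + 1 + 1) * (l + 1) = 2 * (l + 1) + (l + 1) * l by ring,
            Nat.mul_add_div two_pos]
      calc pfaffian K = ((-1) ^ l * (-1) ^ l) * pfaffian K := by rw [hsq, one_mul]
        _ = (-1) ^ l * (-1) ^ (l * (l - 1) / 2) := by rw [mul_assoc, hpiv]
        _ = _ := by rw [hexp, pow_add]
  rw [← main l, ← pfOn_self, pfOn_congr (Equiv.refl _)
    (sumEnum (Equiv.refl (Fin l)) (Equiv.refl (Fin l)))
    (sumEnum (Equiv.refl (Fin l)) (Equiv.refl (Fin l))) (fun _ => rfl)]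
  congr 1
  ext i j
  rcases i with i | i <;> rcases j with j | j <;>
    simp [kk, Matrix.one_apply, Fin.ext_iff] <;> split_ifs <;> first | omega | simp

/-- A Pfaffian with `l` linear constraints. -/
theorem pfOn_constraint {ι : Type*} [Fintype ι] [DecidableEq ι] {m l : ℕ} (e : ι ≃ Fin m)
    (hm : Even m) (A : Matrix ι ι ℂ) (hA : A.transpose = -A) (C : Matrix ι (Fin l) ℂ)
    (D E : Matrix (Fin l) (Fin l) ℂ) (hD : D.transpose = -D) :
    pfOn (sumEnum e (sumEnum (Equiv.refl (Fin l)) (Equiv.refl (Fin l))))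
      (Matrix.fromBlocks A (Matrix.fromCols C 0) (Matrix.fromRows (-C.transpose) 0)
        (Matrix.fromBlocks D E (-E.transpose) 0)) =
      pfOn e A * ((-1) ^ (l * (l - 1) / 2) * E.det) := by
  -- The congruence `B` starts from `A` next to a standard block and creates `C`, `D`, `E`. Half of
  -- `D` comes from each side, as `B` and its transpose both contribute; the determinant of `B` is
  -- that of `E`.
  let B : Matrix (ι ⊕ (Fin l ⊕ Fin l)) (ι ⊕ (Fin l ⊕ Fin l)) ℂ :=
    Matrix.fromBlocks 1 (Matrix.fromCols 0 (-C)) 0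
      (Matrix.fromBlocks 1 (-((1 / 2 : ℂ) • D)) 0 E.transpose)
  let J : Matrix (Fin l ⊕ Fin l) (Fin l ⊕ Fin l) ℂ := Matrix.fromBlocks 0 1 (-1) 0
  have hJ : J.transpose = -J := by
    simp [J, Matrix.fromBlocks_transpose, Matrix.fromBlocks_neg]
  have hfac : Matrix.fromBlocks A (Matrix.fromCols C 0) (Matrix.fromRows (-C.transpose) 0)
        (Matrix.fromBlocks D E (-E.transpose) 0) =
      B * Matrix.fromBlocks A 0 0 J * B.transpose := by
    have hhalf : (2 : ℂ)⁻¹ • D + (2 : ℂ)⁻¹ • D = D := by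
      rw [← add_smul]
      norm_num
    simp [B, J, Matrix.fromBlocks_transpose, Matrix.fromBlocks_multiply,
      Matrix.transpose_fromCols, Matrix.fromCols_mul_fromBlocks, Matrix.fromCols_mul_fromRows,
      Matrix.fromBlocks_mul_fromRows, hD, hhalf]
  have hAJ : (Matrix.fromBlocks A 0 0 J).transpose = -Matrix.fromBlocks A 0 0 J := by
    simp [Matrix.fromBlocks_transpose, Matrix.fromBlocks_neg, hA, hJ]
  rw [hfac, pfOn_mul_mul_transpose_self _ _ _ hAJ, pfOn_fromBlocks_diag _ _ hm _ _ hA hJ,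
    pfaffian_one_block]
  have hdet : B.det = E.det := by
    simp [B, Matrix.det_fromBlocks_zero₂₁]
  rw [hdet]
  ring

/-- Schur's Pfaffian identity. -/
theorem pfaffian_schur_identity (m : ℕ) : ∀ (z : Fin (m + m) → ℂ),
    (∀ i j, i ≠ j → z i + z j ≠ 0) →
    pfaffian (Matrix.of fun i j => (z j - z i) / (z i + z j)) =
      ∏ i, ∏ j ∈ Finset.Ioi i, (z j - z i) / (z i + z j) := by
  induction m with
  | zero =>
    intro z _
    simp [pfaffian]
  | succ m ih =>
    have key : ∀ (z : Fin (m + m + 1 + 1) → ℂ), (∀ i j, i ≠ j → z i + z j ≠ 0) →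
        pfaffian (Matrix.of fun i j => (z j - z i) / (z i + z j)) =
          ∏ i, ∏ j ∈ Finset.Ioi i, (z j - z i) / (z i + z j) := by
      intro z hz
      have hprod : ∏ i, ∏ j ∈ Finset.Ioi i, (z j - z i) / (z i + z j) =
          (z 1 - z 0) / (z 0 + z 1) *
            ((∏ i : Fin (m + m), (z i.succ.succ - z 0) / (z 0 + z i.succ.succ) *
              ((z i.succ.succ - z 1) / (z 1 + z i.succ.succ))) *
            ∏ i : Fin (m + m), ∏ j ∈ Finset.Ioi i, (z j.succ.succ - z i.succ.succ) /
              (z i.succ.succ + z j.succ.succ)) := by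
        rw [Fin.prod_univ_succ, Fin.prod_univ_succ]
        simp only [Fin.Ioi_zero_eq_map, Fin.Ioi_succ, Finset.prod_map, Fin.coe_succEmb,
          Fin.prod_univ_succ, Finset.prod_mul_distrib]
        simp only [Fin.succ_zero_eq_one]
        ring
      have hanti : (Matrix.of fun i j => (z j - z i) / (z i + z j)).transpose =
          -(Matrix.of fun i j => (z j - z i) / (z i + z j)) := by
        ext i j
        simp only [Matrix.transpose_apply, Matrix.of_apply, Matrix.neg_apply]
        rw [add_comm (z j), ← neg_div, neg_sub]
      rw [hprod]
      by_cases h01 : z 1 = z 0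
      -- Exchanging two equal points fixes the matrix but changes the sign of its Pfaffian, so both
      -- sides vanish; otherwise the entry at `0, 1` can serve as pivot.
      · have hp := pfaffian_submatrix_perm (Equiv.swap 0 1)
          (Matrix.of fun i j => (z j - z i) / (z i + z j))
        have hzs : ∀ i, z (Equiv.swap 0 1 i) = z i := by
          intro i
          rcases eq_or_ne i 0 with rfl | h0
          · rw [Equiv.swap_apply_left, h01]
          · rcases eq_or_ne i 1 with rfl | h1
            · rw [Equiv.swap_apply_right, h01]
            · rw [Equiv.swap_apply_of_ne_of_ne h0 h1]
        have hsub : (Matrix.of fun i j => (z j - z i) / (z i + z j)).submatrix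
            (Equiv.swap 0 1) (Equiv.swap 0 1) =
            Matrix.of fun i j => (z j - z i) / (z i + z j) := by
          ext i j
          simp [hzs]
        rw [hsub, Equiv.Perm.sign_swap (by simp)] at hp
        simp only [Units.val_neg, Units.val_one, Int.cast_neg, Int.cast_one, neg_mul,
          one_mul] at hp
        rw [self_eq_neg.mp hp, h01]
        simp
      · have h01' : z 1 - z 0 ≠ 0 := sub_ne_zero.mpr h01
        have hs : z 0 + z 1 ≠ 0 := hz 0 1 (by simp)
        rw [pfaffian_pivot _ hanti (div_ne_zero h01' hs), Matrix.of_apply]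
        congr 1
        -- Eliminating the first two points leaves the same matrix for the other points, scaled on
        -- both sides by `(z_i - z_0) (z_i - z_1) / ((z_0 + z_i) (z_1 + z_i))`.
        rw [← ih (fun i => z i.succ.succ) (fun i j hij => hz _ _ (by simpa using hij)),
          ← pfaffian_diagonal_mul_mul_diagonal]
        · congr 1
          ext i j
          simp only [Matrix.of_apply]
          -- A single `z i` may be zero, as happens when the point `0` is added in the odd case, so
          -- `2 * z i` cannot be cancelled and the diagonal is treated apart.
          rcases eq_or_ne i j with rfl | hij
          · rw [sub_self, zero_div, mul_zero, zero_mul,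
              mul_comm ((z i.succ.succ - z 0) / (z 0 + z i.succ.succ)), sub_self, zero_div,
              sub_zero]
          have h1 := hz 0 i.succ.succ (by simp [Fin.ext_iff])
          have h2 := hz 1 i.succ.succ (by simp [Fin.ext_iff])
          have h3 := hz 0 j.succ.succ (by simp [Fin.ext_iff])
          have h4 := hz 1 j.succ.succ (by simp [Fin.ext_iff])
          have h5 := hz i.succ.succ j.succ.succ (by simpa using hij)
          generalize z i.succ.succ = a at *
          generalize z j.succ.succ = b at *
          generalize z 0 = c at *
          generalize z 1 = d at *
          field_simp
          ring
        · ext i j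
          simp only [Matrix.transpose_apply, Matrix.of_apply, Matrix.neg_apply]
          rw [add_comm (z j.succ.succ), ← neg_div, neg_sub]
    have hcast : m + 1 + (m + 1) = m + m + 1 + 1 := by omega
    rw [hcast]
    exact key

/-! ### Gram Pfaffians of families of vectors and the quadratic identities between them -/

section Families

variable {W : Type*}

/-- The Pfaffian of the Gram matrix of a family of vectors. -/
noncomputable def pfGram (X : W → W → ℂ) {n : ℕ} (w : Fin n → W) : ℂ :=
  pfaffian (Matrix.of fun i j => X (w i) (w j))

/-- The determinant of the mixed Gram matrix of two families of vectors. -/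
noncomputable def detGram (X : W → W → ℂ) {n : ℕ} (f g : Fin n → W) : ℂ :=
  (Matrix.of fun i j => X (f i) (g j)).det

variable {X : W → W → ℂ}

theorem pfGram_comp_perm {n : ℕ} (w : Fin n → W) (σ : Equiv.Perm (Fin n)) :
    pfGram X (w ∘ σ) = ((Equiv.Perm.sign σ : ℤ) : ℂ) * pfGram X w :=
  pfaffian_submatrix_perm σ (Matrix.of fun i j => X (w i) (w j))

theorem pfGram_cons_cons_swap {n : ℕ} (p q : W) (h : Fin n → W) :
    pfGram X (Fin.cons q (Fin.cons p h) : Fin (n + 2) → W) =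
      -pfGram X (Fin.cons p (Fin.cons q h) : Fin (n + 2) → W) := by
  have := pfGram_comp_perm (X := X) (Fin.cons p (Fin.cons q h) : Fin (n + 2) → W) (Equiv.swap 0 1)
  rw [Equiv.Perm.sign_swap (by simp)] at this
  simp only [Units.val_neg, Units.val_one, Int.cast_neg, Int.cast_one, neg_mul, one_mul] at this
  rw [← this]
  congr 1
  ext i
  refine Fin.cases ?_ (fun i => Fin.cases ?_ (fun i => ?_) i) i
  · rw [Function.comp_apply, Equiv.swap_apply_left]
    rfl
  · rw [Function.comp_apply, Fin.succ_zero_eq_one, Equiv.swap_apply_right]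
    rfl
  · rw [Function.comp_apply, Equiv.swap_apply_of_ne_of_ne (by simp [Fin.ext_iff])
      (by simp [Fin.ext_iff])]
    rfl

/-- All entries lie in the Gram matrix of the `n + 2` vectors `p, q, h`. Its size is odd, so
`det_submatrix_eq_pfaffian_mul` applies to its minors of size `n + 1`. -/
theorem detGram_even (hX : ∀ a b, X a b = -X b a) {n : ℕ} (hn : Even (n + 1)) (p q : W)
    (h : Fin n → W) :
    detGram X (Fin.cons p h : Fin (n + 1) → W) (Fin.cons q h : Fin (n + 1) → W) =
      pfGram X (Fin.cons p h : Fin (n + 1) → W) * pfGram X (Fin.cons q h : Fin (n + 1) → W) := by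
  let w : Fin (n + 2) → W := Fin.cons p (Fin.cons q h)
  let r₁ : Fin (n + 1) → Fin (n + 2) := Fin.cons 0 fun i => i.succ.succ
  let r₂ : Fin (n + 1) → Fin (n + 2) := Fin.succ
  have h₁ : w ∘ r₁ = (Fin.cons p h : Fin (n + 1) → W) := by
    ext i
    refine Fin.cases rfl (fun i => rfl) i
  have h₂ : w ∘ r₂ = (Fin.cons q h : Fin (n + 1) → W) := by
    ext i
    rfl
  have := det_submatrix_eq_pfaffian_mul hn (by simp)
    (Matrix.of fun i j : Fin (n + 2) => X (w i) (w j)) (by ext i j; exact hX _ _) r₁ r₂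
  rw [← h₁, ← h₂]
  exact this

/-- Adjoin a vector `none` that pairs with `p` alone, and apply the even case to `none, p, h` and
`q, p, h`. The row of `none` has one nonzero entry, which reduces the determinant to the wanted one
and the first Pfaffian to that of `h`. -/
theorem detGram_odd (hX : ∀ a b, X a b = -X b a) {n : ℕ} (hn : Even n) (p q : W)
    (h : Fin n → W) :
    detGram X (Fin.cons p h : Fin (n + 1) → W) (Fin.cons q h : Fin (n + 1) → W) =
      pfGram X h * pfGram X (Fin.cons p (Fin.cons q h) : Fin (n + 2) → W) := by
  let w : Fin (n + 2) → W := Fin.cons p (Fin.cons q h)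
  let Y : Option (Fin (n + 2)) → Option (Fin (n + 2)) → ℂ := fun a b =>
    match a, b with
    | some i, some j => X (w i) (w j)
    | some i, none => if i = 0 then 1 else 0
    | none, some j => if j = 0 then -1 else 0
    | none, none => 0
  have hd : ∀ a, X a a = 0 := fun a => self_eq_neg.mp (hX a a)
  have hY : ∀ a b, Y a b = -Y b a := by
    rintro (_ | i) (_ | j)
    · simp [Y]
    · simp only [Y]
      split_ifs <;> simp
    · simp only [Y]
      split_ifs <;> simp
    · exact hX _ _
  let H : Fin (n + 1) → Option (Fin (n + 2)) := Fin.cons (some 0) fun i => some i.succ.succ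
  have main := detGram_even hY (n := n + 1) (by rw [Nat.even_add_one, Nat.even_add_one]; simpa)
    none (some 1) H
  have h1 : pfGram Y (Fin.cons none H : Fin (n + 2) → _) = -pfGram X h := by
    rw [pfGram, pfaffian_pivot _ (by ext i j; exact hY _ _) (by simp [Y, H])]
    have e01 : (Matrix.of fun i j : Fin (n + 2) => Y ((Fin.cons none H : Fin (n + 2) → _) i)
        ((Fin.cons none H : Fin (n + 2) → _) j)) 0 1 = -1 := by
      simp [Y, H, Fin.cons_one]
    have e0 : ∀ j : Fin n, (Matrix.of fun i j : Fin (n + 2) =>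
        Y ((Fin.cons none H : Fin (n + 2) → _) i)
        ((Fin.cons none H : Fin (n + 2) → _) j)) 0 j.succ.succ = 0 := by
      intro j
      simp [Y, H]
    rw [e01, neg_one_mul]
    simp only [e0]
    rw [pfGram]
    congr 2
    ext i j
    simp [Y, H, w]
  have h2 : pfGram Y (Fin.cons (some 1) H : Fin (n + 2) → _) =
      -pfGram X (Fin.cons p (Fin.cons q h) : Fin (n + 2) → W) := by
    rw [← pfGram_cons_cons_swap]
    unfold pfGram
    congr 1
    ext i j
    refine Fin.cases ?_ (fun i => Fin.cases ?_ (fun i => ?_) i) i <;>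
      refine Fin.cases ?_ (fun j => Fin.cases ?_ (fun j => ?_) j) j <;> rfl
  have h3 : detGram Y (Fin.cons none H : Fin (n + 2) → _) (Fin.cons (some 1) H : Fin (n + 2) → _) =
      detGram X (Fin.cons p h : Fin (n + 1) → W) (Fin.cons q h : Fin (n + 1) → W) := by
    rw [detGram, Matrix.det_succ_row_zero, Finset.sum_eq_single 1]
    · have e01 : (Matrix.of fun i j : Fin (n + 2) => Y ((Fin.cons none H : Fin (n + 2) → _) i)
          ((Fin.cons (some 1) H : Fin (n + 2) → _) j)) 0 1 = -1 := by
        simp [Y, H, Fin.cons_one]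
      rw [e01]
      simp only [Fin.val_one, pow_one, mul_neg, mul_one, neg_neg, one_mul]
      rw [detGram]
      congr 1
      ext i j
      have hs : ∀ j : Fin n, (Fin.succAbove (1 : Fin (n + 2)) j.succ) = j.succ.succ := by
        intro j
        rw [← Fin.succ_zero_eq_one, Fin.succ_succAbove_succ]
        rfl
      refine Fin.cases ?_ (fun i => ?_) i <;> refine Fin.cases ?_ (fun j => ?_) j
      · rfl
      · simp [hs, Y, H, w]
      · rfl
      · simp [hs, Y, H, w]
    · intro j _ hj
      have : (Matrix.of fun i j : Fin (n + 2) => Y ((Fin.cons none H : Fin (n + 2) → _) i)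
          ((Fin.cons (some 1) H : Fin (n + 2) → _) j)) 0 j = 0 := by
        revert hj
        refine Fin.cases ?_ (fun j => Fin.cases ?_ (fun j => ?_) j) j <;> intro hj
        · simp [Y]
        · exact absurd rfl hj
        · simp [Y, H]
      rw [this]
      ring
    · simp
  rw [h1, h2, h3] at main
  rw [main]
  ring

/-- The extension of an alternating form by one vector that pairs with the others through `b`. -/
def extForm (A : W → W → ℂ) (b : W → ℂ) : Option W → Option W → ℂ
  | some P, some Q => A P Q
  | none, some Q => b Q
  | some P, none => -b P
  | none, none => 0

theorem extForm_antisymm {A : W → W → ℂ} (hA : ∀ P Q, A P Q = -A Q P) (b : W → ℂ) (P Q : Option W) :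
    extForm A b P Q = -extForm A b Q P := by
  rcases P with _ | P <;> rcases Q with _ | Q
  · simp [extForm]
  · simp [extForm]
  · simp [extForm]
  · exact hA P Q

/-- The Gram Pfaffian of a family, extended by the vector `none` if its size is odd. -/
noncomputable def extPf (A : W → W → ℂ) (b : W → ℂ) {n : ℕ} (w : Fin n → W) : ℂ :=
  if Even n then pfGram A w
  else pfGram (extForm A b) (Fin.cons none (some ∘ w) : Fin (n + 1) → Option W)

/-- Border the Gram matrix of `A` by `b`, `-b` and a corner `t`. The determinant is affine in `t`:
at `t = 0` it is that of `extForm`, at `t = 1` the Schur complement of the corner is `A + b ⊗ b`,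
and the slope is the determinant of `A`. -/
theorem detGram_add_rank_one (A : W → W → ℂ) (b : W → ℂ) {n : ℕ} (f g : Fin n → W) :
    detGram (fun P Q => A P Q + b P * b Q) f g = detGram A f g +
      detGram (extForm A b) (Fin.cons none (some ∘ f) : Fin (n + 1) → Option W)
        (Fin.cons none (some ∘ g) : Fin (n + 1) → Option W) := by
  let M : ℂ → Matrix (Fin (n + 1)) (Fin (n + 1)) ℂ := fun t => Matrix.of
    (Fin.cons (Fin.cons t (fun j => b (g j)) : Fin (n + 1) → ℂ)
      (fun i => (Fin.cons (-b (f i)) (fun j => A (f i) (g j)) : Fin (n + 1) → ℂ)) :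
      Fin (n + 1) → Fin (n + 1) → ℂ)
  have h0 : detGram (extForm A b) (Fin.cons none (some ∘ f) : Fin (n + 1) → Option W)
        (Fin.cons none (some ∘ g) : Fin (n + 1) → Option W) = (M 0).det := by
    unfold detGram
    congr 1
    ext i j
    refine Fin.cases ?_ (fun i => ?_) i <;> refine Fin.cases ?_ (fun j => ?_) j <;> rfl
  have hlin : (M 1).det = detGram A f g + (M 0).det := by
    rw [Matrix.det_succ_row_zero, Matrix.det_succ_row_zero (M 0), Fin.sum_univ_succ,
      Fin.sum_univ_succ]
    simp only [M, Matrix.of_apply, Fin.cons_zero, Fin.cons_succ]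
    rw [← add_assoc]
    congr 1
    simp [detGram]
    rfl
  have h1 : (M 1).det = detGram (fun P Q => A P Q + b P * b Q) f g := by
    let σ : Fin 1 ⊕ Fin n ≃ Fin (n + 1) := finSumFinEquiv.trans (finCongr (add_comm 1 n))
    have hl : ∀ c, σ (Sum.inl c) = 0 := by
      intro c
      ext
      simp [σ]
    have hr : ∀ i, σ (Sum.inr i) = i.succ := by
      intro i
      ext
      simp [σ]
    rw [← Matrix.det_submatrix_equiv_self σ]
    have : (M 1).submatrix σ σ = Matrix.fromBlocks 1 (Matrix.of fun _ j => b (g j))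
        (Matrix.of fun i _ => -b (f i)) (Matrix.of fun i j => A (f i) (g j)) := by
      ext i j
      rcases i with i | i <;> rcases j with j | j <;>
        simp [hl, hr, M, Fin.fin_one_eq_zero]
    rw [this, Matrix.det_fromBlocks_one₁₁, detGram]
    congr 1
    ext i j
    simp [Matrix.mul_apply]
  rw [h0, ← hlin, h1]

/-- The bilinear identity that expresses a determinant with a rank one perturbation of an
alternating form through Pfaffians. -/
theorem detGram_add_rank_one_cons {A : W → W → ℂ} (hA : ∀ P Q, A P Q = -A Q P) (b : W → ℂ) {n : ℕ}
    (p q : W) (h : Fin n → W) :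
    detGram (fun P Q => A P Q + b P * b Q) (Fin.cons p h : Fin (n + 1) → W)
        (Fin.cons q h : Fin (n + 1) → W) =
      extPf A b (Fin.cons p h : Fin (n + 1) → W) * extPf A b (Fin.cons q h : Fin (n + 1) → W) +
      extPf A b h * extPf A b (Fin.cons p (Fin.cons q h) : Fin (n + 2) → W) := by
  have hE := extForm_antisymm hA b
  have hsome : ∀ {m : ℕ} (p : W) (h : Fin m → W), some ∘ (Fin.cons p h : Fin (m + 1) → W) =
      (Fin.cons (some p) (some ∘ h) : Fin (m + 1) → Option W) := by
    intro m p h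
    ext1 i
    refine Fin.cases rfl (fun i => rfl) i
  have hdet : detGram (extForm A b) (Fin.cons none (some ∘ (Fin.cons p h : Fin (n + 1) → W)) :
      Fin (n + 2) → Option W) (Fin.cons none (some ∘ (Fin.cons q h : Fin (n + 1) → W)) :
      Fin (n + 2) → Option W) =
      detGram (extForm A b)
        (Fin.cons (some p) (Fin.cons none (some ∘ h) : Fin (n + 1) → Option W) :
          Fin (n + 2) → Option W)
        (Fin.cons (some q) (Fin.cons none (some ∘ h) : Fin (n + 1) → Option W) :
          Fin (n + 2) → Option W) := by
    rw [hsome, hsome, detGram, detGram, ← Matrix.det_submatrix_equiv_self (Equiv.swap 0 1)]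
    congr 1
    have hs : ∀ (a b : Option W) (h : Fin n → Option W) (i : Fin (n + 2)),
        (Fin.cons a (Fin.cons b h : Fin (n + 1) → Option W) : Fin (n + 2) → Option W)
          (Equiv.swap 0 1 i) =
        (Fin.cons b (Fin.cons a h : Fin (n + 1) → Option W) : Fin (n + 2) → Option W) i := by
      intro a b h i
      refine Fin.cases ?_ (fun i => Fin.cases ?_ (fun i => ?_) i) i
      · rw [Equiv.swap_apply_left]
        rfl
      · rw [Fin.succ_zero_eq_one, Equiv.swap_apply_right]
        rfl
      · rw [Equiv.swap_apply_of_ne_of_ne (by simp [Fin.ext_iff]) (by simp [Fin.ext_iff])]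
        rfl
    ext i j
    simp only [Matrix.submatrix_apply, Matrix.of_apply, hs]
  rw [detGram_add_rank_one, hdet]
  -- The parity of `n` decides which of the plain and the bordered determinant has even size. In
  -- either case each determinant supplies one of the two products.
  by_cases hn : Even n
  · have hn1 : ¬ Even (n + 1) := by simpa [Nat.even_add_one] using hn
    have hn2 : Even (n + 1 + 1) := by simpa [Nat.even_add_one] using hn
    rw [detGram_odd hA hn, detGram_even hE hn2]
    simp only [extPf, hn, hn1, hn2, if_true, if_false]
    rw [hsome, hsome, pfGram_cons_cons_swap (some p) none, pfGram_cons_cons_swap (some q) none]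
    ring
  · have hn1 : Even (n + 1) := by simpa [Nat.even_add_one] using hn
    have hn2 : ¬ Even (n + 1 + 1) := by simpa [Nat.even_add_one] using hn
    rw [detGram_even hA hn1, detGram_odd hE hn1]
    simp only [extPf, hn, hn1, hn2, if_true, if_false]
    rw [hsome, hsome]
    congr 2
    have h01 : (0 : Fin (n + 3)) ≠ 1 := Fin.ne_of_val_ne (by simp)
    have h02 : (0 : Fin (n + 3)) ≠ 2 := Fin.ne_of_val_ne (by rw [Fin.val_two]; simp)
    have h12 : (1 : Fin (n + 3)) ≠ 2 := Fin.ne_of_val_ne (by rw [Fin.val_two]; simp)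
    have hlt : ∀ i : Fin n, i.succ.succ.succ ≠ (0 : Fin (n + 3)) ∧
        i.succ.succ.succ ≠ (1 : Fin (n + 3)) ∧ i.succ.succ.succ ≠ (2 : Fin (n + 3)) := fun i =>
      ⟨Fin.ne_of_val_ne (by simp), Fin.ne_of_val_ne (by simp),
        Fin.ne_of_val_ne (by rw [Fin.val_two]; simp)⟩
    -- Moving `none` past both `p` and `q` is an even permutation.
    have := pfGram_comp_perm (X := extForm A b) (Fin.cons none (Fin.cons (some p)
      (Fin.cons (some q) (some ∘ h))) : Fin (n + 3) → Option W)
      ((Equiv.swap 0 1) * (Equiv.swap 1 2))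
    rw [Equiv.Perm.sign_mul, Equiv.Perm.sign_swap h01, Equiv.Perm.sign_swap h12] at this
    simp only [mul_neg, mul_one, neg_neg, Units.val_one, Int.cast_one, one_mul] at this
    rw [← this]
    congr 1
    ext1 i
    refine Fin.cases ?_ (fun i => Fin.cases ?_ (fun i => Fin.cases ?_ (fun i => ?_) i) i) i
    · rw [Function.comp_apply, Equiv.Perm.mul_apply, Equiv.swap_apply_of_ne_of_ne h01 h02,
        Equiv.swap_apply_left]
      rfl
    · rw [Function.comp_apply, Equiv.Perm.mul_apply, Fin.succ_zero_eq_one, Equiv.swap_apply_left,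
        Equiv.swap_apply_of_ne_of_ne h02.symm h12.symm]
      rfl
    · rw [Function.comp_apply, Equiv.Perm.mul_apply, Fin.succ_zero_eq_one, Fin.succ_one_eq_two,
        Equiv.swap_apply_right, Equiv.swap_apply_right]
      rfl
    · rw [Function.comp_apply, Equiv.Perm.mul_apply,
        Equiv.swap_apply_of_ne_of_ne (hlt i).2.1 (hlt i).2.2,
        Equiv.swap_apply_of_ne_of_ne (hlt i).1 (hlt i).2.1]
      rfl

end Families

/-! ### Integrals of Pfaffians and determinants -/

theorem integrable_mul_bdd_kernel {α : Type*} [MeasurableSpace α] {ν : Measure α} {f k : α → ℂ}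
    (hf : Integrable f ν) (hk : Measurable k) (hb : ∀ x, ‖k x‖ ≤ 1) :
    Integrable (fun x => f x * k x) ν :=
  hf.mul_bdd (c := 1) hk.aestronglyMeasurable (Filter.Eventually.of_forall hb)

theorem integral_prod_pairs {m : ℕ} {μ ν : Fin m → Measure ℝ} [∀ i, SigmaFinite (μ i)]
    [∀ i, SigmaFinite (ν i)] (G : Fin m → ℝ → ℝ → ℂ)
    (hG : Integrable (fun p : (Fin m → ℝ) × (Fin m → ℝ) => ∏ t, G t (p.1 t) (p.2 t))
      ((Measure.pi μ).prod (Measure.pi ν))) :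
    ∫ p : (Fin m → ℝ) × (Fin m → ℝ), ∏ t, G t (p.1 t) (p.2 t)
        ∂((Measure.pi μ).prod (Measure.pi ν)) =
      ∏ t, ∫ x, ∫ y, G t x y ∂(ν t) ∂(μ t) := by
  rw [integral_prod _ hG]
  simp only
  have : ∀ x : Fin m → ℝ, ∫ y, ∏ t, G t (x t) (y t) ∂(Measure.pi ν) =
      ∏ t, ∫ y, G t (x t) y ∂(ν t) := fun x =>
    integral_fintype_prod_eq_prod fun t y => G t (x t) y
  simp only [this]
  exact integral_fintype_prod_eq_prod fun t x => ∫ y, G t x y ∂(ν t)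

/-- Each permutation in a Pfaffian groups the coordinates into pairs, and the measure factors
accordingly. The measures may depend on the coordinate because the odd case of de Bruijn's formula
adds a coordinate with a Dirac mass. -/
theorem measurePreserving_split {m n : ℕ} (e : Fin m ⊕ Fin m ≃ Fin n) (μ : Fin n → Measure ℝ)
    [∀ i, SigmaFinite (μ i)] :
    MeasurePreserving (fun z : Fin n → ℝ =>
        ((fun t => z (e (Sum.inl t)), fun t => z (e (Sum.inr t))) :
          (Fin m → ℝ) × (Fin m → ℝ))) (Measure.pi μ)
      ((Measure.pi fun t => μ (e (Sum.inl t))).prod (Measure.pi fun t => μ (e (Sum.inr t)))) := by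
  have h1 := (measurePreserving_piCongrLeft (α := fun _ : Fin n => ℝ) μ e).symm
  have h2 := measurePreserving_sumPiEquivProdPi (X := fun _ : Fin m ⊕ Fin m => ℝ)
    (fun i => μ (e i))
  exact h2.comp h1

theorem measurableEmbedding_split {m n : ℕ} (e : Fin m ⊕ Fin m ≃ Fin n) :
    MeasurableEmbedding (fun z : Fin n → ℝ =>
        ((fun t => z (e (Sum.inl t)), fun t => z (e (Sum.inr t))) :
          (Fin m → ℝ) × (Fin m → ℝ))) :=
  (MeasurableEquiv.sumPiEquivProdPi (fun _ : Fin m ⊕ Fin m => ℝ)).measurableEmbedding.comp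
    (MeasurableEquiv.piCongrLeft (fun _ : Fin n => ℝ) e).symm.measurableEmbedding

/-- The enumeration of an even number of indices by pairs. -/
noncomputable def pairEnum {n : ℕ} (hn : Even n) : Fin (n / 2) ⊕ Fin (n / 2) ≃ Fin n :=
  Equiv.ofBijective
    (Sum.elim (fun t => ⟨2 * t, by omega⟩) fun t => ⟨2 * t + 1, by omega⟩) (by
      rw [Fintype.bijective_iff_injective_and_card]
      constructor
      · rintro (i | i) (j | j) h <;> simp [Fin.ext_iff] at h ⊢ <;> omega
      · obtain ⟨r, rfl⟩ := hn
        simp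
        omega)

theorem integrable_prod_kernel {n : ℕ} {μ : Fin n → Measure ℝ} [∀ i, SigmaFinite (μ i)]
    {F : Fin n → ℝ → ℂ} (hF : ∀ i, Integrable (F i) (μ i)) {K : (Fin n → ℝ) → ℂ}
    (hK : Measurable K) (hb : ∀ z, ‖K z‖ ≤ 1) :
    Integrable (fun z : Fin n → ℝ => (∏ i, F i (z i)) * K z) (Measure.pi μ) :=
  integrable_mul_bdd_kernel (Integrable.fintype_prod hF) hK hb

theorem norm_prod_le_one {ι : Type*} (s : Finset ι) {f : ι → ℂ} (hf : ∀ i, ‖f i‖ ≤ 1) :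
    ‖∏ i ∈ s, f i‖ ≤ 1 := by
  rw [norm_prod]
  exact Finset.prod_le_one (fun _ _ => norm_nonneg _) fun i _ => hf i

/-- De Bruijn's integration formula. -/
theorem integral_prod_mul_pfaffian {n : ℕ} (hn : Even n) {μ : Fin n → Measure ℝ}
    [∀ i, SigmaFinite (μ i)] {F : Fin n → ℝ → ℂ} (hF : ∀ i, Integrable (F i) (μ i))
    {k : ℝ → ℝ → ℂ} (hk : Measurable (Function.uncurry k)) (hb : ∀ x y, ‖k x y‖ ≤ 1) :
    ∫ z : Fin n → ℝ, (∏ i, F i (z i)) * pfaffian (Matrix.of fun i j => k (z i) (z j))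
        ∂(Measure.pi μ) =
      pfaffian (Matrix.of fun i j => ∫ x, ∫ y, F i x * F j y * k x y ∂(μ j) ∂(μ i)) := by
  have hkm : ∀ i j : Fin n, Measurable fun z : Fin n → ℝ => k (z i) (z j) := fun i j => by
    have h : Measurable (Function.uncurry k ∘ fun z : Fin n → ℝ => (z i, z j)) :=
      hk.comp ((measurable_pi_apply i).prodMk (measurable_pi_apply j))
    exact h
  have hint : ∀ σ : Equiv.Perm (Fin n), Integrable (fun z : Fin n → ℝ => (∏ i, F i (z i)) *
      ∏ t : Fin (n / 2), k (z (σ ⟨2 * t, by omega⟩)) (z (σ ⟨2 * t + 1, by omega⟩)))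
      (Measure.pi μ) := fun σ =>
    integrable_prod_kernel hF (Finset.measurable_fun_prod _ fun t _ => hkm _ _)
      fun z => norm_prod_le_one _ fun t => hb _ _
  have hone : ∀ σ : Equiv.Perm (Fin n), ∫ z : Fin n → ℝ, (∏ i, F i (z i)) *
      ∏ t : Fin (n / 2), k (z (σ ⟨2 * t, by omega⟩)) (z (σ ⟨2 * t + 1, by omega⟩))
      ∂(Measure.pi μ) =
      ∏ t : Fin (n / 2), ∫ x, ∫ y, F (σ ⟨2 * t, by omega⟩) x * F (σ ⟨2 * t + 1, by omega⟩) y *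
        k x y ∂(μ (σ ⟨2 * t + 1, by omega⟩)) ∂(μ (σ ⟨2 * t, by omega⟩)) := by
    intro σ
    let e := (pairEnum hn).trans σ
    have hl : ∀ t : Fin (n / 2), e (Sum.inl t) = σ ⟨2 * t, by omega⟩ := fun t => rfl
    have hr : ∀ t : Fin (n / 2), e (Sum.inr t) = σ ⟨2 * t + 1, by omega⟩ := fun t => rfl
    let G : Fin (n / 2) → ℝ → ℝ → ℂ := fun t x y =>
      F (e (Sum.inl t)) x * F (e (Sum.inr t)) y * k x y
    have hform : ∀ z : Fin n → ℝ, (∏ i, F i (z i)) *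
        ∏ t : Fin (n / 2), k (z (σ ⟨2 * t, by omega⟩)) (z (σ ⟨2 * t + 1, by omega⟩)) =
        ∏ t, G t (z (e (Sum.inl t))) (z (e (Sum.inr t))) := by
      intro z
      simp only [G, Finset.prod_mul_distrib, hl, hr]
      congr 1
      rw [← e.prod_comp, Fintype.prod_sum_type]
      rfl
    have hmp := measurePreserving_split e μ
    have hi := hint σ
    simp only [hform] at hi ⊢
    rw [hmp.integral_comp (measurableEmbedding_split e)
      (fun p : (Fin (n / 2) → ℝ) × (Fin (n / 2) → ℝ) => ∏ t, G t (p.1 t) (p.2 t))]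
    exact integral_prod_pairs G
      ((hmp.integrable_comp_emb (measurableEmbedding_split e)).mp hi)
  simp only [pfaffian, if_pos hn, Matrix.of_apply]
  have hre : ∀ z : Fin n → ℝ, (∏ i, F i (z i)) * (1 / (2 ^ (n / 2) * ((n / 2).factorial : ℂ)) *
      ∑ σ : Equiv.Perm (Fin n), ((Equiv.Perm.sign σ : ℤ) : ℂ) *
        ∏ t : Fin (n / 2), k (z (σ ⟨2 * t, by omega⟩)) (z (σ ⟨2 * t + 1, by omega⟩))) =
      1 / (2 ^ (n / 2) * ((n / 2).factorial : ℂ)) *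
      ∑ σ : Equiv.Perm (Fin n), ((Equiv.Perm.sign σ : ℤ) : ℂ) * ((∏ i, F i (z i)) *
        ∏ t : Fin (n / 2), k (z (σ ⟨2 * t, by omega⟩)) (z (σ ⟨2 * t + 1, by omega⟩))) := by
    intro z
    rw [mul_left_comm, Finset.mul_sum]
    congr 1
    exact Finset.sum_congr rfl fun σ _ => by ring
  simp only [hre]
  rw [integral_const_mul, integral_finsetSum _ fun σ _ => (hint σ).const_mul _]
  simp only [integral_const_mul, hone]

/-- The product of a determinant of functions and a determinant of a kernel is integrated by
Andréief's formula. -/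
theorem integral_prod_mul_det {n : ℕ} {μ : Measure ℝ} [SigmaFinite μ] {F G : Fin n → ℝ → ℂ}
    (hF : ∀ i, Integrable (F i) μ) (hG : ∀ i, Integrable (G i) μ)
    {k : ℝ → ℝ → ℂ} (hk : Measurable (Function.uncurry k)) (hb : ∀ x y, ‖k x y‖ ≤ 1) :
    Integrable (fun p : (Fin n → ℝ) × (Fin n → ℝ) => (∏ i, F i (p.1 i)) * (∏ i, G i (p.2 i)) *
      (Matrix.of fun i j => k (p.1 i) (p.2 j)).det)
      ((Measure.pi fun _ => μ).prod (Measure.pi fun _ => μ)) ∧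
    ∫ p : (Fin n → ℝ) × (Fin n → ℝ), (∏ i, F i (p.1 i)) * (∏ i, G i (p.2 i)) *
      (Matrix.of fun i j => k (p.1 i) (p.2 j)).det
      ∂((Measure.pi fun _ => μ).prod (Measure.pi fun _ => μ)) =
      (Matrix.of fun i j => ∫ x, ∫ y, F i x * G j y * k x y ∂μ ∂μ).det := by
  have hkm : ∀ i j : Fin n, Measurable fun p : (Fin n → ℝ) × (Fin n → ℝ) => k (p.1 i) (p.2 j) :=
    fun i j => by
    have h : Measurable (Function.uncurry k ∘
        fun p : (Fin n → ℝ) × (Fin n → ℝ) => (p.1 i, p.2 j)) :=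
      hk.comp (((measurable_pi_apply i).comp measurable_fst).prodMk
        ((measurable_pi_apply j).comp measurable_snd))
    exact h
  have hbase : Integrable (fun p : (Fin n → ℝ) × (Fin n → ℝ) =>
      (∏ i, F i (p.1 i)) * (∏ i, G i (p.2 i)))
      ((Measure.pi fun _ => μ).prod (Measure.pi fun _ => μ)) :=
    (Integrable.fintype_prod hF).mul_prod (Integrable.fintype_prod hG)
  have hint : ∀ σ : Equiv.Perm (Fin n), Integrable (fun p : (Fin n → ℝ) × (Fin n → ℝ) =>
      (∏ i, F i (p.1 i)) * (∏ i, G i (p.2 i)) * ∏ t, k (p.1 (σ t)) (p.2 t))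
      ((Measure.pi fun _ => μ).prod (Measure.pi fun _ => μ)) := fun σ =>
    integrable_mul_bdd_kernel hbase (Finset.measurable_fun_prod _ fun t _ => hkm _ _)
      fun z => norm_prod_le_one _ fun t => hb _ _
  have hone : ∀ σ : Equiv.Perm (Fin n), ∫ p : (Fin n → ℝ) × (Fin n → ℝ),
      (∏ i, F i (p.1 i)) * (∏ i, G i (p.2 i)) * ∏ t, k (p.1 (σ t)) (p.2 t)
      ∂((Measure.pi fun _ => μ).prod (Measure.pi fun _ => μ)) =
      ∏ t, ∫ x, ∫ y, F (σ t) x * G t y * k x y ∂μ ∂μ := by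
    intro σ
    have hform : ∀ p : (Fin n → ℝ) × (Fin n → ℝ),
        (∏ i, F i (p.1 i)) * (∏ i, G i (p.2 i)) * ∏ t, k (p.1 (σ t)) (p.2 t) =
        ∏ t, (fun (t : Fin n) (x y : ℝ) => F (σ t) x * G t y * k x y) t
          ((p.1 ∘ σ) t) (p.2 t) := by
      intro p
      simp only [Finset.prod_mul_distrib, Function.comp_apply]
      rw [Equiv.prod_comp σ fun i => F i (p.1 i)]
    have hs : MeasurePreserving (fun x : Fin n → ℝ => x ∘ σ) (Measure.pi fun _ : Fin n => μ)
        (Measure.pi fun _ : Fin n => μ) :=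
      (measurePreserving_piCongrLeft (α := fun _ : Fin n => ℝ) (fun _ => μ) σ).symm
    have hse : MeasurableEmbedding (fun x : Fin n → ℝ => x ∘ σ) :=
      (MeasurableEquiv.piCongrLeft (fun _ : Fin n => ℝ) σ).symm.measurableEmbedding
    have hmp := hs.prod (MeasurePreserving.id (Measure.pi fun _ : Fin n => μ))
    have hid : MeasurableEmbedding (id : (Fin n → ℝ) → Fin n → ℝ) := MeasurableEmbedding.id
    have hme := hse.prodMap hid
    have hi := hint σ
    simp only [hform] at hi ⊢
    refine (hmp.integral_comp hme (fun p : (Fin n → ℝ) × (Fin n → ℝ) =>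
      ∏ t, (fun (t : Fin n) (x y : ℝ) => F (σ t) x * G t y * k x y) t (p.1 t) (p.2 t))).trans ?_
    exact integral_prod_pairs (fun t x y => F (σ t) x * G t y * k x y)
      ((hmp.integrable_comp_emb hme (g := fun p : (Fin n → ℝ) × (Fin n → ℝ) =>
        ∏ t, F (σ t) (p.1 t) * G t (p.2 t) * k (p.1 t) (p.2 t))).mp hi)
  have hexp : ∀ p : (Fin n → ℝ) × (Fin n → ℝ), (∏ i, F i (p.1 i)) * (∏ i, G i (p.2 i)) *
      (Matrix.of fun i j => k (p.1 i) (p.2 j)).det =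
      ∑ σ : Equiv.Perm (Fin n), ((Equiv.Perm.sign σ : ℤ) : ℂ) *
        ((∏ i, F i (p.1 i)) * (∏ i, G i (p.2 i)) * ∏ t, k (p.1 (σ t)) (p.2 t)) := by
    intro p
    rw [Matrix.det_apply', Finset.mul_sum]
    exact Finset.sum_congr rfl fun σ _ => by
      simp only [Matrix.of_apply]
      ring
  simp only [hexp]
  refine ⟨integrable_finsetSum _ fun σ _ => (hint σ).const_mul _, ?_⟩
  rw [integral_finsetSum _ fun σ _ => (hint σ).const_mul _, Matrix.det_apply']
  simp only [integral_const_mul, hone, Matrix.of_apply]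

/-! ### The two kernels on the half line and their bilinear forms -/

/-- Lebesgue measure on the positive half line. -/
noncomputable abbrev posLeb : Measure ℝ := volume.restrict (Set.Ioi 0)

/-- The kernel `(y - x) / (x + y)`, cut off outside the closed quadrant. -/
noncomputable def schurKer (x y : ℝ) : ℂ :=
  if 0 ≤ x ∧ 0 ≤ y then (((y - x) / (x + y) : ℝ) : ℂ) else 0

/-- The kernel `y / (x + y)`, cut off outside the closed quadrant. -/
noncomputable def cauchyKer (x y : ℝ) : ℂ :=
  if 0 ≤ x ∧ 0 ≤ y then ((y / (x + y) : ℝ) : ℂ) else 0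

theorem measurable_schurKer : Measurable (Function.uncurry schurKer) := by
  unfold schurKer
  refine Measurable.ite ?_ ?_ measurable_const
  · exact (measurableSet_le measurable_const measurable_fst).inter
      (measurableSet_le measurable_const measurable_snd)
  · exact Complex.measurable_ofReal.comp
      ((measurable_snd.sub measurable_fst).div (measurable_fst.add measurable_snd))

theorem measurable_cauchyKer : Measurable (Function.uncurry cauchyKer) := by
  unfold cauchyKer
  refine Measurable.ite ?_ ?_ measurable_const
  · exact (measurableSet_le measurable_const measurable_fst).inter
      (measurableSet_le measurable_const measurable_snd)
  · exact Complex.measurable_ofReal.comp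
      (measurable_snd.div (measurable_fst.add measurable_snd))

/-- The cut-off makes the bound valid everywhere, as the integration lemmas require; at the origin
division by zero gives `0`. -/
theorem norm_schurKer_le (x y : ℝ) : ‖schurKer x y‖ ≤ 1 := by
  unfold schurKer
  split_ifs with h
  · rw [Complex.norm_real, Real.norm_eq_abs, abs_div]
    refine div_le_one_of_le₀ ?_ (abs_nonneg _)
    rw [abs_of_nonneg (add_nonneg h.1 h.2), abs_le]
    constructor <;> linarith [h.1, h.2]
  · simp

theorem norm_cauchyKer_le (x y : ℝ) : ‖cauchyKer x y‖ ≤ 1 := by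
  unfold cauchyKer
  split_ifs with h
  · rw [Complex.norm_real, Real.norm_eq_abs, abs_div]
    refine div_le_one_of_le₀ ?_ (abs_nonneg _)
    rw [abs_of_nonneg (add_nonneg h.1 h.2), abs_of_nonneg h.2]
    linarith [h.1]
  · simp

theorem schurKer_swap (x y : ℝ) : schurKer y x = -schurKer x y := by
  unfold schurKer
  simp only [and_comm (a := 0 ≤ y)]
  rw [add_comm y x, ← neg_sub y x, neg_div]
  split_ifs <;> simp

theorem schurKer_of_pos {x y : ℝ} (hx : 0 < x) (hy : 0 < y) :
    schurKer x y = ((y : ℂ) - x) / (x + y) := by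
  simp [schurKer, hx.le, hy.le]

theorem cauchyKer_of_pos {x y : ℝ} (hx : 0 < x) (hy : 0 < y) :
    cauchyKer x y = (y : ℂ) / (x + y) := by
  simp [cauchyKer, hx.le, hy.le]

/-- The bilinear form with kernel `k`. -/
noncomputable def kerForm (k : ℝ → ℝ → ℂ) (F G : ℝ → ℂ) : ℂ :=
  ∫ x, ∫ y, F x * G y * k x y ∂posLeb ∂posLeb

/-- The alternating form of the Bures-like ensemble. -/
noncomputable abbrev aForm : (ℝ → ℂ) → (ℝ → ℂ) → ℂ := kerForm schurKer

/-- The bilinear form of the Cauchy-like two-matrix model. -/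
noncomputable abbrev cForm : (ℝ → ℂ) → (ℝ → ℂ) → ℂ := kerForm cauchyKer

/-- Integration over the positive half line. -/
noncomputable def bForm (F : ℝ → ℂ) : ℂ := ∫ x, F x ∂posLeb

section KerForm

variable {k : ℝ → ℝ → ℂ} {F F' G : ℝ → ℂ}

theorem integrable_kerForm (hk : Measurable (Function.uncurry k)) (hb : ∀ x y, ‖k x y‖ ≤ 1)
    (hF : Integrable F posLeb) (hG : Integrable G posLeb) :
    Integrable (fun p : ℝ × ℝ => F p.1 * G p.2 * k p.1 p.2) (posLeb.prod posLeb) :=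
  integrable_mul_bdd_kernel (hF.mul_prod hG) hk fun p => hb p.1 p.2

theorem kerForm_eq_prod (hk : Measurable (Function.uncurry k)) (hb : ∀ x y, ‖k x y‖ ≤ 1)
    (hF : Integrable F posLeb) (hG : Integrable G posLeb) :
    kerForm k F G = ∫ p : ℝ × ℝ, F p.1 * G p.2 * k p.1 p.2 ∂(posLeb.prod posLeb) :=
  (integral_prod _ (integrable_kerForm hk hb hF hG)).symm

theorem kerForm_add_left (hk : Measurable (Function.uncurry k)) (hb : ∀ x y, ‖k x y‖ ≤ 1)
    (hF : Integrable F posLeb) (hF' : Integrable F' posLeb) (hG : Integrable G posLeb) :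
    kerForm k (fun x => F x + F' x) G = kerForm k F G + kerForm k F' G := by
  have hadd : Integrable (fun x => F x + F' x) posLeb := hF.add hF'
  rw [kerForm_eq_prod hk hb hadd hG, kerForm_eq_prod hk hb hF hG,
    kerForm_eq_prod hk hb hF' hG, ← integral_add (integrable_kerForm hk hb hF hG)
      (integrable_kerForm hk hb hF' hG)]
  congr 1
  ext p
  ring

theorem kerForm_smul_left (c : ℂ) : kerForm k (fun x => c * F x) G = c * kerForm k F G := by
  unfold kerForm
  rw [← integral_const_mul]
  congr 1
  ext x
  rw [← integral_const_mul]
  congr 1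
  ext y
  ring

theorem kerForm_swap (hk : Measurable (Function.uncurry k)) (hb : ∀ x y, ‖k x y‖ ≤ 1)
    (hF : Integrable F posLeb) (hG : Integrable G posLeb) :
    kerForm (fun x y => k y x) G F = kerForm k F G := by
  rw [kerForm_eq_prod hk hb hF hG,
    kerForm_eq_prod (k := fun x y => k y x) (hk.comp measurable_swap) (fun x y => hb y x) hG hF,
    ← integral_prod_swap]
  congr 1
  ext p
  simp only [Prod.fst_swap, Prod.snd_swap]
  ring

theorem kerForm_add_right (hk : Measurable (Function.uncurry k)) (hb : ∀ x y, ‖k x y‖ ≤ 1)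
    (hF : Integrable F posLeb) (hF' : Integrable F' posLeb) (hG : Integrable G posLeb) :
    kerForm k G (fun x => F x + F' x) = kerForm k G F + kerForm k G F' := by
  have hadd : Integrable (fun x => F x + F' x) posLeb := hF.add hF'
  rw [← kerForm_swap hk hb hG hadd, ← kerForm_swap hk hb hG hF,
    ← kerForm_swap hk hb hG hF']
  exact kerForm_add_left (k := fun x y => k y x) (hk.comp measurable_swap) (fun x y => hb y x)
    hF hF' hG

theorem kerForm_smul_right (c : ℂ) : kerForm k G (fun x => c * F x) = c * kerForm k G F := by
  unfold kerForm
  rw [← integral_const_mul]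
  congr 1
  ext x
  rw [← integral_const_mul]
  congr 1
  ext y
  ring

end KerForm

theorem aForm_antisymm {F G : ℝ → ℂ} (hF : Integrable F posLeb) (hG : Integrable G posLeb) :
    aForm F G = -aForm G F := by
  rw [aForm, ← kerForm_swap measurable_schurKer norm_schurKer_le hF hG]
  unfold kerForm
  rw [← integral_neg]
  congr 1
  ext x
  rw [← integral_neg]
  congr 1
  ext y
  simp only
  rw [schurKer_swap x y]
  ring

/-- The link between the two ensembles: pointwise `(y - x) / (x + y) + 1 = 2 * y / (x + y)`, so
twice the Cauchy kernel is a rank one perturbation of the Schur kernel. -/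
theorem aForm_add_mul {F G : ℝ → ℂ} (hF : Integrable F posLeb) (hG : Integrable G posLeb) :
    aForm F G + bForm F * bForm G = 2 * cForm F G := by
  have h := integrable_kerForm measurable_schurKer norm_schurKer_le hF hG
  have hpos : ∀ᵐ p : ℝ × ℝ ∂(posLeb.prod posLeb), 0 < p.1 ∧ 0 < p.2 := by
    rw [posLeb, Measure.prod_restrict]
    exact ae_restrict_mem (measurableSet_Ioi.prod measurableSet_Ioi)
  rw [aForm, cForm, kerForm_eq_prod measurable_schurKer norm_schurKer_le hF hG,
    kerForm_eq_prod measurable_cauchyKer norm_cauchyKer_le hF hG, bForm, bForm,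
    ← integral_prod_mul, ← integral_add h (hF.mul_prod hG), ← integral_const_mul]
  refine integral_congr_ae ?_
  filter_upwards [hpos] with p hp
  rw [schurKer_of_pos hp.1 hp.2, cauchyKer_of_pos hp.1 hp.2]
  have : ((p.1 : ℂ) + p.2) ≠ 0 := by
    exact_mod_cast (add_pos hp.1 hp.2).ne'
  field_simp
  ring

theorem pi_posLeb (N : ℕ) :
    (Measure.pi fun _ : Fin N => posLeb) = volume.restrict (orthant N) := by
  rw [orthant, volume_pi, Measure.restrict_pi_pi]

theorem ae_pos_pi_posLeb (N : ℕ) :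
    ∀ᵐ z ∂(Measure.pi fun _ : Fin N => posLeb), ∀ i, 0 < z i := by
  rw [pi_posLeb]
  filter_upwards [ae_restrict_mem (MeasurableSet.univ_pi fun _ => measurableSet_Ioi)] with z hz i
  exact hz i (Set.mem_univ i)

theorem extPf_comp_perm {W : Type*} (A : W → W → ℂ) (b : W → ℂ) {n : ℕ} (w : Fin n → W)
    (σ : Equiv.Perm (Fin n)) :
    extPf A b (w ∘ σ) = ((Equiv.Perm.sign σ : ℤ) : ℂ) * extPf A b w := by
  unfold extPf
  split_ifs
  · exact pfGram_comp_perm w σ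
  · have h := pfGram_comp_perm (X := extForm A b)
      (Fin.cons none (some ∘ w) : Fin (n + 1) → Option W)
      (Equiv.Perm.decomposeFin.symm (0, σ))
    rw [Equiv.Perm.decomposeFin.symm_sign, if_pos rfl, one_mul] at h
    rw [← h]
    congr 1
    ext1 i
    refine Fin.cases ?_ (fun i => ?_) i
    · simp
    · simp

/-- For even `n` this is Schur's Pfaffian identity followed by de Bruijn's formula. For odd `n` an
additional variable frozen at `0` makes the number even without changing the product, because
`schurKer 0 y = 1` for `y > 0`. -/
theorem integral_prod_mul_schur {n : ℕ} {F : Fin n → ℝ → ℂ} (hF : ∀ i, Integrable (F i) posLeb) :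
    ∫ z : Fin n → ℝ, (∏ i, F i (z i)) * ∏ i, ∏ j ∈ Finset.Ioi i, schurKer (z i) (z j)
        ∂(Measure.pi fun _ => posLeb) = extPf aForm bForm F := by
  have hschur : ∀ {m : ℕ}, Even m → ∀ z : Fin m → ℝ, (∀ i, 0 ≤ z i) →
      (∀ i j, i ≠ j → 0 < z i + z j) →
      ∏ i, ∏ j ∈ Finset.Ioi i, schurKer (z i) (z j) =
        pfaffian (Matrix.of fun i j => schurKer (z i) (z j)) := by
    rintro m ⟨r, rfl⟩ z hz hs
    have h := pfaffian_schur_identity r (fun i => (z i : ℂ)) (fun i j hij => by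
      exact_mod_cast (hs i j hij).ne')
    have hk : ∀ i j, schurKer (z i) (z j) = ((z j : ℂ) - z i) / (z i + z j) := by
      intro i j
      simp [schurKer, hz]
    simp only [hk]
    exact h.symm
  by_cases hn : Even n
  · rw [extPf, if_pos hn, pfGram]
    refine Eq.trans ?_ (integral_prod_mul_pfaffian hn hF measurable_schurKer norm_schurKer_le)
    refine integral_congr_ae ?_
    filter_upwards [ae_pos_pi_posLeb n] with z hz
    rw [hschur hn z (fun i => (hz i).le) fun i j _ => add_pos (hz i) (hz j)]
  · have hn1 : Even (n + 1) := by simpa [Nat.even_add_one] using hn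
    -- The frozen variable carries a Dirac mass at `0`. Pairing it with `F j` gives `bForm (F j)`,
    -- so it plays the role of `none` in `extForm`.
    let μ : Fin (n + 1) → Measure ℝ := Fin.cons (Measure.dirac 0) fun _ => posLeb
    have hμ : ∀ i, SigmaFinite (μ i) := by
      intro i
      refine Fin.cases ?_ (fun i => ?_) i
      · change SigmaFinite (Measure.dirac 0)
        infer_instance
      · change SigmaFinite posLeb
        infer_instance
    let F' : Fin (n + 1) → ℝ → ℂ := Fin.cons (fun _ => 1) F
    have hF' : ∀ i, Integrable (F' i) (μ i) := by
      intro i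
      refine Fin.cases ?_ (fun i => ?_) i
      · exact integrable_const (μ := Measure.dirac (0 : ℝ)) (1 : ℂ)
      · exact hF i
    have hdb := integral_prod_mul_pfaffian hn1 hF' measurable_schurKer norm_schurKer_le
    have hmp := measurePreserving_piFinSuccAbove μ 0
    have hgram : pfaffian (Matrix.of fun i j =>
        ∫ x, ∫ y, F' i x * F' j y * schurKer x y ∂(μ j) ∂(μ i)) = extPf aForm bForm F := by
      rw [extPf, if_neg hn, pfGram]
      congr 1
      ext i j
      refine Fin.cases ?_ (fun i => ?_) i <;> refine Fin.cases ?_ (fun j => ?_) j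
      · simp [F', μ, extForm, schurKer]
      · simp only [F', μ, extForm, Matrix.of_apply, Fin.cons_zero, Fin.cons_succ,
          integral_dirac, one_mul, Function.comp_apply, bForm]
        refine integral_congr_ae ?_
        filter_upwards [ae_restrict_mem measurableSet_Ioi] with y (hy : 0 < y)
        simp [schurKer, hy.le, hy.ne']
      · simp only [F', μ, extForm, Matrix.of_apply, Fin.cons_zero, Fin.cons_succ,
          integral_dirac, mul_one, Function.comp_apply, bForm]
        rw [← integral_neg]
        refine integral_congr_ae ?_
        filter_upwards [ae_restrict_mem measurableSet_Ioi] with y (hy : 0 < y)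
        simp [schurKer, hy.le, hy.ne']
      · rfl
    rw [← hgram, ← hdb]
    have hcomp := hmp.symm.integral_comp' (g := fun z : Fin (n + 1) → ℝ => (∏ i, F' i (z i)) *
      pfaffian (Matrix.of fun i j => schurKer (z i) (z j)))
    rw [← hcomp]
    have hμ0 : μ 0 = Measure.dirac 0 := rfl
    have hμs : (fun j => μ (Fin.succAbove 0 j)) = fun _ : Fin n => posLeb := by
      ext1 j
      rfl
    rw [hμ0, hμs, Measure.dirac_prod,
      (measurableEmbedding_prodMk_left (0 : ℝ)).integral_map]
    refine integral_congr_ae ?_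
    filter_upwards [ae_pos_pi_posLeb n] with z hz
    have hcons : (MeasurableEquiv.piFinSuccAbove (fun _ : Fin (n + 1) => ℝ) 0).symm (0, z) =
        Fin.cons 0 z := by
      ext i
      refine Fin.cases rfl (fun i => rfl) i
    rw [hcons, ← hschur hn1 (Fin.cons 0 z)]
    · rw [Fin.prod_univ_succ, Fin.prod_univ_succ (f := fun i =>
        ∏ j ∈ Finset.Ioi i, schurKer ((Fin.cons 0 z : Fin (n + 1) → ℝ) i) _)]
      have h0 : ∀ j, schurKer 0 (z j) = 1 := by
        intro j
        simp [schurKer, (hz j).le, (hz j).ne']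
      simp only [Fin.Ioi_zero_eq_map, Fin.Ioi_succ, Finset.prod_map, Fin.coe_succEmb,
        Fin.cons_zero, Fin.cons_succ, F', h0, Finset.prod_const_one, one_mul]
    · intro i
      refine Fin.cases le_rfl (fun i => (hz i).le) i
    · intro i j
      refine Fin.cases ?_ (fun i => ?_) i <;> refine Fin.cases ?_ (fun j => ?_) j <;> intro hij
      · exact absurd rfl hij
      · simpa using hz j
      · simpa using hz i
      · exact add_pos (hz i) (hz j)

/-! ### Determinant identities -/

/-- The Cauchy determinant. -/
theorem det_cauchy {n : ℕ} : ∀ (x y : Fin n → ℂ), (∀ i j, x i + y j ≠ 0) →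
    (Matrix.of fun i j => 1 / (x i + y j)).det = vand x * vand y / ∏ i, ∏ j, (x i + y j) := by
  induction n with
  | zero =>
    intro x y _
    simp [vand]
  | succ n ih =>
    intro x y h
    -- The multiple of row `0` is chosen to clear column `0`; the remaining minor is a smaller
    -- Cauchy matrix with row and column factors.
    let B : Matrix (Fin (n + 1)) (Fin (n + 1)) ℂ := Matrix.of fun i j =>
      if i = 0 then 1 / (x 0 + y j)
      else 1 / (x i + y j) - ((x 0 + y 0) / (x i + y 0)) * (1 / (x 0 + y j))
    have hB : (Matrix.of fun i j => 1 / (x i + y j)).det = B.det := by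
      refine Matrix.det_eq_of_forall_row_eq_smul_add_const
        (fun i => if i = 0 then 0 else (x 0 + y 0) / (x i + y 0)) 0 (by simp) fun i j => ?_
      by_cases hi : i = 0
      · simp [B, hi]
      · simp [B, hi]
    have htail := ih (fun i => x i.succ) (fun i => y i.succ) fun i j => h _ _
    rw [hB, Matrix.det_succ_column_zero, Finset.sum_eq_single 0]
    · have hsub : B.submatrix (Fin.succAbove 0) Fin.succ =
          Matrix.of fun i j => ((x i.succ - x 0) / (x i.succ + y 0)) *
            (Matrix.of fun i j => ((y j.succ - y 0) / (x 0 + y j.succ)) *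
              (Matrix.of fun i j : Fin n => 1 / (x i.succ + y j.succ)) i j) i j := by
        ext i j
        have h1 := h i.succ j.succ
        have h2 := h i.succ 0
        have h3 := h 0 j.succ
        simp only [B, Matrix.submatrix_apply, Matrix.of_apply, Fin.succAbove_zero,
          Fin.succ_ne_zero, if_false]
        field_simp
        ring
      rw [hsub, Matrix.det_mul_column, Matrix.det_mul_row, htail]
      have hv : ∀ u : Fin (n + 1) → ℂ, vand u = (∏ i : Fin n, (u i.succ - u 0)) *
          vand fun i : Fin n => u i.succ := by
        intro u
        unfold vand
        rw [Fin.prod_univ_succ]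
        simp only [Fin.Ioi_zero_eq_map, Fin.Ioi_succ, Finset.prod_map, Fin.coe_succEmb]
      rw [hv x, hv y, Fin.prod_univ_succ (f := fun i => ∏ j, (x i + y j))]
      simp only [Fin.prod_univ_succ (n := n), Finset.prod_mul_distrib, Finset.prod_div_distrib, B,
        Matrix.of_apply, if_true, Fin.val_zero, pow_zero, one_mul]
      have h00 := h 0 0
      have p1 : ∏ i : Fin n, (x i.succ + y 0) ≠ 0 := Finset.prod_ne_zero_iff.mpr fun i _ => h _ _
      have p2 : ∏ i : Fin n, (x 0 + y i.succ) ≠ 0 := Finset.prod_ne_zero_iff.mpr fun i _ => h _ _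
      have p3 : ∏ i : Fin n, ∏ j : Fin n, (x i.succ + y j.succ) ≠ 0 :=
        Finset.prod_ne_zero_iff.mpr fun i _ => Finset.prod_ne_zero_iff.mpr fun j _ => h _ _
      field_simp
    · intro i _ hi
      have : B i 0 = 0 := by
        have h1 := h i 0
        have h2 := h 0 0
        simp only [B, Matrix.of_apply, hi, if_false]
        field_simp
        ring
      rw [this]
      ring
    · simp

/-- In the term of `σ`, scaling row `i` entrywise by `c` contributes the factor `c (σ⁻¹ i)`; these
factors sum over `i` to `∑ c_j`. -/
theorem sum_mul_det {n : ℕ} (c : Fin n → ℂ) (M : Matrix (Fin n) (Fin n) ℂ) :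
    (∑ j, c j) * M.det = ∑ i, (M.updateRow i fun j => c j * M i j).det := by
  have h : ∀ i, (M.updateRow i fun j => c j * M i j).det =
      ∑ σ : Equiv.Perm (Fin n),
        ((Equiv.Perm.sign σ : ℤ) : ℂ) * (c (σ.symm i) * ∏ j, M (σ j) j) := by
    intro i
    rw [Matrix.det_apply']
    refine Finset.sum_congr rfl fun σ _ => ?_
    congr 1
    have h1 : ∀ j, (M.updateRow i fun j => c j * M i j) (σ j) j =
        (if j = σ.symm i then c j else 1) * M (σ j) j := by
      intro j
      by_cases hj : σ j = i
      · have : j = σ.symm i := by rw [← hj, Equiv.symm_apply_apply]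
        rw [if_pos this, hj, Matrix.updateRow_self]
      · have : j ≠ σ.symm i := fun h => hj (by rw [h, Equiv.apply_symm_apply])
        rw [if_neg this, Matrix.updateRow_ne hj, one_mul]
    simp only [h1, Finset.prod_mul_distrib, Finset.prod_ite_eq', Finset.mem_univ, if_true]
  simp only [h]
  rw [Finset.sum_comm, Matrix.det_apply', Finset.mul_sum]
  refine Finset.sum_congr rfl fun σ _ => ?_
  rw [← Finset.mul_sum, ← Finset.sum_mul, Equiv.sum_comp σ.symm c]
  ring

theorem det_pow_eq_vand {n : ℕ} (u : Fin n → ℂ) :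
    (Matrix.of fun i j : Fin n => u j ^ (i : ℕ)).det = vand u := by
  rw [← Matrix.det_transpose]
  exact Matrix.det_vandermonde u

/-- The exponents `0, …, n - 1, n + 1`. -/
def gapExp {n : ℕ} (i : Fin (n + 1)) : ℕ := if (i : ℕ) = n then n + 1 else i

/-- By `sum_mul_det`, the product is a sum of determinants in which one exponent is raised by one.
Raising any exponent except the top one repeats the next row. -/
theorem det_pow_gapExp {n : ℕ} (u : Fin (n + 1) → ℂ) :
    (Matrix.of fun i j : Fin (n + 1) => u j ^ gapExp i).det = (∑ j, u j) * vand u := by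
  rw [← det_pow_eq_vand, sum_mul_det, Finset.sum_eq_single (Fin.last n)]
  · congr 1
    ext i j
    by_cases hi : i = Fin.last n
    · subst hi
      simp [gapExp, pow_succ, mul_comm]
    · have : (i : ℕ) ≠ n := fun h => hi (Fin.ext h)
      rw [Matrix.updateRow_ne hi]
      simp [gapExp, this]
  · intro i _ hi
    have hlt : (i : ℕ) < n := by
      have := i.2
      have : (i : ℕ) ≠ n := fun h => hi (Fin.ext h)
      omega
    refine Matrix.det_zero_of_row_eq (i := i) (j := ⟨i + 1, by omega⟩)
      (fun h => by simpa using congrArg Fin.val h) ?_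
    ext j
    rw [Matrix.updateRow_self, Matrix.updateRow_ne (fun h => by simpa using congrArg Fin.val h)]
    simp [pow_succ, mul_comm]
  · simp

/-! ### Integrals against determinants of functions -/

theorem det_eq_sum_comp {n : ℕ} (F : Fin n → ℝ → ℂ) (z : Fin n → ℝ) :
    (Matrix.of fun i j => F i (z j)).det =
      ∑ σ : Equiv.Perm (Fin n), ((Equiv.Perm.sign σ : ℤ) : ℂ) * ∏ j, (F ∘ σ) j (z j) := by
  rw [Matrix.det_apply']
  rfl

/-- All `n!` terms of the determinant contribute equally, since `extPf` picks up the sign of the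
permutation once more. -/
theorem integral_det_mul_schur {n : ℕ} {F : Fin n → ℝ → ℂ} (hF : ∀ i, Integrable (F i) posLeb) :
    Integrable (fun z : Fin n → ℝ => (Matrix.of fun i j => F i (z j)).det *
        ∏ i, ∏ j ∈ Finset.Ioi i, schurKer (z i) (z j)) (Measure.pi fun _ => posLeb) ∧
    ∫ z : Fin n → ℝ, (Matrix.of fun i j => F i (z j)).det *
        ∏ i, ∏ j ∈ Finset.Ioi i, schurKer (z i) (z j) ∂(Measure.pi fun _ => posLeb) =
      (n.factorial : ℂ) * extPf aForm bForm F := by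
  have hm : Measurable fun z : Fin n → ℝ => ∏ i, ∏ j ∈ Finset.Ioi i, schurKer (z i) (z j) := by
    refine Finset.measurable_fun_prod _ fun i _ => Finset.measurable_fun_prod _ fun j _ => ?_
    have h : Measurable (Function.uncurry schurKer ∘ fun z : Fin n → ℝ => (z i, z j)) :=
      measurable_schurKer.comp ((measurable_pi_apply i).prodMk (measurable_pi_apply j))
    exact h
  have hb : ∀ z : Fin n → ℝ, ‖∏ i, ∏ j ∈ Finset.Ioi i, schurKer (z i) (z j)‖ ≤ 1 := fun z =>
    norm_prod_le_one _ fun i => norm_prod_le_one _ fun j => norm_schurKer_le _ _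
  have hint : ∀ σ : Equiv.Perm (Fin n), Integrable (fun z : Fin n → ℝ =>
      (∏ j, (F ∘ σ) j (z j)) * ∏ i, ∏ j ∈ Finset.Ioi i, schurKer (z i) (z j))
      (Measure.pi fun _ => posLeb) := fun σ =>
    integrable_prod_kernel (fun i => hF (σ i)) hm hb
  simp only [det_eq_sum_comp, Finset.sum_mul, mul_assoc]
  refine ⟨integrable_finsetSum _ fun σ _ => (hint σ).const_mul _, ?_⟩
  rw [integral_finsetSum _ fun σ _ => (hint σ).const_mul _]
  have hone : ∀ σ : Equiv.Perm (Fin n), ∫ z : Fin n → ℝ, ((Equiv.Perm.sign σ : ℤ) : ℂ) *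
      ((∏ j, (F ∘ σ) j (z j)) * ∏ i, ∏ j ∈ Finset.Ioi i, schurKer (z i) (z j))
      ∂(Measure.pi fun _ => posLeb) = extPf aForm bForm F := by
    intro σ
    rw [integral_const_mul, integral_prod_mul_schur (F := F ∘ σ) fun i => hF (σ i),
      extPf_comp_perm, ← mul_assoc]
    rcases Int.units_eq_one_or (Equiv.Perm.sign σ) with h | h <;> simp [h]
  simp only [hone]
  simp [Fintype.card_perm]

theorem integral_det_mul_cauchy {n : ℕ} {F G : Fin n → ℝ → ℂ}
    (hF : ∀ i, Integrable (F i) posLeb) (hG : ∀ i, Integrable (G i) posLeb) :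
    Integrable (fun p : (Fin n → ℝ) × (Fin n → ℝ) => (Matrix.of fun i j => F i (p.1 j)).det *
      (Matrix.of fun i j => G i (p.2 j)).det * (Matrix.of fun i j => cauchyKer (p.1 i) (p.2 j)).det)
      ((Measure.pi fun _ => posLeb).prod (Measure.pi fun _ => posLeb)) ∧
    ∫ p : (Fin n → ℝ) × (Fin n → ℝ), (Matrix.of fun i j => F i (p.1 j)).det *
      (Matrix.of fun i j => G i (p.2 j)).det * (Matrix.of fun i j => cauchyKer (p.1 i) (p.2 j)).det
      ∂((Measure.pi fun _ => posLeb).prod (Measure.pi fun _ => posLeb)) =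
      (n.factorial : ℂ) ^ 2 * detGram cForm F G := by
  have hbase := fun σ τ : Equiv.Perm (Fin n) => integral_prod_mul_det (fun i => hF (σ i))
    (fun i => hG (τ i)) measurable_cauchyKer norm_cauchyKer_le
  have hexp : ∀ p : (Fin n → ℝ) × (Fin n → ℝ), (Matrix.of fun i j => F i (p.1 j)).det *
      (Matrix.of fun i j => G i (p.2 j)).det *
        (Matrix.of fun i j => cauchyKer (p.1 i) (p.2 j)).det =
      ∑ σ : Equiv.Perm (Fin n), ∑ τ : Equiv.Perm (Fin n),
        (((Equiv.Perm.sign σ : ℤ) : ℂ) * ((Equiv.Perm.sign τ : ℤ) : ℂ)) *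
        ((∏ i, F (σ i) (p.1 i)) * (∏ i, G (τ i) (p.2 i)) *
        (Matrix.of fun i j => cauchyKer (p.1 i) (p.2 j)).det) := by
    intro p
    rw [det_eq_sum_comp, det_eq_sum_comp, Finset.sum_mul_sum, Finset.sum_mul]
    refine Finset.sum_congr rfl fun σ _ => ?_
    rw [Finset.sum_mul]
    refine Finset.sum_congr rfl fun τ _ => ?_
    simp only [Function.comp_apply]
    ring
  have hone : ∀ σ τ : Equiv.Perm (Fin n),
      (((Equiv.Perm.sign σ : ℤ) : ℂ) * ((Equiv.Perm.sign τ : ℤ) : ℂ)) *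
        (Matrix.of fun i j => cForm (F (σ i)) (G (τ j))).det = detGram cForm F G := by
    intro σ τ
    have h1 : (Matrix.of fun i j => cForm (F (σ i)) (G (τ j))) =
        ((Matrix.of fun i j => cForm (F i) (G j)).submatrix σ id).submatrix id τ := rfl
    rw [h1, Matrix.det_permute', Matrix.det_permute, detGram]
    rcases Int.units_eq_one_or (Equiv.Perm.sign σ) with h | h <;>
      rcases Int.units_eq_one_or (Equiv.Perm.sign τ) with h' | h' <;> simp [h, h']
  simp only [hexp]
  refine ⟨integrable_finsetSum _ fun σ _ => integrable_finsetSum _ fun τ _ =>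
    (hbase σ τ).1.const_mul _, ?_⟩
  rw [integral_finsetSum _ fun σ _ => integrable_finsetSum _ fun τ _ => (hbase σ τ).1.const_mul _]
  have hstep : ∀ σ : Equiv.Perm (Fin n), ∫ p : (Fin n → ℝ) × (Fin n → ℝ),
      ∑ τ : Equiv.Perm (Fin n), (((Equiv.Perm.sign σ : ℤ) : ℂ) * ((Equiv.Perm.sign τ : ℤ) : ℂ)) *
        ((∏ i, F (σ i) (p.1 i)) * (∏ i, G (τ i) (p.2 i)) *
        (Matrix.of fun i j => cauchyKer (p.1 i) (p.2 j)).det)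
      ∂((Measure.pi fun _ => posLeb).prod (Measure.pi fun _ => posLeb)) =
      ∑ τ : Equiv.Perm (Fin n), detGram cForm F G := by
    intro σ
    rw [integral_finsetSum _ fun τ _ => (hbase σ τ).1.const_mul _]
    refine Finset.sum_congr rfl fun τ _ => ?_
    rw [integral_const_mul, (hbase σ τ).2]
    exact hone σ τ
  simp only [hstep]
  simp [Fintype.card_perm]
  ring

/-! ### Polynomial families: partition functions as Pfaffians and determinants -/

open Polynomial in
/-- The function `β P` on the half line. -/
noncomputable def polyFun (β : ℝ → ℂ) (P : ℂ[X]) : ℝ → ℂ := fun z => β z * P.eval (z : ℂ)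

theorem integrable_polyFun {β : ℝ → ℂ} (hβ : HasAllMoments β) (P : Polynomial ℂ) :
    Integrable (polyFun β P) posLeb := by
  have h : polyFun β P = fun z : ℝ =>
      ∑ i ∈ Finset.range (P.natDegree + 1), P.coeff i * ((z : ℂ) ^ i * β z) := by
    ext z
    rw [polyFun, Polynomial.eval_eq_sum_range, Finset.mul_sum]
    exact Finset.sum_congr rfl fun i _ => by ring
  rw [h]
  exact integrable_finsetSum _ fun i _ => (hβ i).const_mul _

/-- The bilinear form with kernel `k` and weight `β` on polynomials. -/
noncomputable def kerLin (k : ℝ → ℝ → ℂ) (hk : Measurable (Function.uncurry k))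
    (hb : ∀ x y, ‖k x y‖ ≤ 1) {β : ℝ → ℂ} (hβ : HasAllMoments β) :
    Polynomial ℂ →ₗ[ℂ] Polynomial ℂ →ₗ[ℂ] ℂ :=
  LinearMap.mk₂ ℂ (fun P Q => kerForm k (polyFun β P) (polyFun β Q))
    (fun P P' Q => by
      rw [← kerForm_add_left hk hb (integrable_polyFun hβ P) (integrable_polyFun hβ P')
        (integrable_polyFun hβ Q)]
      congr 1
      ext z
      simp [polyFun, mul_add])
    (fun c P Q => by
      rw [smul_eq_mul, ← kerForm_smul_left]
      congr 1
      ext z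
      simp [polyFun, mul_left_comm])
    (fun P Q Q' => by
      rw [← kerForm_add_right hk hb (integrable_polyFun hβ Q) (integrable_polyFun hβ Q')
        (integrable_polyFun hβ P)]
      congr 1
      ext z
      simp [polyFun, mul_add])
    (fun c P Q => by
      rw [smul_eq_mul, ← kerForm_smul_right]
      congr 1
      ext z
      simp [polyFun, mul_left_comm])

/-- The alternating form with weight `β` on polynomials. -/
noncomputable def aLin {β : ℝ → ℂ} (hβ : HasAllMoments β) :
    Polynomial ℂ →ₗ[ℂ] Polynomial ℂ →ₗ[ℂ] ℂ :=
  kerLin schurKer measurable_schurKer norm_schurKer_le hβ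

/-- The Cauchy form with weight `β` on polynomials. -/
noncomputable def cLin {β : ℝ → ℂ} (hβ : HasAllMoments β) :
    Polynomial ℂ →ₗ[ℂ] Polynomial ℂ →ₗ[ℂ] ℂ :=
  kerLin cauchyKer measurable_cauchyKer norm_cauchyKer_le hβ

/-- The moment functional with weight `β` on polynomials. -/
noncomputable def bLin {β : ℝ → ℂ} (hβ : HasAllMoments β) : Polynomial ℂ →ₗ[ℂ] ℂ where
  toFun P := bForm (polyFun β P)
  map_add' P Q := by
    rw [bForm, bForm, bForm, ← integral_add (integrable_polyFun hβ P) (integrable_polyFun hβ Q)]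
    congr 1
    ext z
    simp [polyFun, mul_add]
  map_smul' c P := by
    rw [bForm, bForm, RingHom.id_apply, smul_eq_mul, ← integral_const_mul]
    congr 1
    ext z
    simp [polyFun, mul_left_comm]

theorem aLin_antisymm {β : ℝ → ℂ} (hβ : HasAllMoments β) (P Q : Polynomial ℂ) :
    aLin hβ P Q = -aLin hβ Q P :=
  aForm_antisymm (integrable_polyFun hβ P) (integrable_polyFun hβ Q)

theorem aLin_add_mul {β : ℝ → ℂ} (hβ : HasAllMoments β) (P Q : Polynomial ℂ) :
    aLin hβ P Q + bLin hβ P * bLin hβ Q = 2 * cLin hβ P Q :=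
  aForm_add_mul (integrable_polyFun hβ P) (integrable_polyFun hβ Q)

/-- The Pfaffian that represents the Bures-like ensemble built on a family of polynomials. -/
noncomputable def buresPf {β : ℝ → ℂ} (hβ : HasAllMoments β) {n : ℕ} (w : Fin n → Polynomial ℂ) :
    ℂ :=
  extPf (fun P Q => aLin hβ P Q) (fun P => bLin hβ P) w

/-- The determinant that represents the Cauchy-like two-matrix model built on two families of
polynomials. -/
noncomputable def cauchyDet {β : ℝ → ℂ} (hβ : HasAllMoments β) {n : ℕ}
    (f g : Fin n → Polynomial ℂ) : ℂ :=
  detGram (fun P Q => cLin hβ P Q) f g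

theorem extPf_comp {W W' : Type*} (A : W → W → ℂ) (b : W → ℂ) (φ : W' → W) {n : ℕ}
    (w : Fin n → W') :
    extPf A b (φ ∘ w) = extPf (fun P Q => A (φ P) (φ Q)) (fun P => b (φ P)) w := by
  unfold extPf
  split_ifs
  · rfl
  · unfold pfGram
    congr 1
    ext i j
    refine Fin.cases ?_ (fun i => ?_) i <;> refine Fin.cases ?_ (fun j => ?_) j <;> rfl

/-- One factor of the squared Vandermonde product forms the determinant of the functions; the other,
divided by the `z_i + z_j`, is the product of Schur kernels. -/
theorem buresDensity_eq (α : ℝ → ℂ) {β : ℝ → ℂ} {n k l : ℕ}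
    (kap : Fin k → ℂ) (lam : Fin l → ℂ) (f : Fin n → Polynomial ℂ)
    (hf : ∀ i : Fin n, ∀ z : ℝ, 0 < z →
      α z * charRatio kap lam z * (z : ℂ) ^ (i : ℕ) = β z * (f i).eval (z : ℂ))
    {z : Fin n → ℝ} (hz : ∀ i, 0 < z i) :
    ((vand z ^ 2 / ∏ i, ∏ j ∈ Finset.Ioi i, (z i + z j) : ℝ) : ℂ) *
        ∏ j, (α (z j) * charRatio kap lam (z j)) =
      (Matrix.of fun i j => (polyFun β ∘ f) i (z j)).det *
        ∏ i, ∏ j ∈ Finset.Ioi i, schurKer (z i) (z j) := by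
  have hM : (Matrix.of fun i j => (polyFun β ∘ f) i (z j)) = Matrix.of fun i j : Fin n =>
      (α (z j) * charRatio kap lam (z j)) *
        (Matrix.of fun i j : Fin n => (z j : ℂ) ^ (i : ℕ)) i j := by
    ext i j
    exact (hf i (z j) (hz j)).symm
  rw [hM, Matrix.det_mul_row, det_pow_eq_vand fun j => (z j : ℂ)]
  have hker : ∏ i, ∏ j ∈ Finset.Ioi i, schurKer (z i) (z j) =
      vand (fun j => (z j : ℂ)) / ∏ i, ∏ j ∈ Finset.Ioi i, ((z i : ℂ) + z j) := by
    rw [vand, ← Finset.prod_div_distrib]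
    refine Finset.prod_congr rfl fun i _ => ?_
    rw [← Finset.prod_div_distrib]
    exact Finset.prod_congr rfl fun j _ => schurKer_of_pos (hz i) (hz j)
  have hv : ((vand z : ℝ) : ℂ) = vand fun j => (z j : ℂ) := by
    simp [vand]
  rw [hker]
  push_cast
  rw [hv]
  ring

/-- The weight `β` need not be `α`: it may absorb denominators, so that partition functions with
different poles become Pfaffians of polynomials with respect to a common form. -/
theorem ZB_eq_buresPf (α : ℝ → ℂ) {β : ℝ → ℂ} (hβ : HasAllMoments β) {n k l : ℕ}
    (kap : Fin k → ℂ) (lam : Fin l → ℂ) (f : Fin n → Polynomial ℂ)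
    (hf : ∀ i : Fin n, ∀ z : ℝ, 0 < z →
      α z * charRatio kap lam z * (z : ℂ) ^ (i : ℕ) = β z * (f i).eval (z : ℂ)) :
    ZB α n kap lam = buresPf hβ f := by
  have h := (integral_det_mul_schur (F := polyFun β ∘ f) fun i => integrable_polyFun hβ (f i)).2
  rw [extPf_comp] at h
  rw [ZB, buresPf, ← pi_posLeb]
  change _ = extPf (fun P Q => aForm (polyFun β P) (polyFun β Q)) (fun P => bForm (polyFun β P)) f
  have hn : (n.factorial : ℂ) ≠ 0 := by exact_mod_cast n.factorial_ne_zero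
  rw [one_div_mul_eq_div, div_eq_iff hn, mul_comm, ← h]
  refine integral_congr_ae ?_
  filter_upwards [ae_pos_pi_posLeb n] with z hz
  exact buresDensity_eq α kap lam f hf hz

/-- One Vandermonde product in `x`, one in `y` and the factors `y_j` make up the determinant of
`cauchyKer`; the other two Vandermonde products remain for the functions. -/
theorem cauchyDensity_eq (α : ℝ → ℂ) {n : ℕ} {x y : Fin n → ℝ} (hx : ∀ i, 0 < x i)
    (hy : ∀ i, 0 < y i) :
    cauchyDensity α x y = vand (fun j => (x j : ℂ)) * vand (fun j => (y j : ℂ)) *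
      (∏ j, (α (x j) * α (y j))) * (Matrix.of fun i j => cauchyKer (x i) (y j)).det := by
  have hM : (Matrix.of fun i j => cauchyKer (x i) (y j)) = Matrix.of fun i j : Fin n =>
      (y j : ℂ) * (Matrix.of fun i j : Fin n => 1 / ((x i : ℂ) + y j)) i j := by
    ext i j
    simp only [Matrix.of_apply]
    rw [cauchyKer_of_pos (hx i) (hy j)]
    ring
  have hv : ∀ z : Fin n → ℝ, ((vand z : ℝ) : ℂ) = vand fun j => (z j : ℂ) := by
    intro z
    simp [vand]
  rw [hM, Matrix.det_mul_row, det_cauchy (fun i => (x i : ℂ)) (fun i => (y i : ℂ)), cauchyDensity]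
  · push_cast
    rw [hv, hv, Finset.prod_mul_distrib]
    ring
  · intro i j
    exact_mod_cast (add_pos (hx i) (hy j)).ne'

theorem restrict_orthant_prod (n : ℕ) :
    (volume : Measure ((Fin n → ℝ) × (Fin n → ℝ))).restrict (orthant n ×ˢ orthant n) =
      (Measure.pi fun _ => posLeb).prod (Measure.pi fun _ => posLeb) := by
  rw [pi_posLeb, Measure.prod_restrict]
  rfl

theorem ae_pos_prod (n : ℕ) :
    ∀ᵐ p ∂((Measure.pi fun _ : Fin n => posLeb).prod (Measure.pi fun _ : Fin n => posLeb)),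
      (∀ i, 0 < p.1 i) ∧ ∀ i, 0 < p.2 i := by
  have h := ae_pos_pi_posLeb n
  exact (Measure.quasiMeasurePreserving_fst.ae h).and (Measure.quasiMeasurePreserving_snd.ae h)

theorem ZC_eq_cauchyDet (α : ℝ → ℂ) {β : ℝ → ℂ} (hβ : HasAllMoments β) {n k₁ l₁ k₂ l₂ : ℕ}
    (kap₁ : Fin k₁ → ℂ) (lam₁ : Fin l₁ → ℂ) (kap₂ : Fin k₂ → ℂ) (lam₂ : Fin l₂ → ℂ)
    (f g : Fin n → Polynomial ℂ)
    (hf : ∀ i : Fin n, ∀ z : ℝ, 0 < z →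
      α z * charRatio kap₁ lam₁ z * (z : ℂ) ^ (i : ℕ) = β z * (f i).eval (z : ℂ))
    (hg : ∀ i : Fin n, ∀ z : ℝ, 0 < z →
      α z * charRatio kap₂ lam₂ z * (z : ℂ) ^ (i : ℕ) = β z * (g i).eval (z : ℂ)) :
    ZC α n kap₁ lam₁ kap₂ lam₂ = cauchyDet hβ f g := by
  have h := (integral_det_mul_cauchy (F := polyFun β ∘ f) (G := polyFun β ∘ g)
    (fun i => integrable_polyFun hβ (f i)) fun i => integrable_polyFun hβ (g i)).2
  rw [ZC, restrict_orthant_prod]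
  have hn : (n.factorial : ℂ) ^ 2 ≠ 0 := by
    exact_mod_cast pow_ne_zero 2 n.factorial_ne_zero
  rw [one_div_mul_eq_div, div_eq_iff hn, mul_comm]
  refine Eq.trans ?_ h
  refine integral_congr_ae ?_
  filter_upwards [ae_pos_prod n] with p hp
  have hM : ∀ {k l : ℕ} (kap : Fin k → ℂ) (lam : Fin l → ℂ) (f : Fin n → Polynomial ℂ)
      (_ : ∀ i : Fin n, ∀ z : ℝ, 0 < z →
        α z * charRatio kap lam z * (z : ℂ) ^ (i : ℕ) = β z * (f i).eval (z : ℂ))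
      (z : Fin n → ℝ) (_ : ∀ i, 0 < z i), (Matrix.of fun i j => (polyFun β ∘ f) i (z j)).det =
        (∏ j, (α (z j) * charRatio kap lam (z j))) * vand fun j => (z j : ℂ) := by
    intro k l kap lam f hf z hz
    rw [← det_pow_eq_vand, ← Matrix.det_mul_row]
    congr 1
    ext i j
    exact (hf i (z j) (hz j)).symm
  rw [hM kap₁ lam₁ f hf p.1 hp.1, hM kap₂ lam₂ g hg p.2 hp.2, cauchyDensity_eq α hp.1 hp.2]
  simp only [Finset.prod_mul_distrib]
  ring

/-- A Vandermonde determinant times the sum of its variables is the determinant with exponents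
`gapExp`. The sum over `x` acts on the first family, the sum over `y` on the second. -/
theorem ZHat_eq_cauchyDet {α : ℝ → ℂ} (hα : HasAllMoments α) (n : ℕ) :
    ZHat α (n + 1) =
      cauchyDet hα (fun i : Fin (n + 1) => Polynomial.X ^ gapExp i)
        (fun i : Fin (n + 1) => Polynomial.X ^ (i : ℕ)) -
      cauchyDet hα (fun i : Fin (n + 1) => Polynomial.X ^ (i : ℕ))
        (fun i : Fin (n + 1) => Polynomial.X ^ gapExp i) := by
  let F : Fin (n + 1) → ℝ → ℂ := polyFun α ∘ fun i => Polynomial.X ^ (i : ℕ)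
  let F' : Fin (n + 1) → ℝ → ℂ := polyFun α ∘ fun i => Polynomial.X ^ gapExp i
  have hF : ∀ i, Integrable (F i) posLeb := fun i => integrable_polyFun hα _
  have hF' : ∀ i, Integrable (F' i) posLeb := fun i => integrable_polyFun hα _
  have h1 := integral_det_mul_cauchy hF' hF
  have h2 := integral_det_mul_cauchy hF hF'
  rw [ZHat, restrict_orthant_prod]
  have hn : ((n + 1).factorial : ℂ) ^ 2 ≠ 0 := by
    exact_mod_cast pow_ne_zero 2 (n + 1).factorial_ne_zero
  rw [one_div_mul_eq_div, div_eq_iff hn, mul_comm]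
  refine Eq.trans ?_ ((congrArg₂ HSub.hSub h1.2 h2.2).trans (mul_sub _ _ _).symm)
  rw [← integral_sub h1.1 h2.1]
  refine integral_congr_ae ?_
  filter_upwards [ae_pos_prod (n + 1)] with p hp
  have hM : ∀ (e : Fin (n + 1) → ℕ) (z : Fin (n + 1) → ℝ),
      (Matrix.of fun i j => (polyFun α ∘ fun i => Polynomial.X ^ e i) i (z j)).det =
        (∏ j, α (z j)) * (Matrix.of fun i j : Fin (n + 1) => (z j : ℂ) ^ e i).det := by
    intro e z
    rw [← Matrix.det_mul_row]
    congr 1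
    ext i j
    simp [polyFun]
  simp only [F, F']
  rw [hM, hM, hM, hM, det_pow_gapExp fun j => (p.1 j : ℂ), det_pow_gapExp fun j => (p.2 j : ℂ),
    det_pow_eq_vand fun j => (p.1 j : ℂ), det_pow_eq_vand fun j => (p.2 j : ℂ),
    cauchyDensity_eq α hp.1 hp.2]
  push_cast
  simp only [Finset.prod_mul_distrib, Finset.sum_sub_distrib]
  ring

/-! ### Weights with poles -/

theorem HasAllMoments.div_sub {α : ℝ → ℂ} (hα : HasAllMoments α) {κ : ℂ}
    (hκ : ∀ t : ℝ, 0 ≤ t → κ ≠ t) : HasAllMoments fun z => α z / ((z : ℂ) - κ) := by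
  -- The closed half line has positive distance from `κ`, so `1 / (z - κ)` is bounded on it.
  obtain ⟨c, hc, hb⟩ : ∃ c : ℝ, 0 < c ∧ ∀ t : ℝ, 0 ≤ t → c ≤ ‖(t : ℂ) - κ‖ := by
    have hcl : IsClosed ((fun t : ℝ => (t : ℂ)) '' Set.Ici 0) :=
      Complex.isometry_ofReal.isClosedEmbedding.isClosedMap _ isClosed_Ici
    have hmem : κ ∈ ((fun t : ℝ => (t : ℂ)) '' Set.Ici 0)ᶜ := by
      rintro ⟨t, ht, h⟩
      exact hκ t ht h.symm
    obtain ⟨c, hc, hball⟩ := Metric.isOpen_iff.mp hcl.isOpen_compl κ hmem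
    refine ⟨c, hc, fun t ht => ?_⟩
    by_contra hlt
    push Not at hlt
    exact hball (by rwa [Metric.mem_ball, dist_eq_norm]) ⟨t, ht, rfl⟩
  intro n
  have hm : Measurable fun z : ℝ => ((z : ℂ) - κ)⁻¹ :=
    (Complex.measurable_ofReal.sub_const κ).inv
  have h := Integrable.mul_bdd (c := c⁻¹) (hα n) (hm.aestronglyMeasurable (μ := posLeb)) (by
    filter_upwards [ae_restrict_mem measurableSet_Ioi] with z (hz : 0 < z)
    rw [norm_inv]
    exact inv_anti₀ hc (hb z hz.le))
  refine h.congr (Filter.Eventually.of_forall fun z => ?_)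
  simp only
  rw [div_eq_mul_inv, mul_assoc]

theorem HasAllMoments.div_prod {α : ℝ → ℂ} (hα : HasAllMoments α) {k : ℕ} :
    ∀ {kap : Fin k → ℂ}, (∀ i, ∀ t : ℝ, 0 ≤ t → kap i ≠ t) →
      HasAllMoments fun z => α z / ∏ i, ((z : ℂ) - kap i) := by
  induction k with
  | zero =>
    intro kap _
    simpa using hα
  | succ k ih =>
    intro kap h
    have := (ih (kap := fun i => kap i.succ) fun i => h i.succ).div_sub (h 0)
    simp only [Fin.prod_univ_succ]
    convert! this using 2 with z
    rw [div_div, mul_comm]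

/-- The bordered Gram matrix of a family of vectors, with `p` border rows. -/
noncomputable def extGram {W : Type*} (A : W → W → ℂ) (b : W → ℂ) (p : ℕ) {n : ℕ} (w : Fin n → W) :
    Matrix (Fin p ⊕ Fin n) (Fin p ⊕ Fin n) ℂ :=
  Matrix.fromBlocks 0 (Matrix.of fun _ j => b (w j)) (Matrix.of fun i _ => -b (w i))
    (Matrix.of fun i j => A (w i) (w j))

theorem extGram_transpose {W : Type*} {A : W → W → ℂ} (hA : ∀ P Q, A P Q = -A Q P) (b : W → ℂ)
    (p : ℕ) {n : ℕ} (w : Fin n → W) :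
    (extGram A b p w).transpose = -extGram A b p w := by
  ext i j
  rcases i with i | i <;> rcases j with j | j <;> simp [extGram]
  exact hA _ _

/-- With `p` the parity of `n`, the case distinction in `extPf` becomes a single bordered Gram
matrix, to which congruences apply uniformly. -/
theorem extPf_eq_pfOn {W : Type*} (A : W → W → ℂ) (b : W → ℂ) {p n : ℕ} (hp : p ≤ 1)
    (h : Even (p + n)) (w : Fin n → W) :
    extPf A b w = pfOn (sumEnum (Equiv.refl _) (Equiv.refl _)) (extGram A b p w) := by
  obtain rfl | rfl : p = 0 ∨ p = 1 := by omega
  · have hn : Even n := by simpa using h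
    rw [extPf, if_pos hn, pfGram, ← pfOn_self,
      pfOn_congr (Equiv.refl (Fin n)) (sumEnum (Equiv.refl (Fin 0)) (Equiv.refl (Fin n)))
        (Equiv.emptySum (Fin 0) (Fin n))]
    · congr 1
      ext i j
      rcases i with i | i
      · exact i.elim0
      rcases j with j | j
      · exact j.elim0
      rfl
    · rintro (i | i)
      · exact i.elim0
      · simp
  · have hn : ¬ Even n := by
      intro h'
      rw [Nat.even_add] at h
      exact absurd (h.mpr h') (by decide)
    rw [extPf, if_neg hn, pfGram, ← pfOn_self,
      pfOn_congr (Equiv.refl (Fin (n + 1))) (sumEnum (Equiv.refl (Fin 1)) (Equiv.refl (Fin n)))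
        (finSumFinEquiv.trans (finCongr (add_comm 1 n)))]
    · congr 1
      have h0 : ∀ i : Fin 1, (finSumFinEquiv.trans (finCongr (add_comm 1 n))) (Sum.inl i) = 0 := by
        intro i
        ext
        simp
      have h1 : ∀ i : Fin n,
          (finSumFinEquiv.trans (finCongr (add_comm 1 n))) (Sum.inr i) = i.succ := by
        intro i
        ext
        simp
      ext i j
      rcases i with i | i <;> rcases j with j | j <;>
        simp only [Matrix.submatrix_apply, h0, h1] <;>
        simp [extGram, extForm]
    · rintro (i | i)
      · simp
      · simp [add_comm]

/-! ### Linear combinations and permutations of families -/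

section Linear

variable {V : Type*} [AddCommGroup V] [Module ℂ V]

theorem extGram_linear_comb (A : V →ₗ[ℂ] V →ₗ[ℂ] ℂ) (b : V →ₗ[ℂ] ℂ) (p : ℕ) {m n : ℕ}
    (T : Matrix (Fin m) (Fin n) ℂ) (w : Fin n → V) :
    extGram (fun P Q => A P Q) (fun P => b P) p (fun i => ∑ j, T i j • w j) =
      (Matrix.fromBlocks 1 0 0 T : Matrix (Fin p ⊕ Fin m) (Fin p ⊕ Fin n) ℂ) *
        extGram (fun P Q => A P Q) (fun P => b P) p w *
        (Matrix.fromBlocks 1 0 0 T : Matrix (Fin p ⊕ Fin m) (Fin p ⊕ Fin n) ℂ).transpose := by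
  rw [extGram, extGram, Matrix.fromBlocks_transpose, Matrix.fromBlocks_multiply,
    Matrix.fromBlocks_multiply]
  congr 1
  · simp
  · ext i j
    simp [Matrix.mul_apply, mul_comm]
  · ext i j
    simp [Matrix.mul_apply]
  · ext i j
    simp [Matrix.mul_apply, Finset.mul_sum, mul_comm, mul_left_comm]
    try exact Finset.sum_comm

theorem extPf_linear_comb (A : V →ₗ[ℂ] V →ₗ[ℂ] ℂ) (hA : ∀ P Q, A P Q = -A Q P) (b : V →ₗ[ℂ] ℂ)
    {n : ℕ} (T : Matrix (Fin n) (Fin n) ℂ) (w : Fin n → V) :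
    extPf (fun P Q => A P Q) (fun P => b P) (fun i => ∑ j, T i j • w j) =
      T.det * extPf (fun P Q => A P Q) (fun P => b P) w := by
  obtain ⟨p, hp, h⟩ : ∃ p, p ≤ 1 ∧ Even (p + n) := by
    rcases Nat.even_or_odd n with h | h
    · exact ⟨0, by simp, by simpa using h⟩
    · exact ⟨1, le_rfl, by rw [add_comm]; exact h.add_one⟩
  rw [extPf_eq_pfOn _ _ hp h, extPf_eq_pfOn _ _ hp h, extGram_linear_comb,
    pfOn_mul_mul_transpose_self _ _ _ (extGram_transpose hA _ _ _)]
  simp [Matrix.det_fromBlocks_zero₂₁]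

theorem detGram_linear_comb (C : V →ₗ[ℂ] V →ₗ[ℂ] ℂ) {n : ℕ} (S T : Matrix (Fin n) (Fin n) ℂ)
    (f g : Fin n → V) :
    detGram (fun P Q => C P Q) (fun i => ∑ j, S i j • f j) (fun i => ∑ j, T i j • g j) =
      S.det * T.det * detGram (fun P Q => C P Q) f g := by
  have h : (Matrix.of fun i j => C (∑ a, S i a • f a) (∑ a, T j a • g a)) =
      S * (Matrix.of fun i j => C (f i) (g j)) * T.transpose := by
    ext i j
    simp [Matrix.mul_apply, Finset.mul_sum, mul_comm, mul_left_comm]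
    try exact Finset.sum_comm
  rw [detGram, detGram, h, Matrix.det_mul, Matrix.det_mul, Matrix.det_transpose]
  ring

end Linear

theorem detGram_comp_perm {W : Type*} (X : W → W → ℂ) {n : ℕ} (f g : Fin n → W)
    (σ τ : Equiv.Perm (Fin n)) :
    detGram X (f ∘ σ) (g ∘ τ) =
      ((Equiv.Perm.sign σ : ℤ) : ℂ) * ((Equiv.Perm.sign τ : ℤ) : ℂ) * detGram X f g := by
  have h : (Matrix.of fun i j => X ((f ∘ σ) i) ((g ∘ τ) j)) =
      ((Matrix.of fun i j => X (f i) (g j)).submatrix σ id).submatrix id τ := rfl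
  rw [detGram, h, Matrix.det_permute', Matrix.det_permute, detGram]
  ring

theorem sign_finRotate_cast (n : ℕ) :
    ((Equiv.Perm.sign (finRotate (n + 1)) : ℤ) : ℂ) = (-1) ^ n := by
  simp [sign_finRotate]

theorem snoc_eq_cons_comp_finRotate {W : Type*} {n : ℕ} (h : Fin n → W) (p : W) :
    (Fin.snoc h p : Fin (n + 1) → W) = (Fin.cons p h : Fin (n + 1) → W) ∘ finRotate (n + 1) :=
  Fin.snoc_eq_cons_rotate h p

theorem extPf_snoc {W : Type*} (A : W → W → ℂ) (b : W → ℂ) {n : ℕ} (h : Fin n → W) (p : W) :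
    extPf A b (Fin.snoc h p : Fin (n + 1) → W) =
      (-1) ^ n * extPf A b (Fin.cons p h : Fin (n + 1) → W) := by
  rw [snoc_eq_cons_comp_finRotate, extPf_comp_perm, sign_finRotate_cast]

theorem extPf_cons_snoc {W : Type*} (A : W → W → ℂ) (b : W → ℂ) {n : ℕ} (h : Fin n → W) (p q : W) :
    extPf A b (Fin.cons p (Fin.snoc h q : Fin (n + 1) → W) : Fin (n + 2) → W) =
      (-1) ^ n * extPf A b (Fin.cons p (Fin.cons q h : Fin (n + 1) → W) : Fin (n + 2) → W) := by
  have hc : (Fin.cons p (Fin.snoc h q : Fin (n + 1) → W) : Fin (n + 2) → W) =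
      (Fin.cons p (Fin.cons q h : Fin (n + 1) → W) : Fin (n + 2) → W) ∘
        Equiv.Perm.decomposeFin.symm (0, finRotate (n + 1)) := by
    rw [snoc_eq_cons_comp_finRotate]
    ext i
    refine Fin.cases ?_ (fun i => ?_) i <;> simp
  rw [hc, extPf_comp_perm, Equiv.Perm.decomposeFin.symm_sign, if_pos rfl, one_mul,
    sign_finRotate_cast]

theorem extPf_cons_cons_swap {W : Type*} (A : W → W → ℂ) (b : W → ℂ) {n : ℕ} (h : Fin n → W)
    (p q : W) :
    extPf A b (Fin.cons p (Fin.cons q h : Fin (n + 1) → W) : Fin (n + 2) → W) =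
      -extPf A b (Fin.cons q (Fin.cons p h : Fin (n + 1) → W) : Fin (n + 2) → W) := by
  have hc : (Fin.cons p (Fin.cons q h : Fin (n + 1) → W) : Fin (n + 2) → W) =
      (Fin.cons q (Fin.cons p h : Fin (n + 1) → W) : Fin (n + 2) → W) ∘ Equiv.swap 0 1 := by
    ext i
    refine Fin.cases ?_ (fun i => ?_) i
    · simp
    · refine Fin.cases ?_ (fun i => ?_) i
      · simp
      · rw [Function.comp_apply, Equiv.swap_apply_of_ne_of_ne]
        · simp
        · exact Fin.succ_ne_zero _
        · intro h
          exact Fin.succ_ne_zero i (Fin.succ_injective _ h)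
  rw [hc, extPf_comp_perm, Equiv.Perm.sign_swap (by simp)]
  simp

/-! ### Quadratic relations between Bures Pfaffians and Cauchy determinants -/

section Bures

variable {β : ℝ → ℂ} (hβ : HasAllMoments β)

theorem buresPf_linear_comb {n : ℕ} (T : Matrix (Fin n) (Fin n) ℂ) (w : Fin n → Polynomial ℂ) :
    buresPf hβ (fun i => ∑ j, T i j • w j) = T.det * buresPf hβ w :=
  extPf_linear_comb _ (aLin_antisymm hβ) _ T w

theorem cauchyDet_linear_comb {n : ℕ} (S T : Matrix (Fin n) (Fin n) ℂ)
    (f g : Fin n → Polynomial ℂ) :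
    cauchyDet hβ (fun i => ∑ j, S i j • f j) (fun i => ∑ j, T i j • g j) =
      S.det * T.det * cauchyDet hβ f g :=
  detGram_linear_comb _ S T f g

open Polynomial in
theorem mul_eq_sum_coeff {n : ℕ} (a : ℂ[X]) (p : Fin n → ℂ[X]) (hd : ∀ i, (p i).natDegree = i) :
    (fun i => a * p i) = fun i => ∑ j, (Matrix.of fun i j : Fin n => (p i).coeff j) i j •
      (a * (X : ℂ[X]) ^ (j : ℕ)) := by
  ext1 i
  conv_lhs => rw [(p i).as_sum_range' n (by rw [hd]; exact i.2), Finset.sum_range, Finset.mul_sum]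
  refine Finset.sum_congr rfl fun j _ => ?_
  rw [Matrix.of_apply, ← mul_smul_comm, ← C_mul_X_pow_eq_monomial, smul_eq_C_mul]

theorem det_coeff_monic {n : ℕ} (p : Fin n → Polynomial ℂ) (hd : ∀ i, (p i).natDegree = i)
    (hm : ∀ i, (p i).Monic) : (Matrix.of fun i j : Fin n => (p i).coeff j).det = 1 := by
  rw [← Matrix.det_transpose]
  exact Matrix.det_matrixOfPolynomials p hd hm

open Polynomial in
-- Monic polynomials of degrees `0, …, n - 1` arise from the monomials by a unitriangular matrix.
theorem buresPf_monic {n : ℕ} (a : ℂ[X]) (p : Fin n → ℂ[X]) (hd : ∀ i, (p i).natDegree = i)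
    (hm : ∀ i, (p i).Monic) :
    buresPf hβ (fun i => a * p i) = buresPf hβ fun i : Fin n => a * X ^ (i : ℕ) := by
  rw [mul_eq_sum_coeff a p hd, buresPf_linear_comb, det_coeff_monic p hd hm, one_mul]

theorem cauchyDet_linear_comb_left {n : ℕ} (S : Matrix (Fin n) (Fin n) ℂ)
    (f g : Fin n → Polynomial ℂ) :
    cauchyDet hβ (fun i => ∑ j, S i j • f j) g = S.det * cauchyDet hβ f g := by
  have h := cauchyDet_linear_comb hβ S 1 f g
  simpa [Matrix.one_apply] using h

theorem cauchyDet_linear_comb_right {n : ℕ} (T : Matrix (Fin n) (Fin n) ℂ)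
    (f g : Fin n → Polynomial ℂ) :
    cauchyDet hβ f (fun i => ∑ j, T i j • g j) = T.det * cauchyDet hβ f g := by
  have h := cauchyDet_linear_comb hβ 1 T f g
  simpa [Matrix.one_apply] using h

open Polynomial in
theorem cauchyDet_monic_left {n : ℕ} (a : ℂ[X]) (p g : Fin n → ℂ[X])
    (hd : ∀ i, (p i).natDegree = i) (hm : ∀ i, (p i).Monic) :
    cauchyDet hβ (fun i => a * p i) g = cauchyDet hβ (fun i => a * X ^ (i : ℕ)) g := by
  rw [mul_eq_sum_coeff a p hd, cauchyDet_linear_comb_left, det_coeff_monic p hd hm, one_mul]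

open Polynomial in
theorem cauchyDet_monic_right {n : ℕ} (a : ℂ[X]) (p f : Fin n → ℂ[X])
    (hd : ∀ i, (p i).natDegree = i) (hm : ∀ i, (p i).Monic) :
    cauchyDet hβ f (fun i => a * p i) = cauchyDet hβ f (fun i => a * X ^ (i : ℕ)) := by
  rw [mul_eq_sum_coeff a p hd, cauchyDet_linear_comb_right, det_coeff_monic p hd hm, one_mul]

/-- `aLin_add_mul` turns `2 ^ (n + 1)` times the determinant of the Cauchy form into one for an
alternating form plus a rank one term. -/
theorem two_pow_mul_cauchyDet {n : ℕ} (p q : Polynomial ℂ) (h : Fin n → Polynomial ℂ) :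
    2 ^ (n + 1) * cauchyDet hβ (Fin.cons p h : Fin (n + 1) → Polynomial ℂ) (Fin.cons q h) =
      buresPf hβ (Fin.cons p h : Fin (n + 1) → Polynomial ℂ) *
        buresPf hβ (Fin.cons q h : Fin (n + 1) → Polynomial ℂ) +
      buresPf hβ h *
        buresPf hβ (Fin.cons p (Fin.cons q h : Fin (n + 1) → Polynomial ℂ) :
          Fin (n + 2) → Polynomial ℂ) := by
  have h1 := detGram_add_rank_one_cons (aLin_antisymm hβ) (fun P => bLin hβ P) p q h
  refine Eq.trans ?_ h1
  rw [cauchyDet, detGram, detGram]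
  conv_lhs => rw [show (2 : ℂ) ^ (n + 1) = 2 ^ Fintype.card (Fin (n + 1)) by simp,
    ← Matrix.det_smul]
  congr 1
  ext i j
  simp only [Matrix.smul_apply, Matrix.of_apply, smul_eq_mul]
  exact (aLin_add_mul hβ _ _).symm

/-- In `two_pow_mul_cauchyDet` the product containing `p, q, h` changes sign under exchange of `p`
and `q`, and the other product does not. Adding the two versions isolates the symmetric part;
subtracting them, in `cauchyDet_sub_swap`, the antisymmetric part. -/
theorem cauchyDet_add_swap {n : ℕ} (p q : Polynomial ℂ) (h : Fin n → Polynomial ℂ) :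
    2 ^ n * (cauchyDet hβ (Fin.cons p h : Fin (n + 1) → Polynomial ℂ) (Fin.cons q h) +
      cauchyDet hβ (Fin.cons q h : Fin (n + 1) → Polynomial ℂ) (Fin.cons p h)) =
      buresPf hβ (Fin.cons p h : Fin (n + 1) → Polynomial ℂ) *
        buresPf hβ (Fin.cons q h : Fin (n + 1) → Polynomial ℂ) := by
  have h1 := two_pow_mul_cauchyDet hβ p q h
  have h2 := two_pow_mul_cauchyDet hβ q p h
  have h3 : buresPf hβ (Fin.cons p (Fin.cons q h : Fin (n + 1) → Polynomial ℂ) :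
      Fin (n + 2) → Polynomial ℂ) = -_ := extPf_cons_cons_swap _ _ h p q
  rw [h3] at h1
  rw [pow_succ] at h1 h2
  unfold buresPf at *
  linear_combination (h1 + h2) / 2

theorem cauchyDet_sub_swap {n : ℕ} (p q : Polynomial ℂ) (h : Fin n → Polynomial ℂ) :
    2 ^ n * (cauchyDet hβ (Fin.cons p h : Fin (n + 1) → Polynomial ℂ) (Fin.cons q h) -
      cauchyDet hβ (Fin.cons q h : Fin (n + 1) → Polynomial ℂ) (Fin.cons p h)) =
      buresPf hβ h *
        buresPf hβ (Fin.cons p (Fin.cons q h : Fin (n + 1) → Polynomial ℂ) :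
          Fin (n + 2) → Polynomial ℂ) := by
  have h1 := two_pow_mul_cauchyDet hβ p q h
  have h2 := two_pow_mul_cauchyDet hβ q p h
  have h3 : buresPf hβ (Fin.cons q (Fin.cons p h : Fin (n + 1) → Polynomial ℂ) :
      Fin (n + 2) → Polynomial ℂ) = -_ := extPf_cons_cons_swap _ _ h q p
  rw [h3] at h2
  rw [pow_succ] at h1 h2
  unfold buresPf at *
  linear_combination (h1 - h2) / 2

theorem buresPf_snoc {n : ℕ} (h : Fin n → Polynomial ℂ) (p : Polynomial ℂ) :
    buresPf hβ (Fin.snoc h p : Fin (n + 1) → Polynomial ℂ) =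
      (-1) ^ n * buresPf hβ (Fin.cons p h : Fin (n + 1) → Polynomial ℂ) :=
  extPf_snoc _ _ h p

theorem cauchyDet_snoc_right {n : ℕ} (f : Fin (n + 1) → Polynomial ℂ) (h : Fin n → Polynomial ℂ)
    (p : Polynomial ℂ) :
    cauchyDet hβ f (Fin.snoc h p : Fin (n + 1) → Polynomial ℂ) =
      (-1) ^ n * cauchyDet hβ f (Fin.cons p h : Fin (n + 1) → Polynomial ℂ) := by
  have := detGram_comp_perm (fun P Q => cLin hβ P Q) f (Fin.cons p h : Fin (n + 1) → Polynomial ℂ)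
    1 (finRotate (n + 1))
  rw [← snoc_eq_cons_comp_finRotate, sign_finRotate_cast] at this
  simpa [cauchyDet] using this

theorem cauchyDet_snoc_left {n : ℕ} (f : Fin (n + 1) → Polynomial ℂ) (h : Fin n → Polynomial ℂ)
    (p : Polynomial ℂ) :
    cauchyDet hβ (Fin.snoc h p : Fin (n + 1) → Polynomial ℂ) f =
      (-1) ^ n * cauchyDet hβ (Fin.cons p h : Fin (n + 1) → Polynomial ℂ) f := by
  have := detGram_comp_perm (fun P Q => cLin hβ P Q) (Fin.cons p h : Fin (n + 1) → Polynomial ℂ) f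
    (finRotate (n + 1)) 1
  rw [← snoc_eq_cons_comp_finRotate, sign_finRotate_cast] at this
  simpa [cauchyDet] using this

theorem buresPf_cons_add {n : ℕ} (c : ℂ) (p q : Polynomial ℂ) (h : Fin n → Polynomial ℂ) :
    buresPf hβ (Fin.cons (c • p + q) (Fin.cons q h : Fin (n + 1) → Polynomial ℂ) :
      Fin (n + 2) → Polynomial ℂ) =
    c * buresPf hβ (Fin.cons p (Fin.cons q h : Fin (n + 1) → Polynomial ℂ) :
      Fin (n + 2) → Polynomial ℂ) := by
  let T : Matrix (Fin (n + 2)) (Fin (n + 2)) ℂ := Matrix.of (Fin.cons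
    (Fin.cons c (Fin.cons 1 0 : Fin (n + 1) → ℂ))
    fun i j => if i.succ = j then 1 else 0)
  have hT : T.det = c := by
    rw [Matrix.det_of_isUpperTriangular, Fin.prod_univ_succ]
    · simp [T]
    · intro i j hij
      have hij : j < i := hij
      induction i using Fin.cases with
      | zero => exact absurd hij (Fin.not_lt_zero _)
      | succ i => simp [T, hij.ne']
  conv_rhs => rw [← hT, ← buresPf_linear_comb]
  congr 1
  ext1 i
  refine Fin.cases ?_ (fun i => ?_) i
  · simp [T, Fin.sum_univ_succ]
  · simp [T]

end Bures

section

open Polynomial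

/-! ### Vandermonde families with one or two prescribed roots -/

section Identities

variable {β : ℝ → ℂ} (hβ : HasAllMoments β)

theorem cons_one_natDegree {n : ℕ} (c : ℂ) (i : Fin (n + 1)) :
    ((Fin.cons 1 (fun i : Fin n => (X - C c) * X ^ (i : ℕ)) : Fin (n + 1) → ℂ[X]) i).natDegree =
      i := by
  refine Fin.cases ?_ (fun i => ?_) i
  · simp
  · rw [Fin.cons_succ, (monic_X_sub_C c).natDegree_mul (monic_X_pow _)]
    simp [add_comm]

theorem cons_one_monic {n : ℕ} (c : ℂ) (i : Fin (n + 1)) :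
    ((Fin.cons 1 (fun i : Fin n => (X - C c) * X ^ (i : ℕ)) : Fin (n + 1) → ℂ[X]) i).Monic := by
  refine Fin.cases ?_ (fun i => ?_) i
  · simp
  · exact (monic_X_sub_C c).mul (monic_X_pow _)

theorem cons_mul_eq {n : ℕ} (a : ℂ[X]) (c : ℂ) :
    (Fin.cons a (fun i : Fin n => a * ((X - C c) * X ^ (i : ℕ))) : Fin (n + 1) → ℂ[X]) =
      fun i => a *
        (Fin.cons 1 (fun i : Fin n => (X - C c) * X ^ (i : ℕ)) : Fin (n + 1) → ℂ[X]) i := by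
  ext1 i
  refine Fin.cases ?_ (fun i => ?_) i <;> simp

theorem snoc_mul_pow {n : ℕ} (a : ℂ[X]) :
    (fun i : Fin (n + 1) => a * X ^ (i : ℕ)) =
      Fin.snoc (fun i : Fin n => a * X ^ (i : ℕ)) (a * X ^ n) := by
  ext1 i
  refine Fin.lastCases ?_ (fun i => ?_) i <;> simp

/-- The polynomials `1, X - c, (X - c) X, …` are monic of consecutive degrees. This form separates
the head `a` from a tail divisible by `X - c`, as the quadratic relations require. -/
theorem buresPf_cons_mul {n : ℕ} (a : ℂ[X]) (c : ℂ) :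
    buresPf hβ (Fin.cons a (fun i : Fin n => a * ((X - C c) * X ^ (i : ℕ))) : Fin (n + 1) → ℂ[X]) =
      buresPf hβ fun i : Fin (n + 1) => a * X ^ (i : ℕ) := by
  rw [cons_mul_eq]
  exact buresPf_monic hβ a _ (cons_one_natDegree c) (cons_one_monic c)

theorem cauchyDet_cons_mul_left {n : ℕ} (a : ℂ[X]) (c : ℂ) (g : Fin (n + 1) → ℂ[X]) :
    cauchyDet hβ
      (Fin.cons a (fun i : Fin n => a * ((X - C c) * X ^ (i : ℕ))) : Fin (n + 1) → ℂ[X]) g =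
      cauchyDet hβ (fun i : Fin (n + 1) => a * X ^ (i : ℕ)) g := by
  rw [cons_mul_eq]
  exact cauchyDet_monic_left hβ a _ g (cons_one_natDegree c) (cons_one_monic c)

theorem cauchyDet_cons_mul_right {n : ℕ} (a : ℂ[X]) (c : ℂ) (f : Fin (n + 1) → ℂ[X]) :
    cauchyDet hβ f
      (Fin.cons a (fun i : Fin n => a * ((X - C c) * X ^ (i : ℕ))) : Fin (n + 1) → ℂ[X]) =
      cauchyDet hβ f fun i : Fin (n + 1) => a * X ^ (i : ℕ) := by
  rw [cons_mul_eq]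
  exact cauchyDet_monic_right hβ a _ f (cons_one_natDegree c) (cons_one_monic c)

/-- The Vandermonde family decomposes along two roots. -/
theorem buresPf_cons_cons_linear {n : ℕ} (a b : ℂ) :
    buresPf hβ (Fin.cons (X - C a) (Fin.cons (X - C b)
      (fun i : Fin n => (X - C a) * (X - C b) * X ^ (i : ℕ)) : Fin (n + 1) → ℂ[X]) :
        Fin (n + 2) → ℂ[X]) =
      (b - a) * buresPf hβ fun i : Fin (n + 2) => X ^ (i : ℕ) := by
  have h1 : (X - C a : ℂ[X]) = (b - a) • (1 : ℂ[X]) + (X - C b) := by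
    rw [smul_eq_C_mul, C_sub]
    ring
  have h2 := buresPf_cons_add hβ (b - a) 1 (X - C b)
    (fun i : Fin n => (X - C a) * (X - C b) * X ^ (i : ℕ))
  rw [← h1] at h2
  rw [h2]
  congr 1
  have h := buresPf_monic hβ 1 (Fin.cons 1 (Fin.cons (X - C b)
      (fun i : Fin n => (X - C a) * (X - C b) * X ^ (i : ℕ)) : Fin (n + 1) → ℂ[X]) :
        Fin (n + 2) → ℂ[X]) ?_ ?_
  · simpa using h
  · intro i
    refine Fin.cases ?_ (fun i => ?_) i
    · simp
    refine Fin.cases ?_ (fun i => ?_) i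
    · simp
    · rw [Fin.cons_succ, Fin.cons_succ,
        ((monic_X_sub_C a).mul (monic_X_sub_C b)).natDegree_mul (monic_X_pow _),
        (monic_X_sub_C a).natDegree_mul (monic_X_sub_C b)]
      simp
      ring
  · intro i
    refine Fin.cases ?_ (fun i => ?_) i
    · simp
    refine Fin.cases ?_ (fun i => ?_) i
    · exact monic_X_sub_C b
    · exact ((monic_X_sub_C a).mul (monic_X_sub_C b)).mul (monic_X_pow _)

/-- Up to unitriangular changes the two families share the tail `(X - a) (X - b) X ^ i` and differ
in the heads `X - a` and `X - b`, so `cauchyDet_sub_swap` applies. -/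
theorem cauchyDet_linear_sub_swap {n : ℕ} (a b : ℂ) :
    2 ^ n * (cauchyDet hβ (fun i : Fin (n + 1) => (X - C a) * X ^ (i : ℕ))
        (fun i : Fin (n + 1) => (X - C b) * X ^ (i : ℕ)) -
      cauchyDet hβ (fun i : Fin (n + 1) => (X - C b) * X ^ (i : ℕ))
        (fun i : Fin (n + 1) => (X - C a) * X ^ (i : ℕ))) =
      (b - a) * (buresPf hβ (fun i : Fin n => (X - C a) * (X - C b) * X ^ (i : ℕ)) *
        buresPf hβ fun i : Fin (n + 2) => X ^ (i : ℕ)) := by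
  have h := cauchyDet_sub_swap hβ (X - C a) (X - C b)
    (fun i : Fin n => (X - C a) * (X - C b) * X ^ (i : ℕ))
  rw [buresPf_cons_cons_linear] at h
  have e1 : (fun i : Fin n => (X - C a) * (X - C b) * X ^ (i : ℕ)) =
      fun i : Fin n => (X - C a) * ((X - C b) * X ^ (i : ℕ)) := by
    ext1 i
    ring
  have e2 : (fun i : Fin n => (X - C a) * (X - C b) * X ^ (i : ℕ)) =
      fun i : Fin n => (X - C b) * ((X - C a) * X ^ (i : ℕ)) := by
    ext1 i
    ring
  rw [← cauchyDet_cons_mul_left hβ (X - C a) b, ← cauchyDet_cons_mul_right hβ (X - C b) a,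
    ← cauchyDet_cons_mul_left hβ (X - C b) a, ← cauchyDet_cons_mul_right hβ (X - C a) b,
    ← e1, ← e2, h]
  ring

/-- The symmetric part for one numerator and one denominator root. -/
theorem cauchyDet_linear_add_swap {n : ℕ} (a b : ℂ) :
    2 ^ n * (cauchyDet hβ (fun i : Fin (n + 1) => (X - C a) * X ^ (i : ℕ))
        (fun i : Fin (n + 1) => (X - C b) * X ^ (i : ℕ)) +
      cauchyDet hβ (fun i : Fin (n + 1) => (X - C b) * X ^ (i : ℕ))
        (fun i : Fin (n + 1) => (X - C a) * X ^ (i : ℕ))) =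
      buresPf hβ (fun i : Fin (n + 1) => (X - C a) * X ^ (i : ℕ)) *
        buresPf hβ fun i : Fin (n + 1) => (X - C b) * X ^ (i : ℕ) := by
  have h := cauchyDet_add_swap hβ (X - C a) (X - C b)
    (fun i : Fin n => (X - C a) * (X - C b) * X ^ (i : ℕ))
  have e1 : (fun i : Fin n => (X - C a) * (X - C b) * X ^ (i : ℕ)) =
      fun i : Fin n => (X - C a) * ((X - C b) * X ^ (i : ℕ)) := by
    ext1 i
    ring
  have e2 : (fun i : Fin n => (X - C a) * (X - C b) * X ^ (i : ℕ)) =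
      fun i : Fin n => (X - C b) * ((X - C a) * X ^ (i : ℕ)) := by
    ext1 i
    ring
  rw [← cauchyDet_cons_mul_left hβ (X - C a) b, ← cauchyDet_cons_mul_right hβ (X - C b) a,
    ← cauchyDet_cons_mul_left hβ (X - C b) a, ← cauchyDet_cons_mul_right hβ (X - C a) b,
    ← e1, ← e2, h, ← buresPf_cons_mul hβ _ b,
    ← buresPf_cons_mul hβ (X - C b) a, ← e1, ← e2]

theorem buresPf_cons_one {n : ℕ} (b : ℂ) :
    buresPf hβ (Fin.cons 1 (fun i : Fin n => (X - C b) * X ^ (i : ℕ)) : Fin (n + 1) → ℂ[X]) =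
      buresPf hβ fun i : Fin (n + 1) => X ^ (i : ℕ) := by
  simpa using buresPf_cons_mul hβ (n := n) 1 b

theorem cauchyDet_cons_one_left {n : ℕ} (b : ℂ) (g : Fin (n + 1) → ℂ[X]) :
    cauchyDet hβ (Fin.cons 1 (fun i : Fin n => (X - C b) * X ^ (i : ℕ)) : Fin (n + 1) → ℂ[X]) g =
      cauchyDet hβ (fun i : Fin (n + 1) => X ^ (i : ℕ)) g := by
  simpa using cauchyDet_cons_mul_left hβ (n := n) 1 b g

theorem cauchyDet_cons_one_right {n : ℕ} (b : ℂ) (f : Fin (n + 1) → ℂ[X]) :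
    cauchyDet hβ f (Fin.cons 1 (fun i : Fin n => (X - C b) * X ^ (i : ℕ)) : Fin (n + 1) → ℂ[X]) =
      cauchyDet hβ f fun i : Fin (n + 1) => X ^ (i : ℕ) := by
  simpa using cauchyDet_cons_mul_right hβ (n := n) 1 b f

/-- Here the common tail is `(X - b) X ^ i` for `i < n`, and the heads are `1` and `(X - b) X ^ n`.
The latter stands last in its family, so moving it to the front costs `(-1) ^ n`. -/
theorem cauchyDet_one_add_swap {n : ℕ} (b : ℂ) :
    2 ^ n * (cauchyDet hβ (fun i : Fin (n + 1) => X ^ (i : ℕ))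
        (fun i : Fin (n + 1) => (X - C b) * X ^ (i : ℕ)) +
      cauchyDet hβ (fun i : Fin (n + 1) => (X - C b) * X ^ (i : ℕ))
        (fun i : Fin (n + 1) => X ^ (i : ℕ))) =
      buresPf hβ (fun i : Fin (n + 1) => X ^ (i : ℕ)) *
        buresPf hβ fun i : Fin (n + 1) => (X - C b) * X ^ (i : ℕ) := by
  have h := cauchyDet_add_swap hβ 1 ((X - C b) * X ^ n) (fun i : Fin n => (X - C b) * X ^ (i : ℕ))
  rw [cauchyDet_cons_one_left, cauchyDet_cons_one_right, buresPf_cons_one] at h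
  rw [snoc_mul_pow, cauchyDet_snoc_left, cauchyDet_snoc_right, buresPf_snoc]
  linear_combination (-1) ^ n * h

theorem cauchyDet_one_sub_swap {n : ℕ} (b : ℂ) :
    2 ^ n * (cauchyDet hβ (fun i : Fin (n + 1) => (X - C b) * X ^ (i : ℕ))
        (fun i : Fin (n + 1) => X ^ (i : ℕ)) -
      cauchyDet hβ (fun i : Fin (n + 1) => X ^ (i : ℕ))
        (fun i : Fin (n + 1) => (X - C b) * X ^ (i : ℕ))) =
      -(buresPf hβ (fun i : Fin n => (X - C b) * X ^ (i : ℕ)) *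
        buresPf hβ fun i : Fin (n + 2) => X ^ (i : ℕ)) := by
  have h := cauchyDet_sub_swap hβ 1 ((X - C b) * X ^ n) (fun i : Fin n => (X - C b) * X ^ (i : ℕ))
  have h2 := buresPf_cons_one hβ (n := n + 1) b
  rw [snoc_mul_pow] at h2
  have h3 : buresPf hβ (Fin.cons 1 (Fin.snoc (fun i : Fin n => (X - C b) * X ^ (i : ℕ))
      ((X - C b) * X ^ n) : Fin (n + 1) → ℂ[X]) : Fin (n + 2) → ℂ[X]) = _ :=
    extPf_cons_snoc _ _ _ _ _
  rw [cauchyDet_cons_one_left, cauchyDet_cons_one_right] at h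
  rw [snoc_mul_pow, cauchyDet_snoc_left, cauchyDet_snoc_right, ← h2, h3]
  unfold buresPf at *
  linear_combination -(-1) ^ n * h

/-- The symmetric relation with equal heads `p = q = 1`: its two determinants coincide, which
supplies the last factor two. Writing `X` as `X - C 0` gives the tail the required form. -/
theorem two_pow_mul_cauchyDet_self {n : ℕ} :
    2 ^ n * cauchyDet hβ (fun i : Fin n => X ^ (i : ℕ)) (fun i : Fin n => X ^ (i : ℕ)) =
      (buresPf hβ fun i : Fin n => X ^ (i : ℕ)) ^ 2 := by
  cases n with
  | zero => simp [cauchyDet, detGram, buresPf, extPf, pfGram, pfaffian]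
  | succ n =>
    have h := cauchyDet_add_swap hβ 1 1 (fun i : Fin n => (X - C 0) * X ^ (i : ℕ))
    rw [cauchyDet_cons_one_left, cauchyDet_cons_one_right, buresPf_cons_one] at h
    rw [pow_succ 2 n]
    linear_combination h

/-- The antisymmetric relation with heads `X ^ (n + 1)` and `X ^ n`. Moving both past the tail is
even, but they come in the wrong order; this minus sign is what makes `ZHat` negative for positive
`ZB₀`. -/
theorem two_pow_mul_cauchyDet_gap {n : ℕ} :
    2 ^ n * (cauchyDet hβ (fun i : Fin (n + 1) => X ^ gapExp i)
        (fun i : Fin (n + 1) => X ^ (i : ℕ)) -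
      cauchyDet hβ (fun i : Fin (n + 1) => X ^ (i : ℕ))
        (fun i : Fin (n + 1) => X ^ gapExp i)) =
      -((buresPf hβ fun i : Fin n => X ^ (i : ℕ)) *
        buresPf hβ fun i : Fin (n + 2) => X ^ (i : ℕ)) := by
  have h := cauchyDet_sub_swap hβ (X ^ (n + 1)) (X ^ n) (fun i : Fin n => X ^ (i : ℕ))
  have hs : ∀ n, (fun i : Fin (n + 1) => (X : ℂ[X]) ^ (i : ℕ)) =
      Fin.snoc (fun i : Fin n => X ^ (i : ℕ)) (X ^ n) := by
    intro n
    simpa using snoc_mul_pow (n := n) 1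
  have hg : (fun i : Fin (n + 1) => (X : ℂ[X]) ^ gapExp i) =
      Fin.snoc (fun i : Fin n => X ^ (i : ℕ)) (X ^ (n + 1)) := by
    ext1 i
    refine Fin.lastCases ?_ (fun i => ?_) i
    · simp [gapExp]
    · simp [gapExp, i.2.ne]
  have h3 : buresPf hβ (fun i : Fin (n + 2) => (X : ℂ[X]) ^ (i : ℕ)) = -buresPf hβ
      (Fin.cons (X ^ (n + 1)) (Fin.cons (X ^ n) fun i : Fin n => X ^ (i : ℕ) : Fin (n + 1) → ℂ[X]) :
        Fin (n + 2) → ℂ[X]) := by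
    rw [hs (n + 1), buresPf_snoc, hs n]
    have := extPf_cons_snoc (fun P Q => aLin hβ P Q) (fun P => bLin hβ P)
      (fun i : Fin n => X ^ (i : ℕ)) (X ^ (n + 1)) (X ^ n)
    unfold buresPf
    rw [this, ← mul_assoc, ← pow_add, show n + 1 + n = 2 * n + 1 by ring, pow_succ, pow_mul]
    simp
  rw [h3, hg, hs n, cauchyDet_snoc_left, cauchyDet_snoc_left, cauchyDet_snoc_right,
    cauchyDet_snoc_right]
  have hsq : ((-1 : ℂ) ^ n) * (-1) ^ n = 1 := by rw [← mul_pow]; simp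
  linear_combination h + 2 ^ n * (cauchyDet hβ
    (Fin.cons (X ^ (n + 1)) fun i : Fin n => X ^ (i : ℕ) : Fin (n + 1) → ℂ[X])
    (Fin.cons (X ^ n) fun i : Fin n => X ^ (i : ℕ) : Fin (n + 1) → ℂ[X]) -
    cauchyDet hβ (Fin.cons (X ^ n) fun i : Fin n => X ^ (i : ℕ) : Fin (n + 1) → ℂ[X])
    (Fin.cons (X ^ (n + 1)) fun i : Fin n => X ^ (i : ℕ) : Fin (n + 1) → ℂ[X])) * hsq

end Identities

end

section

open Polynomial

/-! ### Relations between the partition functions of the two ensembles -/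

section PartitionFunctions

variable {α : ℝ → ℂ} (hα : HasAllMoments α)
include hα

theorem ZB_zero_eq_buresPf (n : ℕ) : ZB₀ α n = buresPf hα fun i : Fin n => X ^ (i : ℕ) :=
  ZB_eq_buresPf α hα _ _ _ fun i z _ => by simp [charRatio]

theorem two_pow_mul_ZC_zero (n : ℕ) : 2 ^ n * ZC₀ α n = ZB₀ α n ^ 2 := by
  rw [ZB_zero_eq_buresPf hα, ← two_pow_mul_cauchyDet_self, ZC₀,
    ZC_eq_cauchyDet α hα _ _ _ _ (fun i => X ^ (i : ℕ)) (fun i => X ^ (i : ℕ))] <;>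
  simp [charRatio]

theorem two_pow_mul_ZHat (n : ℕ) :
    2 ^ n * ZHat α (n + 1) = -(ZB₀ α n * ZB₀ α (n + 2)) := by
  rw [ZHat_eq_cauchyDet hα, ZB_zero_eq_buresPf hα, ZB_zero_eq_buresPf hα, two_pow_mul_cauchyDet_gap]

/-- With respect to the weight `α / ((z - κ₁) (z - κ₂))`, the pole at `κ₁` alone becomes the factor
`X - κ₂` and conversely, both poles together become `1`, and no pole becomes the product of both
factors. -/
theorem ZC_poles_sub_swap (n : ℕ) {κ₁ κ₂ : ℂ} (h₁ : ∀ t : ℝ, 0 ≤ t → κ₁ ≠ t)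
    (h₂ : ∀ t : ℝ, 0 ≤ t → κ₂ ≠ t) :
    2 ^ n * (ZC α (n + 1) ![κ₁] ![] ![κ₂] ![] - ZC α (n + 1) ![κ₂] ![] ![κ₁] ![]) =
      (κ₁ - κ₂) * (ZB₀ α n * ZB α (n + 2) ![κ₁, κ₂] ![]) := by
  have hβ := (hα.div_sub h₁).div_sub h₂
  have h := cauchyDet_linear_sub_swap hβ (n := n) κ₂ κ₁
  have ne₁ : ∀ z : ℝ, 0 < z → (z : ℂ) - κ₁ ≠ 0 := fun z hz => sub_ne_zero.mpr (h₁ z hz.le).symm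
  have ne₂ : ∀ z : ℝ, 0 < z → (z : ℂ) - κ₂ ≠ 0 := fun z hz => sub_ne_zero.mpr (h₂ z hz.le).symm
  have e₁ : ∀ m, ∀ i : Fin m, ∀ z : ℝ, 0 < z → α z * charRatio ![κ₁] ![] z * (z : ℂ) ^ (i : ℕ) =
      α z / (z - κ₁) / (z - κ₂) * ((X - C κ₂) * X ^ (i : ℕ) : ℂ[X]).eval (z : ℂ) := by
    intro m i z hz
    have := ne₁ z hz
    have := ne₂ z hz
    simp [charRatio]
    field_simp
  have e₂ : ∀ m, ∀ i : Fin m, ∀ z : ℝ, 0 < z → α z * charRatio ![κ₂] ![] z * (z : ℂ) ^ (i : ℕ) =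
      α z / (z - κ₁) / (z - κ₂) * ((X - C κ₁) * X ^ (i : ℕ) : ℂ[X]).eval (z : ℂ) := by
    intro m i z hz
    have := ne₁ z hz
    have := ne₂ z hz
    simp [charRatio]
    field_simp
  rw [ZC_eq_cauchyDet α hβ _ _ _ _ _ _ (e₁ _) (e₂ _),
    ZC_eq_cauchyDet α hβ _ _ _ _ _ _ (e₂ _) (e₁ _), h, ZB₀,
    ZB_eq_buresPf α hβ ![] ![] (fun i => (X - C κ₂) * (X - C κ₁) * X ^ (i : ℕ)),
    ZB_eq_buresPf α hβ ![κ₁, κ₂] ![] (fun i => X ^ (i : ℕ))]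
  · intro i z hz
    simp only [charRatio, Fin.prod_univ_two, Finset.univ_eq_empty, Finset.prod_empty, eval_pow,
      eval_X, Matrix.cons_val_zero, Matrix.cons_val_one, div_div]
    ring
  · intro i z hz
    have := ne₁ z hz
    have := ne₂ z hz
    simp [charRatio]
    field_simp

theorem ZC_zeros_sub_swap (n : ℕ) (lam₁ lam₂ : ℂ) :
    2 ^ n * (ZC α (n + 1) ![] ![lam₁] ![] ![lam₂] - ZC α (n + 1) ![] ![lam₂] ![] ![lam₁]) =
      (lam₂ - lam₁) * (ZB α n ![] ![lam₁, lam₂] * ZB₀ α (n + 2)) := by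
  have h := cauchyDet_linear_sub_swap hα (n := n) lam₁ lam₂
  have e : ∀ m, ∀ c : ℂ, ∀ i : Fin m, ∀ z : ℝ, 0 < z →
      α z * charRatio ![] ![c] z * (z : ℂ) ^ (i : ℕ) =
      α z * ((X - C c) * X ^ (i : ℕ) : ℂ[X]).eval (z : ℂ) := by
    intro m c i z _
    simp [charRatio, mul_assoc]
  rw [ZC_eq_cauchyDet α hα _ _ _ _ _ _ (e _ lam₁) (e _ lam₂),
    ZC_eq_cauchyDet α hα _ _ _ _ _ _ (e _ lam₂) (e _ lam₁), h, ZB_zero_eq_buresPf hα,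
    ZB_eq_buresPf α hα ![] ![lam₁, lam₂] (fun i => (X - C lam₁) * (X - C lam₂) * X ^ (i : ℕ))]
  intro i z hz
  simp [charRatio, mul_assoc]

theorem ZC_zero_sub_swap (n : ℕ) (lam : ℂ) :
    2 ^ n * (ZC α (n + 1) ![] ![lam] ![] ![] - ZC α (n + 1) ![] ![] ![] ![lam]) =
      -(ZB α n ![] ![lam] * ZB₀ α (n + 2)) := by
  have e : ∀ m, ∀ i : Fin m, ∀ z : ℝ, 0 < z →
      α z * charRatio ![] ![lam] z * (z : ℂ) ^ (i : ℕ) =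
      α z * ((X - C lam) * X ^ (i : ℕ) : ℂ[X]).eval (z : ℂ) := by
    intro m i z _
    simp [charRatio, mul_assoc]
  have e₀ : ∀ m, ∀ i : Fin m, ∀ z : ℝ, 0 < z →
      α z * charRatio ![] ![] z * (z : ℂ) ^ (i : ℕ) =
      α z * (X ^ (i : ℕ) : ℂ[X]).eval (z : ℂ) := by
    intro m i z _
    simp [charRatio]
  rw [ZC_eq_cauchyDet α hα _ _ _ _ _ _ (e _) (e₀ _),
    ZC_eq_cauchyDet α hα _ _ _ _ _ _ (e₀ _) (e _), cauchyDet_one_sub_swap, ZB_zero_eq_buresPf hα,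
    ZB_eq_buresPf α hα _ _ _ (e _)]

omit hα in
theorem ZB_size_zero {k l : ℕ} (kap : Fin k → ℂ) (lam : Fin l → ℂ) : ZB α 0 kap lam = 1 := by
  have h : orthant 0 = Set.univ := Set.eq_univ_of_forall fun _ i => i.elim0
  have : IsProbabilityMeasure (volume : Measure (Fin 0 → ℝ)) :=
    ⟨by simp [volume_pi]⟩
  simp [ZB, h, vand]

omit hα in
theorem ZC_size_zero {k₁ l₁ k₂ l₂ : ℕ} (kap₁ : Fin k₁ → ℂ) (lam₁ : Fin l₁ → ℂ)
    (kap₂ : Fin k₂ → ℂ) (lam₂ : Fin l₂ → ℂ) : ZC α 0 kap₁ lam₁ kap₂ lam₂ = 1 := by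
  have h : orthant 0 = Set.univ := Set.eq_univ_of_forall fun _ i => i.elim0
  have : IsProbabilityMeasure (volume : Measure (Fin 0 → ℝ)) :=
    ⟨by simp [volume_pi]⟩
  simp [ZC, h, vand, cauchyDensity, Measure.volume_eq_prod]

/-- With the weight `α / (z - κ)` the trivial ratio becomes `X - κ` and the ratio with pole and zero
becomes `X - lam`. The quadratic relations concern size at least one, so `n = 0` is checked
directly. -/
theorem ZC_pole_zero_add_swap (n : ℕ) {κ : ℂ} (h₁ : ∀ t : ℝ, 0 ≤ t → κ ≠ t) (lam : ℂ) :
    2 ^ n * (ZC α n ![] ![] ![κ] ![lam] + ZC α n ![κ] ![lam] ![] ![]) =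
      2 * (ZB₀ α n * ZB α n ![κ] ![lam]) := by
  cases n with
  | zero =>
    rw [ZB₀]
    simp only [ZB_size_zero, ZC_size_zero]
    norm_num
  | succ n =>
  have hβ := hα.div_sub h₁
  have ne₁ : ∀ z : ℝ, 0 < z → (z : ℂ) - κ ≠ 0 := fun z hz => sub_ne_zero.mpr (h₁ z hz.le).symm
  have e₁ : ∀ m, ∀ i : Fin m, ∀ z : ℝ, 0 < z → α z * charRatio ![] ![] z * (z : ℂ) ^ (i : ℕ) =
      α z / (z - κ) * ((X - C κ) * X ^ (i : ℕ) : ℂ[X]).eval (z : ℂ) := by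
    intro m i z hz
    have := ne₁ z hz
    simp [charRatio]
    field_simp
  have e₂ : ∀ m, ∀ i : Fin m, ∀ z : ℝ, 0 < z →
      α z * charRatio ![κ] ![lam] z * (z : ℂ) ^ (i : ℕ) =
      α z / (z - κ) * ((X - C lam) * X ^ (i : ℕ) : ℂ[X]).eval (z : ℂ) := by
    intro m i z hz
    have := ne₁ z hz
    simp [charRatio]
    field_simp
  rw [ZC_eq_cauchyDet α hβ _ _ _ _ _ _ (e₁ _) (e₂ _),
    ZC_eq_cauchyDet α hβ _ _ _ _ _ _ (e₂ _) (e₁ _), ZB₀, ZB_eq_buresPf α hβ _ _ _ (e₁ _),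
    ZB_eq_buresPf α hβ _ _ _ (e₂ _), ← cauchyDet_linear_add_swap]
  ring

theorem ZC_pole_add_swap (n : ℕ) {κ : ℂ} (h₁ : ∀ t : ℝ, 0 ≤ t → κ ≠ t) :
    2 ^ n * (ZC α n ![] ![] ![κ] ![] + ZC α n ![κ] ![] ![] ![]) =
      2 * (ZB₀ α n * ZB α n ![κ] ![]) := by
  cases n with
  | zero =>
    rw [ZB₀]
    simp only [ZB_size_zero, ZC_size_zero]
    norm_num
  | succ n =>
  have hβ := hα.div_sub h₁
  have ne₁ : ∀ z : ℝ, 0 < z → (z : ℂ) - κ ≠ 0 := fun z hz => sub_ne_zero.mpr (h₁ z hz.le).symm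
  have e₁ : ∀ m, ∀ i : Fin m, ∀ z : ℝ, 0 < z → α z * charRatio ![] ![] z * (z : ℂ) ^ (i : ℕ) =
      α z / (z - κ) * ((X - C κ) * X ^ (i : ℕ) : ℂ[X]).eval (z : ℂ) := by
    intro m i z hz
    have := ne₁ z hz
    simp [charRatio]
    field_simp
  have e₂ : ∀ m, ∀ i : Fin m, ∀ z : ℝ, 0 < z → α z * charRatio ![κ] ![] z * (z : ℂ) ^ (i : ℕ) =
      α z / (z - κ) * (X ^ (i : ℕ) : ℂ[X]).eval (z : ℂ) := by
    intro m i z _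
    simp only [charRatio, Finset.univ_unique, Fin.default_eq_zero, Finset.prod_singleton,
      Matrix.cons_val_fin_one, Finset.univ_eq_empty, Finset.prod_empty, eval_pow, eval_X]
    ring
  rw [ZC_eq_cauchyDet α hβ _ _ _ _ _ _ (e₁ _) (e₂ _),
    ZC_eq_cauchyDet α hβ _ _ _ _ _ _ (e₂ _) (e₁ _), ZB₀, ZB_eq_buresPf α hβ _ _ _ (e₁ _),
    ZB_eq_buresPf α hβ _ _ _ (e₂ _), pow_succ]
  have h := cauchyDet_one_add_swap hβ (n := n) κ
  linear_combination 2 * h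

/-! ### The kernels as partition functions of both ensembles -/

theorem ZB_two_poles_div (N : ℕ) {κ₁ κ₂ : ℂ} (hN : 2 ≤ N) (h₁ : ∀ t : ℝ, 0 ≤ t → κ₁ ≠ t)
    (h₂ : ∀ t : ℝ, 0 ≤ t → κ₂ ≠ t) (hne : κ₁ ≠ κ₂) (hB : ZB₀ α N ≠ 0)
    (hZ : ZHat α (N - 1) ≠ 0) :
    ZB α N ![κ₁, κ₂] ![] / ZB₀ α N =
      1 / (κ₂ - κ₁) * ((ZC α (N - 1) ![κ₁] ![] ![κ₂] ![] - ZC α (N - 1) ![κ₂] ![] ![κ₁] ![]) /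
        ZHat α (N - 1)) := by
  obtain ⟨n, rfl⟩ : ∃ n, N = n + 2 := ⟨N - 2, by omega⟩
  have e : n + 2 - 1 = n + 1 := rfl
  rw [e] at hZ ⊢
  have h := ZC_poles_sub_swap hα n h₁ h₂
  have h' := two_pow_mul_ZHat hα n
  have hne' : κ₂ - κ₁ ≠ 0 := sub_ne_zero.mpr hne.symm
  have h2 : (2 : ℂ) ^ n ≠ 0 := by positivity
  rw [one_div_mul_eq_div, div_div, div_eq_div_iff hB (mul_ne_zero hZ hne')]
  refine mul_left_cancel₀ h2 ?_
  linear_combination ZB α (n + 2) ![κ₁, κ₂] ![] * (κ₂ - κ₁) * h' - ZB₀ α (n + 2) * h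

theorem ZB_pole_zero_div (N : ℕ) {κ : ℂ} (h₁ : ∀ t : ℝ, 0 ≤ t → κ ≠ t) (lam : ℂ)
    (hB : ZB₀ α N ≠ 0) (hC : ZC₀ α N ≠ 0) :
    ZB α N ![κ] ![lam] / ZB₀ α N =
      (ZC α N ![] ![] ![κ] ![lam] + ZC α N ![κ] ![lam] ![] ![]) / (2 * ZC₀ α N) := by
  have h := ZC_pole_zero_add_swap hα N h₁ lam
  have h' := two_pow_mul_ZC_zero hα N
  have h2 : (2 : ℂ) ^ N ≠ 0 := by positivity
  rw [div_eq_div_iff hB (mul_ne_zero two_ne_zero hC)]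
  refine mul_left_cancel₀ h2 ?_
  linear_combination 2 * ZB α N ![κ] ![lam] * h' - ZB₀ α N * h

theorem ZB_two_zeros_div (N : ℕ) {lam₁ lam₂ : ℂ} (hne : lam₁ ≠ lam₂) (hB : ZB₀ α N ≠ 0)
    (hZ : ZHat α (N + 1) ≠ 0) :
    ZB α N ![] ![lam₁, lam₂] / ZB₀ α N =
      1 / (lam₁ - lam₂) * ((ZC α (N + 1) ![] ![lam₁] ![] ![lam₂] -
        ZC α (N + 1) ![] ![lam₂] ![] ![lam₁]) / ZHat α (N + 1)) := by
  have h := ZC_zeros_sub_swap hα N lam₁ lam₂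
  have h' := two_pow_mul_ZHat hα N
  have hne' : lam₁ - lam₂ ≠ 0 := sub_ne_zero.mpr hne
  have h2 : (2 : ℂ) ^ N ≠ 0 := by positivity
  rw [one_div_mul_eq_div, div_div, div_eq_div_iff hB (mul_ne_zero hZ hne')]
  refine mul_left_cancel₀ h2 ?_
  linear_combination ZB α N ![] ![lam₁, lam₂] * (lam₁ - lam₂) * h' - ZB₀ α N * h

theorem ZB_pole_div (N : ℕ) {κ : ℂ} (h₁ : ∀ t : ℝ, 0 ≤ t → κ ≠ t)
    (hB : ZB₀ α N ≠ 0) (hC : ZC₀ α N ≠ 0) :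
    ZB α N ![κ] ![] / ZB₀ α N =
      (ZC α N ![] ![] ![κ] ![] + ZC α N ![κ] ![] ![] ![]) / (2 * ZC₀ α N) := by
  have h := ZC_pole_add_swap hα N h₁
  have h' := two_pow_mul_ZC_zero hα N
  have h2 : (2 : ℂ) ^ N ≠ 0 := by positivity
  rw [div_eq_div_iff hB (mul_ne_zero two_ne_zero hC)]
  refine mul_left_cancel₀ h2 ?_
  linear_combination 2 * ZB α N ![κ] ![] * h' - ZB₀ α N * h

theorem ZB_zero_div (N : ℕ) (lam : ℂ) (hB : ZB₀ α N ≠ 0) (hZ : ZHat α (N + 1) ≠ 0) :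
    ZB α N ![] ![lam] / ZB₀ α N =
      (ZC α (N + 1) ![] ![lam] ![] ![] - ZC α (N + 1) ![] ![] ![] ![lam]) / ZHat α (N + 1) := by
  have h := ZC_zero_sub_swap hα N lam
  have h' := two_pow_mul_ZHat hα N
  have h2 : (2 : ℂ) ^ N ≠ 0 := by positivity
  rw [div_eq_div_iff hB hZ]
  refine mul_left_cancel₀ h2 ?_
  linear_combination ZB α N ![] ![lam] * h' - ZB₀ α N * h

/-! ### Positivity -/

theorem ZC_zero_pos (h : ∀ L, 0 < ZB₀ α L) (L : ℕ) : 0 < ZC₀ α L := by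
  have h2 : (0 : ℂ) < 2 ^ L := by positivity
  have e : ZC₀ α L = ((2 ^ L : ℝ)⁻¹ : ℝ) * ZB₀ α L ^ 2 := by
    rw [← two_pow_mul_ZC_zero hα]
    push_cast
    field_simp
  rw [e]
  exact mul_pos (Complex.zero_lt_real.mpr (inv_pos.mpr (pow_pos two_pos L))) (pow_pos (h L) 2)

theorem ZHat_neg (h : ∀ L, 0 < ZB₀ α L) {L : ℕ} (hL : 1 ≤ L) : ZHat α L < 0 := by
  obtain ⟨n, rfl⟩ : ∃ n, L = n + 1 := ⟨L - 1, by omega⟩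
  have e : ZHat α (n + 1) = -(((2 ^ n : ℝ)⁻¹ : ℝ) * (ZB₀ α n * ZB₀ α (n + 2))) := by
    rw [← neg_eq_iff_eq_neg.mpr (two_pow_mul_ZHat hα n)]
    push_cast
    field_simp
  rw [e]
  exact neg_neg_of_pos (mul_pos (Complex.zero_lt_real.mpr (inv_pos.mpr (pow_pos two_pos n)))
    (mul_pos (h n) (h _)))

theorem meanSign_eq (h : ∀ L, 0 < ZB₀ α L) {L : ℕ} (hL : 1 ≤ L) : meanSign α L = -1 := by
  have := (Complex.lt_def.mp (ZHat_neg hα h hL)).1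
  rw [meanSign, Real.sign_of_neg this]
  simp

end PartitionFunctions

end

theorem buresWeight_pos {n : ℕ} {z : Fin n → ℝ} (hz : ∀ i, 0 < z i)
    (hinj : Function.Injective z) :
    0 < vand z ^ 2 / ∏ i, ∏ j ∈ Finset.Ioi i, (z i + z j) := by
  have hv : vand z ≠ 0 := Finset.prod_ne_zero_iff.mpr fun i _ => Finset.prod_ne_zero_iff.mpr
    fun j hj => sub_ne_zero.mpr (hinj.ne (Finset.mem_Ioi.mp hj).ne')
  exact div_pos (pow_two_pos_of_ne_zero hv)
    (Finset.prod_pos fun i _ => Finset.prod_pos fun j _ => add_pos (hz i) (hz j))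

theorem ae_injective (n : ℕ) : ∀ᵐ z : Fin n → ℝ, Function.Injective z := by
  have h : ∀ i j : Fin n, i ≠ j → ∀ᵐ z : Fin n → ℝ, z i ≠ z j := by
    intro i j hij
    let S : Submodule ℝ (Fin n → ℝ) :=
      LinearMap.ker ((LinearMap.proj i : (Fin n → ℝ) →ₗ[ℝ] ℝ) - LinearMap.proj j)
    have hS : S ≠ ⊤ := by
      intro htop
      have : (Pi.single i 1 : Fin n → ℝ) ∈ S := htop ▸ Submodule.mem_top
      simp [S, Pi.single_eq_of_ne hij.symm] at this
    have h0 := Measure.addHaar_submodule (volume : Measure (Fin n → ℝ)) S hS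
    refine measure_mono_null (fun z hz => ?_) h0
    have hz : z i = z j := not_not.mp hz
    simp [S, hz]
  have h' : ∀ᵐ z : Fin n → ℝ, ∀ i j, i ≠ j → z i ≠ z j := by
    simp only [ae_all_iff]
    exact h
  filter_upwards [h'] with z hz i j hij
  by_contra hne
  exact hz i j hne hij

/-- The integrand is a weight that is positive off the diagonals, times `∏ α (z_j) ≥ 0`. If the
integral vanished, the product would vanish almost everywhere; hence `(∫ α) ^ L = 0`, and `α = 0`
almost everywhere. -/
theorem ZB_zero_pos {α : ℝ → ℂ} (hα : HasAllMoments α)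
    (h0 : ∀ᵐ z ∂(volume.restrict (Set.Ioi (0 : ℝ))), 0 ≤ α z)
    (hne : ¬ ∀ᵐ z ∂(volume.restrict (Set.Ioi (0 : ℝ))), α z = 0) (L : ℕ) : 0 < ZB₀ α L := by
  let μ : Measure (Fin L → ℝ) := Measure.pi fun _ => posLeb
  let w : (Fin L → ℝ) → ℝ := fun z => vand z ^ 2 / ∏ i, ∏ j ∈ Finset.Ioi i, (z i + z j)
  let a : ℝ → ℝ := fun z => (α z).re
  let g : (Fin L → ℝ) → ℝ := fun z => w z * ∏ j, a (z j)
  have hαint : Integrable α posLeb := by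
    have h := hα 0
    simp only [pow_zero, one_mul] at h
    exact h
  have haint : Integrable a posLeb := hαint.re
  have hαa : ∀ᵐ z ∂posLeb, 0 ≤ a z ∧ α z = (a z : ℂ) := by
    filter_upwards [h0] with z hz
    rw [Complex.le_def] at hz
    exact ⟨hz.1, Complex.ext rfl hz.2.symm⟩
  have hαa' : ∀ᵐ z ∂μ, ∀ i, 0 ≤ a (z i) ∧ α (z i) = (a (z i) : ℂ) := by
    rw [ae_all_iff]
    exact fun i => (Measure.quasiMeasurePreserving_eval (μ := fun _ : Fin L => posLeb) i).ae hαa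
  have hpos : ∀ᵐ z ∂μ, ∀ i, 0 < z i := ae_pos_pi_posLeb L
  have hinj : ∀ᵐ z ∂μ, Function.Injective z := by
    simp only [μ, pi_posLeb]
    exact ae_restrict_of_ae (ae_injective L)
  have hG : ∀ᵐ z ∂μ, ((w z : ℝ) : ℂ) * ∏ j, (α (z j) * charRatio ![] ![] (z j)) = (g z : ℂ) := by
    filter_upwards [hαa'] with z hz
    simp only [g, charRatio]
    push_cast
    congr 1
    refine Finset.prod_congr rfl fun j _ => ?_
    simp [← (hz j).2]
  have hgint : Integrable g μ := by
    have h1 := (integral_det_mul_schur (n := L) (F := polyFun α ∘ fun i => Polynomial.X ^ (i : ℕ))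
      fun i => integrable_polyFun hα _).1
    refine h1.re.congr ?_
    filter_upwards [hG, hpos] with z hz hp
    rw [← buresDensity_eq α ![] ![] (fun i => Polynomial.X ^ (i : ℕ)) (by simp [charRatio]) hp]
    change (((w z : ℝ) : ℂ) * ∏ j, (α (z j) * charRatio ![] ![] (z j))).re = g z
    rw [hz, Complex.ofReal_re]
  have hZ : ZB₀ α L = ((1 / (L.factorial : ℝ) * ∫ z, g z ∂μ : ℝ) : ℂ) := by
    rw [ZB₀, ZB, ← pi_posLeb]
    rw [Complex.ofReal_mul, ← integral_complex_ofReal]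
    congr 1
    · simp
    · exact integral_congr_ae hG
  have hgnn : 0 ≤ᵐ[μ] g := by
    filter_upwards [hαa', hpos, hinj] with z hz hp hi
    exact mul_nonneg (buresWeight_pos hp hi).le (Finset.prod_nonneg fun j _ => (hz j).1)
  rw [hZ, Complex.zero_lt_real]
  refine mul_pos (by positivity) ((integral_nonneg_of_ae hgnn).lt_of_ne' fun hzero => ?_)
  have hg0 := (integral_eq_zero_iff_of_nonneg_ae hgnn hgint).mp hzero
  have hprod : ∫ z : Fin L → ℝ, ∏ j, a (z j) ∂μ = 0 := by
    rw [← integral_zero (Fin L → ℝ) ℝ (μ := μ)]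
    refine integral_congr_ae ?_
    filter_upwards [hg0, hpos, hinj] with z hz hp hi
    exact (mul_eq_zero.mp hz).resolve_left (buresWeight_pos hp hi).ne'
  rw [integral_fintype_prod_eq_pow] at hprod
  have ha0 := (integral_eq_zero_iff_of_nonneg_ae (hαa.mono fun z hz => hz.1) haint).mp
    (by_contra fun hc => pow_ne_zero _ hc hprod)
  refine hne ?_
  filter_upwards [ha0, hαa] with z hz hz'
  rw [hz'.2, hz]
  simp

/-! ### Signs of block swaps -/

theorem finRotate_pow_val {n : ℕ} (k : ℕ) (i : Fin n) :
    (((finRotate n) ^ k) i : ℕ) = (i + k) % n := by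
  cases n with
  | zero => exact i.elim0
  | succ n =>
    induction k with
    | zero => simp [Nat.mod_eq_of_lt i.2]
    | succ k ih =>
      rw [pow_succ', Equiv.Perm.mul_apply, finRotate_apply, Fin.val_add, ih]
      simp [add_assoc]

/-- The block swap is the `n`-th power of the rotation of `m + n` points, and `(m + n - 1) n` has
the parity of `m n`. -/
theorem sign_block_swap (m n : ℕ) :
    Equiv.Perm.sign ((finAddFlip (m := m) (n := n)).trans (finCongr (add_comm n m))) =
      (-1) ^ (m * n) := by
  have h : (finAddFlip (m := m) (n := n)).trans (finCongr (add_comm n m)) =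
      finRotate (m + n) ^ n := by
    ext i
    rw [finRotate_pow_val]
    refine Fin.addCases (fun i => ?_) (fun j => ?_) i
    · have := i.2
      simp only [Equiv.trans_apply, finAddFlip_apply_castAdd, finCongr_apply, Fin.val_cast,
        Fin.val_natAdd, Fin.val_castAdd]
      rw [Nat.mod_eq_of_lt (by omega), add_comm]
    · have := j.2
      simp only [Equiv.trans_apply, finAddFlip_apply_natAdd, finCongr_apply, Fin.val_cast,
        Fin.val_natAdd, Fin.val_castAdd]
      rw [show m + (j : ℕ) + n = j + (m + n) by ring, Nat.add_mod_right,
        Nat.mod_eq_of_lt (by omega)]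
  rw [h, map_pow, sign_finRotate, ← pow_mul]
  cases n with
  | zero => simp
  | succ n =>
    have e : (m + (n + 1) - 1) * (n + 1) = m * (n + 1) + n * (n + 1) := by
      rw [← add_assoc, Nat.add_sub_cancel]
      ring
    rw [e, pow_add, (Nat.even_mul_succ_self n).neg_one_pow, mul_one]

/-- An alternating function of families picks up `(-1) ^ (m n)` when two blocks are swapped. -/
theorem append_swap_of_alternating {W : Type*} (F : ∀ n : ℕ, (Fin n → W) → ℂ)
    (hF : ∀ n (w : Fin n → W) (σ : Equiv.Perm (Fin n)),
      F n (w ∘ σ) = ((Equiv.Perm.sign σ : ℤ) : ℂ) * F n w)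
    {m n : ℕ} (v : Fin m → W) (w : Fin n → W) :
    F (m + n) (Fin.append v w) = (-1) ^ (m * n) * F (n + m) (Fin.append w v) := by
  have hcast : ∀ a b (h : a = b) (x : Fin a → W), F a x = F b (x ∘ Fin.cast h.symm) := by
    rintro a _ rfl x
    rfl
  let σ : Equiv.Perm (Fin (m + n)) :=
    (finAddFlip (m := m) (n := n)).trans (finCongr (add_comm n m))
  have hv : Fin.append v w = (Fin.append w v ∘ Fin.cast (add_comm n m).symm) ∘ σ := by
    ext1 i
    refine Fin.addCases (fun i => ?_) (fun j => ?_) i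
    · simp [σ]
    · simp [σ]
  rw [hcast _ _ (add_comm n m) (Fin.append w v), hv, hF, sign_block_swap]
  simp

/-! ### Gram Pfaffians bordered by linear functionals -/

section BigPf

variable {V : Type*} [AddCommGroup V] [Module ℂ V] (A : V →ₗ[ℂ] V →ₗ[ℂ] ℂ) (b : V →ₗ[ℂ] ℂ)
  {l : ℕ} (E : V →ₗ[ℂ] Fin l → ℂ)

/-- The Gram matrix of a family of vectors, bordered by `p` copies of `b` and by the functionals
`E`. -/
noncomputable def bigGram (p : ℕ) {d : ℕ} (w : Fin d → V) :
    Matrix ((Fin p ⊕ Fin d) ⊕ Fin l) ((Fin p ⊕ Fin d) ⊕ Fin l) ℂ :=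
  Matrix.fromBlocks (extGram (fun P Q => A P Q) (fun P => b P) p w)
    (Matrix.fromRows 0 (Matrix.of fun i c => E (w i) c))
    (Matrix.fromCols 0 (Matrix.of fun c i => -E (w i) c)) 0

/-- The Pfaffian of `bigGram`. -/
noncomputable def bigPf (p : ℕ) {d : ℕ} (w : Fin d → V) : ℂ :=
  pfOn (sumEnum (sumEnum (Equiv.refl (Fin p)) (Equiv.refl (Fin d))) (Equiv.refl (Fin l)))
    (bigGram A b E p w)

variable {A}

theorem bigGram_transpose (hA : ∀ P Q, A P Q = -A Q P) (p : ℕ) {d : ℕ} (w : Fin d → V) :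
    (bigGram A b E p w).transpose = -bigGram A b E p w := by
  rw [bigGram, Matrix.fromBlocks_transpose, extGram_transpose hA, Matrix.fromBlocks_neg]
  congr 1
  · ext (i | i) j <;> simp
  · ext i (j | j) <;> simp
  · simp

theorem bigPf_linear_comb (hA : ∀ P Q, A P Q = -A Q P) (p : ℕ) {d : ℕ}
    (T : Matrix (Fin d) (Fin d) ℂ) (w : Fin d → V) :
    bigPf A b E p (fun i => ∑ j, T i j • w j) = T.det * bigPf A b E p w := by
  let B : Matrix ((Fin p ⊕ Fin d) ⊕ Fin l) ((Fin p ⊕ Fin d) ⊕ Fin l) ℂ :=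
    Matrix.fromBlocks (Matrix.fromBlocks 1 0 0 T) 0 0 1
  have h : bigGram A b E p (fun i => ∑ j, T i j • w j) =
      B * bigGram A b E p w * B.transpose := by
    rw [bigGram, bigGram, extGram_linear_comb]
    simp only [B, Matrix.fromBlocks_transpose, Matrix.fromBlocks_multiply]
    congr 1
    · simp
    · ext (i | i) c <;> simp [Matrix.mul_apply]
    · ext c (i | i) <;> simp [Matrix.mul_apply, mul_comm]
    · simp
  rw [bigPf, h, pfOn_mul_mul_transpose_self _ _ _ (bigGram_transpose b E hA p w), bigPf]
  simp [B, Matrix.det_fromBlocks_zero₂₁]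

theorem bigPf_comp_perm (hA : ∀ P Q, A P Q = -A Q P) (p : ℕ) {d : ℕ} (w : Fin d → V)
    (σ : Equiv.Perm (Fin d)) :
    bigPf A b E p (w ∘ σ) = ((Equiv.Perm.sign σ : ℤ) : ℂ) * bigPf A b E p w := by
  have h := bigPf_linear_comb b E hA p (Equiv.Perm.permMatrix ℂ σ) w
  rw [Matrix.det_permutation] at h
  rw [← h]
  congr 1
  ext1 i
  simp [Equiv.Perm.permMatrix, PEquiv.toMatrix_apply]

theorem bigPf_append_swap (hA : ∀ P Q, A P Q = -A Q P) (p : ℕ) {m n : ℕ} (v : Fin m → V)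
    (w : Fin n → V) :
    bigPf A b E p (Fin.append v w) = (-1) ^ (m * n) * bigPf A b E p (Fin.append w v) :=
  append_swap_of_alternating (fun _ w => bigPf A b E p w)
    (fun _ w σ => bigPf_comp_perm b E hA p w σ) v w

variable (A)

/-- The off-diagonal block of `bigGram` for a family that is split into two parts. -/
noncomputable def crossGram (p : ℕ) {m n : ℕ} (v : Fin m → V) (w : Fin n → V) :
    Matrix (Fin p ⊕ Fin m) (Fin n ⊕ Fin l) ℂ :=
  Matrix.fromBlocks (Matrix.of fun _ a => b (w a)) 0 (Matrix.of fun i a => A (v i) (w a))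
    (Matrix.of fun i c => E (v i) c)

/-- The lower diagonal block of `bigGram` for a family that is split into two parts. -/
noncomputable def tailGram {n : ℕ} (w : Fin n → V) : Matrix (Fin n ⊕ Fin l) (Fin n ⊕ Fin l) ℂ :=
  Matrix.fromBlocks (Matrix.of fun i j => A (w i) (w j)) (Matrix.of fun i c => E (w i) c)
    (Matrix.of fun c i => -E (w i) c) 0

variable {A}

/-- The border of `b` is grouped with the first part of the family and the functionals with the
second. The order of the indices is unchanged, so no sign arises. -/
theorem bigPf_append (hA : ∀ P Q, A P Q = -A Q P) (p : ℕ) {m n : ℕ} (v : Fin m → V)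
    (w : Fin n → V) :
    bigPf A b E p (Fin.append v w) =
      pfOn (sumEnum (sumEnum (Equiv.refl (Fin p)) (Equiv.refl (Fin m)))
        (sumEnum (Equiv.refl (Fin n)) (Equiv.refl (Fin l))))
      (Matrix.fromBlocks (extGram (fun P Q => A P Q) (fun P => b P) p v) (crossGram A b E p v w)
        (-(crossGram A b E p v w).transpose) (tailGram A E w)) := by
  let σ : (Fin p ⊕ Fin m) ⊕ (Fin n ⊕ Fin l) ≃ (Fin p ⊕ Fin (m + n)) ⊕ Fin l :=
    (Equiv.sumAssoc _ _ _).symm.trans (((Equiv.sumAssoc _ _ _).trans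
      ((Equiv.refl _).sumCongr finSumFinEquiv)).sumCongr (Equiv.refl _))
  rw [bigPf, pfOn_congr _ (sumEnum (sumEnum (Equiv.refl (Fin p)) (Equiv.refl (Fin m)))
        (sumEnum (Equiv.refl (Fin n)) (Equiv.refl (Fin l)))) σ]
  · congr 1
    ext ((i | i) | (i | i)) ((j | j) | (j | j)) <;>
      simp [σ, bigGram, extGram, crossGram, tailGram]
    exact hA _ _
  · rintro ((i | i) | (i | i)) <;> simp [σ, add_assoc]

theorem tailGram_transpose (hA : ∀ P Q, A P Q = -A Q P) {n : ℕ} (w : Fin n → V) :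
    (tailGram A E w).transpose = -tailGram A E w := by
  ext (i | i) (j | j) <;> simp [tailGram]
  exact hA _ _

/-- Elimination of the first part of the family. Its Gram matrix is invertible because its
determinant is the square of the nonzero Pfaffian; `p` makes the bordered size even. -/
theorem bigPf_append_schur (hA : ∀ P Q, A P Q = -A Q P) {p m : ℕ} (hp : p ≤ 1)
    (hpm : Even (p + m)) {n : ℕ} (v : Fin m → V) (w : Fin n → V)
    (h0 : extPf (fun P Q => A P Q) (fun P => b P) v ≠ 0) :
    bigPf A b E p (Fin.append v w) = extPf (fun P Q => A P Q) (fun P => b P) v *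
      pfOn (sumEnum (Equiv.refl (Fin n)) (Equiv.refl (Fin l)))
        (tailGram A E w + (crossGram A b E p v w).transpose *
          (extGram (fun P Q => A P Q) (fun P => b P) p v)⁻¹ * crossGram A b E p v w) := by
  have hT := extGram_transpose hA (fun P => b P) p v
  rw [extPf_eq_pfOn _ _ hp hpm] at h0 ⊢
  rw [bigPf_append b E hA, pfOn_schur _ _ hpm _ _ _ hT (tailGram_transpose E hA w)]
  intro hdet
  refine h0 (pow_eq_zero_iff two_ne_zero |>.mp ?_)
  rw [pfOn, pfaffian_sq hpm, Matrix.det_submatrix_equiv_self, hdet]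
  rw [Matrix.transpose_submatrix, hT]
  rfl

/-- If the first part lies in the kernel of `E`, then the functionals pair only with the `l`
remaining vectors, and `pfOn_constraint` discards all pairings of those vectors under `A` and `b`.
-/
theorem bigPf_append_constraint (hA : ∀ P Q, A P Q = -A Q P) {p m : ℕ} (hp : p ≤ 1)
    (hpm : Even (p + m)) (v : Fin m → V) (w : Fin l → V) (hE : ∀ i, E (v i) = 0) :
    bigPf A b E p (Fin.append v w) = extPf (fun P Q => A P Q) (fun P => b P) v *
      ((-1) ^ (l * (l - 1) / 2) * (Matrix.of fun i c => E (w i) c).det) := by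
  rw [bigPf_append b E hA, extPf_eq_pfOn _ _ hp hpm,
    ← pfOn_constraint _ hpm _ (extGram_transpose hA _ p v) (Matrix.of fun u a =>
      crossGram A b E p v w u (Sum.inl a)) (Matrix.of fun i j => A (w i) (w j))
      (Matrix.of fun i c => E (w i) c)]
  · congr 1
    ext ((i | i) | (i | i)) ((j | j) | (j | j)) <;> simp [crossGram, tailGram, hE]
  · ext i j
    exact hA _ _

end BigPf

section

open Polynomial

/-! ### Monomial coordinates -/

section Coordinates

variable {A : ℂ[X] →ₗ[ℂ] ℂ[X] →ₗ[ℂ] ℂ} (b : ℂ[X] →ₗ[ℂ] ℂ) {l : ℕ} (E : ℂ[X] →ₗ[ℂ] Fin l → ℂ)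

theorem bigPf_monic (hA : ∀ P Q, A P Q = -A Q P) (p : ℕ) {d : ℕ} (w : Fin d → ℂ[X])
    (hd : ∀ i, (w i).natDegree = i) (hm : ∀ i, (w i).Monic) :
    bigPf A b E p w = bigPf A b E p fun i : Fin d => X ^ (i : ℕ) := by
  have h := mul_eq_sum_coeff 1 w hd
  simp only [one_mul] at h
  change w = _ at h
  conv_lhs => rw [h]
  rw [bigPf_linear_comb b E hA, det_coeff_monic w hd hm, one_mul]

theorem append_pow_natDegree {m n : ℕ} {ℓ : ℂ[X]} (hℓ : ℓ.Monic) (hd : ℓ.natDegree = m)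
    (i : Fin (m + n)) :
    (Fin.append (fun j : Fin m => X ^ (j : ℕ)) (fun j : Fin n => ℓ * X ^ (j : ℕ)) i).natDegree =
      i := by
  refine Fin.addCases (fun i => ?_) (fun i => ?_) i
  · simp
  · rw [Fin.append_right, hℓ.natDegree_mul (monic_X_pow _), hd]
    simp

theorem append_pow_monic {m n : ℕ} {ℓ : ℂ[X]} (hℓ : ℓ.Monic) (i : Fin (m + n)) :
    (Fin.append (fun j : Fin m => X ^ (j : ℕ)) (fun j : Fin n => ℓ * X ^ (j : ℕ)) i).Monic := by
  refine Fin.addCases (fun i => ?_) (fun i => ?_) i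
  · simp
  · rw [Fin.append_right]
    exact hℓ.mul (monic_X_pow _)

/-- Placing the `X ^ j` before the multiples of `ℓ` gives monic polynomials of consecutive degrees;
the reverse order costs the sign of the block swap. -/
theorem bigPf_append_pow (hA : ∀ P Q, A P Q = -A Q P) (p : ℕ) {m n : ℕ} {ℓ : ℂ[X]} (hℓ : ℓ.Monic)
    (hd : ℓ.natDegree = m) :
    bigPf A b E p (Fin.append (fun j : Fin n => ℓ * X ^ (j : ℕ)) (fun j : Fin m => X ^ (j : ℕ))) =
      (-1) ^ (n * m) * bigPf A b E p fun i : Fin (m + n) => X ^ (i : ℕ) := by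
  rw [bigPf_append_swap b E hA, bigPf_monic b E hA p _ (append_pow_natDegree hℓ hd)
    (append_pow_monic hℓ)]

/-- For the additional constraint at infinity one more vector is needed, the top monomial `X ^ (m +
n)`. It stays last while the other two blocks are swapped. -/
theorem bigPf_append_snoc_pow (hA : ∀ P Q, A P Q = -A Q P) (p : ℕ) {m n : ℕ} {ℓ : ℂ[X]}
    (hℓ : ℓ.Monic) (hd : ℓ.natDegree = m) :
    bigPf A b E p (Fin.append (fun j : Fin n => ℓ * X ^ (j : ℕ))
      (Fin.snoc (fun j : Fin m => X ^ (j : ℕ)) (X ^ (m + n)) : Fin (m + 1) → ℂ[X])) =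
      (-1) ^ (n * m) * bigPf A b E p fun i : Fin (m + n + 1) => X ^ (i : ℕ) := by
  have hsn : ∀ d (w : Fin d → ℂ[X]) (σ : Equiv.Perm (Fin d)),
      bigPf A b E p (Fin.snoc (w ∘ σ) (X ^ (m + n)) : Fin (d + 1) → ℂ[X]) =
        ((Equiv.Perm.sign σ : ℤ) : ℂ) *
          bigPf A b E p (Fin.snoc w (X ^ (m + n)) : Fin (d + 1) → ℂ[X]) := by
    intro d w σ
    have hc : (Fin.snoc (w ∘ σ) (X ^ (m + n)) : Fin (d + 1) → ℂ[X]) =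
        (Fin.snoc w (X ^ (m + n)) : Fin (d + 1) → ℂ[X]) ∘
          finSumFinEquiv.permCongr (Equiv.sumCongr σ (Equiv.refl (Fin 1))) := by
      ext1 i
      refine Fin.addCases (m := d) (n := 1) (fun i => ?_) (fun i => ?_) i
      · have e : finSumFinEquiv.symm (Fin.castAdd 1 i) = Sum.inl i := by simp
        simp only [Function.comp_apply, Equiv.permCongr_apply, e, Equiv.sumCongr_apply, Sum.map_inl,
          finSumFinEquiv_apply_left]
        exact (Fin.snoc_castSucc (α := fun _ => ℂ[X]) _ _ i).trans
          (Fin.snoc_castSucc (α := fun _ => ℂ[X]) _ _ (σ i)).symm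
      · have e : finSumFinEquiv.symm (Fin.natAdd d i) = Sum.inr i := by simp
        simp only [Function.comp_apply, Equiv.permCongr_apply, e, Equiv.sumCongr_apply, Sum.map_inr,
          finSumFinEquiv_apply_right, Equiv.refl_apply]
        obtain rfl : i = 0 := Subsingleton.elim _ _
        exact (Fin.snoc_last (α := fun _ => ℂ[X]) _ _).trans
          (Fin.snoc_last (α := fun _ => ℂ[X]) _ _).symm
    rw [hc, bigPf_comp_perm b E hA, Equiv.Perm.sign_permCongr]
    simp [Equiv.Perm.sign_sumCongr]
  rw [Fin.append_snoc]
  have h := append_swap_of_alternating (fun d w => bigPf A b E p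
    (Fin.snoc w (X ^ (m + n)) : Fin (d + 1) → ℂ[X])) hsn (fun j : Fin n => ℓ * X ^ (j : ℕ))
    (fun j : Fin m => X ^ (j : ℕ))
  refine h.trans ?_
  congr 1
  refine bigPf_monic b E hA p _ (fun i => ?_) (fun i => ?_)
  · refine Fin.lastCases ?_ (fun i => ?_) i
    · simp
    · rw [Fin.snoc_castSucc]
      exact append_pow_natDegree hℓ hd i
  · refine Fin.lastCases ?_ (fun i => ?_) i
    · simp
    · rw [Fin.snoc_castSucc]
      exact append_pow_monic hℓ i

/-- The `φ i` are combinations of `X ^ j` with `j < m`, so their coefficient matrix is the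
nontrivial block of the base change; it is meant for the polynomials `coRootPoly`. -/
theorem bigPf_append_of_natDegree_lt (hA : ∀ P Q, A P Q = -A Q P) (p : ℕ) {m n : ℕ} {ℓ : ℂ[X]}
    (hℓ : ℓ.Monic) (hd : ℓ.natDegree = m) (φ : Fin m → ℂ[X]) (hφ : ∀ i, (φ i).natDegree < m) :
    bigPf A b E p (Fin.append (fun j : Fin n => ℓ * X ^ (j : ℕ)) φ) =
      (-1) ^ (n * m) * ((Matrix.of fun i j : Fin m => (φ i).coeff j).det *
        bigPf A b E p fun i : Fin (m + n) => X ^ (i : ℕ)) := by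
  rw [bigPf_append_swap b E hA]
  congr 1
  let T : Matrix (Fin m ⊕ Fin n) (Fin m ⊕ Fin n) ℂ :=
    Matrix.fromBlocks (Matrix.of fun i j : Fin m => (φ i).coeff j) 0 0 1
  have h : Fin.append φ (fun j : Fin n => ℓ * X ^ (j : ℕ)) = fun i =>
      ∑ j, Matrix.reindex finSumFinEquiv finSumFinEquiv T i j •
        Fin.append (fun j : Fin m => X ^ (j : ℕ)) (fun j : Fin n => ℓ * X ^ (j : ℕ)) j := by
    ext1 i
    rw [← Equiv.sum_comp finSumFinEquiv, Fintype.sum_sum_type]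
    refine Fin.addCases (fun i => ?_) (fun i => ?_) i
    · simp only [Fin.append_left, T, Matrix.reindex_apply, Matrix.submatrix_apply,
        finSumFinEquiv_symm_apply_castAdd, Equiv.symm_apply_apply, Matrix.fromBlocks_apply₁₁,
        Matrix.of_apply, finSumFinEquiv_apply_left, Matrix.fromBlocks_apply₁₂, Matrix.zero_apply,
        zero_smul, Finset.sum_const_zero, add_zero]
      conv_lhs => rw [(φ i).as_sum_range' m (hφ i), Finset.sum_range]
      exact Finset.sum_congr rfl fun j _ => by rw [← C_mul_X_pow_eq_monomial, smul_eq_C_mul]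
    · simp [T, Matrix.one_apply]
  rw [h, bigPf_linear_comb b E hA, Matrix.det_reindex_self, bigPf_monic b E hA p _
    (append_pow_natDegree hℓ hd) (append_pow_monic hℓ), Matrix.det_fromBlocks_zero₁₂,
    Matrix.det_one, mul_one]

end Coordinates

/-! ### The polynomials attached to the poles -/

section Poles

variable {k : ℕ} (kap : Fin k → ℂ)

/-- The polynomial with the given roots. -/
noncomputable def rootPoly : ℂ[X] := ∏ a, (X - C (kap a))

/-- The polynomial with all but one of the given roots. -/
noncomputable def coRootPoly (a : Fin k) : ℂ[X] := ∏ c ∈ {a}ᶜ, (X - C (kap c))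

theorem rootPoly_monic : (rootPoly kap).Monic := monic_prod_X_sub_C _ _

theorem rootPoly_natDegree : (rootPoly kap).natDegree = k := by
  simp [rootPoly, natDegree_prod_of_monic _ _ fun i _ => monic_X_sub_C (kap i)]

theorem coRootPoly_monic (a : Fin k) : (coRootPoly kap a).Monic := monic_prod_X_sub_C _ _

theorem coRootPoly_natDegree (a : Fin k) : (coRootPoly kap a).natDegree = k - 1 := by
  rw [coRootPoly, natDegree_prod_of_monic _ _ fun c _ => monic_X_sub_C (kap c)]
  simp [Finset.card_compl]

theorem rootPoly_eq_mul (a : Fin k) : rootPoly kap = (X - C (kap a)) * coRootPoly kap a := by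
  rw [rootPoly, coRootPoly, Fintype.prod_eq_mul_prod_compl a]

theorem rootPoly_eval (z : ℂ) : (rootPoly kap).eval z = ∏ a, (z - kap a) := by
  simp [rootPoly, eval_prod]

theorem card_pairs (n : ℕ) : ∑ i : Fin n, (Finset.Ioi i).card = n * (n - 1) / 2 := by
  simp only [Fin.card_Ioi]
  rw [Fin.sum_univ_eq_sum_range fun i => n - 1 - i, Finset.sum_range_reflect fun i => i,
    Finset.sum_range_id]

variable {kap}

theorem vand_ne_zero (h : Function.Injective kap) : vand kap ≠ 0 :=
  Finset.prod_ne_zero_iff.mpr fun _ _ => Finset.prod_ne_zero_iff.mpr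
    fun _ hj => sub_ne_zero.mpr (h.ne (Finset.mem_Ioi.mp hj).ne')

/-- Lagrange interpolation: `coRootPoly i` vanishes at every `kap j` with `j ≠ i`, so coefficient
matrix times Vandermonde matrix is diagonal. The diagonal entries multiply to the squared
Vandermonde product, with one sign per pair. -/
theorem det_coRootPoly (h : Function.Injective kap) :
    (Matrix.of fun i j : Fin k => (coRootPoly kap i).coeff j).det =
      (-1) ^ (k * (k - 1) / 2) * vand kap := by
  have hmul : (Matrix.of fun i j : Fin k => (coRootPoly kap i).coeff j) *
      (Matrix.of fun i j : Fin k => kap j ^ (i : ℕ)) =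
      Matrix.diagonal fun i => ∏ c ∈ {i}ᶜ, (kap i - kap c) := by
    ext i j
    have he : (coRootPoly kap i).eval (kap j) =
        ∑ a : Fin k, (coRootPoly kap i).coeff a * kap j ^ (a : ℕ) := by
      rw [eval_eq_sum_range' (n := k) (by rw [coRootPoly_natDegree]; have := i.2; omega),
        Finset.sum_range]
    simp only [Matrix.mul_apply, Matrix.of_apply]
    rw [← he, coRootPoly, eval_prod]
    simp only [eval_sub, eval_X, eval_C]
    by_cases hij : i = j
    · subst hij
      simp
    · rw [Matrix.diagonal_apply_ne _ hij]
      exact Finset.prod_eq_zero (i := j) (by simpa using Ne.symm hij) (sub_self _)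
  have hdet := congrArg Matrix.det hmul
  rw [Matrix.det_mul, det_pow_eq_vand, Matrix.det_diagonal] at hdet
  have hoff := Finset.prod_prod_Ioi_mul_eq_prod_prod_off_diag fun i j : Fin k => kap j - kap i
  rw [← hoff] at hdet
  refine mul_right_cancel₀ (vand_ne_zero h) (hdet.trans ?_)
  have e : ∀ i j : Fin k, (kap i - kap j) * (kap j - kap i) =
      -1 * ((kap j - kap i) * (kap j - kap i)) := by
    intro i j
    ring
  simp only [e, Finset.prod_mul_distrib, Finset.prod_const]
  rw [Finset.prod_pow_eq_pow_sum, card_pairs, vand]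
  ring

end Poles

end

section

open Polynomial

theorem kerForm_congr_ae (k : ℝ → ℝ → ℂ) {F F' G G' : ℝ → ℂ} (hF : F =ᵐ[posLeb] F')
    (hG : G =ᵐ[posLeb] G') : kerForm k F G = kerForm k F' G' := by
  refine integral_congr_ae ?_
  filter_upwards [hF] with x hx
  refine integral_congr_ae ?_
  filter_upwards [hG] with y hy
  simp only [hx, hy]

theorem bForm_congr_ae {F F' : ℝ → ℂ} (hF : F =ᵐ[posLeb] F') : bForm F = bForm F' :=
  integral_congr_ae hF

theorem ae_posLeb_of_pos {P : ℝ → Prop} (h : ∀ z : ℝ, 0 < z → P z) : ∀ᵐ z ∂posLeb, P z := by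
  filter_upwards [ae_restrict_mem measurableSet_Ioi] with z hz
  exact h z hz

/-! ### The kernels at a pair of points -/

/-- An argument of a characteristic polynomial: in the denominator, in the numerator, or the point
at infinity, which evens out the number of arguments. -/
inductive CharPoint : Type
  | pole (κ : ℂ) : CharPoint
  | root (lam : ℂ) : CharPoint
  | infinity : CharPoint

/-- The bordered Gram matrix of the monomials. -/
noncomputable def momentGram (α : ℝ → ℂ) (M : ℕ) :
    Matrix (Fin (M % 2) ⊕ Fin M) (Fin (M % 2) ⊕ Fin M) ℂ :=
  extGram aForm bForm (M % 2) fun (i : Fin M) (z : ℝ) => α z * (z : ℂ) ^ (i : ℕ)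

/-- The pairing of a point with the monomials. -/
noncomputable def pointCol (α : ℝ → ℂ) (M : ℕ) : CharPoint → Fin (M % 2) ⊕ Fin M → ℂ
  | .pole κ, .inl _ => bForm fun z => α z / ((z : ℂ) - κ)
  | .pole κ, .inr i => aForm (fun z => α z * (z : ℂ) ^ (i : ℕ)) fun z => α z / ((z : ℂ) - κ)
  | .root _, .inl _ => 0
  | .root lam, .inr i => lam ^ (i : ℕ)
  | .infinity, .inl _ => 0
  -- Infinity reads off the top coefficient. The sign `(-1) ^ M` cancels the one left over from the
  -- block swaps for an odd number of points.
  | .infinity, .inr i => if (i : ℕ) + 1 = M then (-1) ^ M else 0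

/-- The direct pairing of two points. -/
noncomputable def pointPair (α : ℝ → ℂ) (M : ℕ) : CharPoint → CharPoint → ℂ
  | .pole κ, .pole κ' => aForm (fun z => α z / ((z : ℂ) - κ)) fun z => α z / ((z : ℂ) - κ')
  | .pole κ, .root lam => (lam - κ)⁻¹
  | .root lam, .pole κ => -(lam - κ)⁻¹
  -- The coefficient read at infinity exceeds the degree of the polynomial attached to a pole,
  -- except for `M = 0`, where it is the leading one.
  | .pole _, .infinity => if M = 0 then 1 else 0
  | .infinity, .pole _ => -if M = 0 then 1 else 0
  | _, _ => 0

/-- The Schur complement of the moment matrix, for two points. -/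
noncomputable def pointKernel (α : ℝ → ℂ) (M : ℕ) (x y : CharPoint) : ℂ :=
  pointPair α M x y +
    ∑ v, (∑ u, pointCol α M x u * (momentGram α M)⁻¹ u v) * pointCol α M y v

theorem momentGram_inv_antisymm {α : ℝ → ℂ} (hα : HasAllMoments α) (M : ℕ)
    (u v : Fin (M % 2) ⊕ Fin M) : (momentGram α M)⁻¹ u v = -(momentGram α M)⁻¹ v u := by
  have hG : (momentGram α M).transpose = -momentGram α M := by
    have : ∀ i : Fin M, Integrable (fun z : ℝ => α z * (z : ℂ) ^ (i : ℕ)) posLeb := fun i =>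
      (hα i).congr (Filter.Eventually.of_forall fun z => mul_comm _ _)
    ext (i | i) (j | j) <;> simp [momentGram, extGram]
    exact aForm_antisymm (this _) (this _)
  have h : ((momentGram α M)⁻¹).transpose = -(momentGram α M)⁻¹ := by
    by_cases hd : IsUnit (momentGram α M).det
    · rw [Matrix.transpose_nonsing_inv, hG]
      refine Matrix.inv_eq_left_inv ?_
      rw [neg_mul_neg, Matrix.nonsing_inv_mul _ hd]
    · simp [Matrix.nonsing_inv_apply_not_isUnit _ hd]
  exact congrFun (congrFun h v) u

theorem pointKernel_antisymm {α : ℝ → ℂ} (hα : HasAllMoments α) (M : ℕ) (x y : CharPoint)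
    (hx : ∀ κ, x = .pole κ → ∀ t : ℝ, 0 ≤ t → κ ≠ t)
    (hy : ∀ κ, y = .pole κ → ∀ t : ℝ, 0 ≤ t → κ ≠ t) :
    pointKernel α M x y = -pointKernel α M y x := by
  have hp : pointPair α M x y = -pointPair α M y x := by
    rcases x with κ | lam | _ <;> rcases y with κ' | lam' | _ <;> simp [pointPair]
    have i1 := (hα.div_sub (hx κ rfl)) 0
    have i2 := (hα.div_sub (hy κ' rfl)) 0
    simp only [pow_zero, one_mul] at i1 i2
    exact aForm_antisymm i1 i2
  rw [pointKernel, pointKernel, hp, neg_add]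
  congr 1
  simp only [Finset.sum_mul, ← Finset.sum_neg_distrib]
  rw [Finset.sum_comm]
  refine Finset.sum_congr rfl fun u _ => Finset.sum_congr rfl fun v _ => ?_
  rw [momentGram_inv_antisymm hα]
  ring

/-- The matrix of the point kernel. -/
noncomputable def pointMatrix (α : ℝ → ℂ) (M : ℕ) {ι : Type*} (pt : ι → CharPoint) :
    Matrix ι ι ℂ :=
  Matrix.of fun i j => pointKernel α M (pt i) (pt j)

theorem pointMatrix_eq (α : ℝ → ℂ) (M : ℕ) {ι : Type*} (pt : ι → CharPoint)
    {S : Matrix ι ι ℂ} {P : Matrix (Fin (M % 2) ⊕ Fin M) (Fin (M % 2) ⊕ Fin M) ℂ}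
    {Q : Matrix (Fin (M % 2) ⊕ Fin M) ι ℂ} (hP : P = momentGram α M)
    (hQ : ∀ u i, Q u i = pointCol α M (pt i) u)
    (hS : ∀ i j, S i j = pointPair α M (pt i) (pt j)) :
    S + Q.transpose * P⁻¹ * Q = pointMatrix α M pt := by
  subst hP
  ext i j
  simp only [Matrix.add_apply, Matrix.mul_apply, Matrix.transpose_apply, pointMatrix,
    Matrix.of_apply, pointKernel, hQ, hS]

/-! ### Poles as polynomials for the weight divided by all pole factors -/

section PoleWeight

variable {α : ℝ → ℂ} (hα : HasAllMoments α) {k : ℕ} {kap : Fin k → ℂ}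
  (hκ : ∀ i, ∀ t : ℝ, 0 ≤ t → kap i ≠ t)
include hκ

theorem rootPoly_eval_ne_zero {z : ℝ} (hz : 0 < z) : (rootPoly kap).eval (z : ℂ) ≠ 0 := by
  rw [rootPoly_eval]
  exact Finset.prod_ne_zero_iff.mpr fun a _ => sub_ne_zero.mpr (hκ a z hz.le).symm

/-- For the weight `α / ∏ (z - κ_i)`, multiples of `rootPoly kap` stand for `α` times a polynomial,
and `coRootPoly kap a` stands for `α / (z - κ_a)`. So moments and poles live in one polynomial
space. -/
theorem polyFun_rootPoly_mul (P : ℂ[X]) {z : ℝ} (hz : 0 < z) :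
    polyFun (fun z => α z / ∏ i, ((z : ℂ) - kap i)) (rootPoly kap * P) z =
      α z * P.eval (z : ℂ) := by
  have h := rootPoly_eval_ne_zero hκ hz
  rw [polyFun, eval_mul]
  rw [rootPoly_eval] at h ⊢
  field_simp

theorem polyFun_coRootPoly (a : Fin k) {z : ℝ} (hz : 0 < z) :
    polyFun (fun z => α z / ∏ i, ((z : ℂ) - kap i)) (coRootPoly kap a) z =
      α z / ((z : ℂ) - kap a) := by
  have h := rootPoly_eval_ne_zero hκ hz
  have e := rootPoly_eval kap (z : ℂ)
  rw [polyFun, ← e]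
  rw [rootPoly_eq_mul kap a, eval_mul] at h ⊢
  have h1 := left_ne_zero_of_mul h
  have h2 := right_ne_zero_of_mul h
  simp only [eval_sub, eval_X, eval_C] at h1 ⊢
  field_simp

theorem extGram_rootPoly (M : ℕ) :
    extGram (fun P Q => aLin (hα.div_prod hκ) P Q) (fun P => bLin (hα.div_prod hκ) P) (M % 2)
      (fun i : Fin M => rootPoly kap * X ^ (i : ℕ)) = momentGram α M := by
  have h : ∀ i : Fin M, polyFun (fun z => α z / ∏ i, ((z : ℂ) - kap i))
      (rootPoly kap * X ^ (i : ℕ)) =ᵐ[posLeb] fun z : ℝ => α z * (z : ℂ) ^ (i : ℕ) := fun i =>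
    ae_posLeb_of_pos fun z hz => by rw [polyFun_rootPoly_mul hκ _ hz]; simp
  ext (i | i) (j | j)
  · simp [momentGram, extGram]
  · exact bForm_congr_ae (h j)
  · exact congrArg Neg.neg (bForm_congr_ae (h i))
  · exact kerForm_congr_ae _ (h i) (h j)

theorem extPf_rootPoly (M : ℕ) :
    extPf (fun P Q => aLin (hα.div_prod hκ) P Q) (fun P => bLin (hα.div_prod hκ) P)
      (fun i : Fin M => rootPoly kap * X ^ (i : ℕ)) = ZB₀ α M := by
  rw [ZB₀, ZB_eq_buresPf α (hα.div_prod hκ) ![] ![]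
    fun i : Fin M => rootPoly kap * X ^ (i : ℕ)]
  · rfl
  · intro i z hz
    refine Eq.trans ?_ (polyFun_rootPoly_mul hκ _ hz).symm
    simp [charRatio]

theorem extPf_rootPoly_lam (N : ℕ) {l : ℕ} (lam : Fin l → ℂ) :
    extPf (fun P Q => aLin (hα.div_prod hκ) P Q) (fun P => bLin (hα.div_prod hκ) P)
      (fun i : Fin N => rootPoly lam * X ^ (i : ℕ)) = ZB α N kap lam := by
  rw [ZB_eq_buresPf α (hα.div_prod hκ) kap lam fun i : Fin N => rootPoly lam * X ^ (i : ℕ)]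
  · rfl
  · intro i z hz
    rw [eval_mul, rootPoly_eval, charRatio]
    simp only [eval_pow, eval_X]
    ring

/-- The bordered Gram matrix has the point kernel as Schur complement. -/
theorem bigPf_rootPoly_schur {M l : ℕ} (hZ : ZB₀ α M ≠ 0) (E : ℂ[X] →ₗ[ℂ] Fin l → ℂ)
    (pt : Fin l → CharPoint)
    (hEpair : ∀ a c, E (coRootPoly kap a) c = pointPair α M (.pole (kap a)) (pt c))
    (hEpair' : ∀ a c, -E (coRootPoly kap a) c = pointPair α M (pt c) (.pole (kap a)))
    (hpair : ∀ c c', pointPair α M (pt c) (pt c') = 0)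
    (hEcol : ∀ (i : Fin M) c, E (rootPoly kap * X ^ (i : ℕ)) c = pointCol α M (pt c) (.inr i))
    (hcol : ∀ u c, pointCol α M (pt c) (.inl u) = 0) :
    bigPf (aLin (hα.div_prod hκ)) (bLin (hα.div_prod hκ)) E (M % 2)
      (Fin.append (fun i : Fin M => rootPoly kap * X ^ (i : ℕ)) (coRootPoly kap)) =
      ZB₀ α M * pfOn (sumEnum (Equiv.refl (Fin k)) (Equiv.refl (Fin l)))
        (pointMatrix α M (Sum.elim (fun a => .pole (kap a)) pt)) := by
  have hp : Even (M % 2 + M) := by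
    rw [Nat.even_add, Nat.even_iff, Nat.even_iff, Nat.mod_mod]
  have h1 : ∀ i : Fin M, polyFun (fun z => α z / ∏ i, ((z : ℂ) - kap i))
      (rootPoly kap * X ^ (i : ℕ)) =ᵐ[posLeb] fun z : ℝ => α z * (z : ℂ) ^ (i : ℕ) := fun i =>
    ae_posLeb_of_pos fun z hz => by rw [polyFun_rootPoly_mul hκ _ hz]; simp
  have h2 : ∀ a : Fin k, polyFun (fun z => α z / ∏ i, ((z : ℂ) - kap i)) (coRootPoly kap a)
      =ᵐ[posLeb] fun z : ℝ => α z / ((z : ℂ) - kap a) := fun a =>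
    ae_posLeb_of_pos fun z hz => polyFun_coRootPoly hκ a hz
  have h0 := extPf_rootPoly hα hκ M
  rw [bigPf_append_schur _ E (aLin_antisymm _) (by omega) hp _ _ (by rw [h0]; exact hZ), h0,
    pointMatrix_eq α M (Sum.elim (fun a => .pole (kap a)) pt) (extGram_rootPoly hα hκ M)]
  · rintro (u | u) (a | c)
    · exact bForm_congr_ae (h2 a)
    · exact (hcol u c).symm
    · exact kerForm_congr_ae _ (h1 u) (h2 a)
    · exact hEcol u c
  · rintro (a | c) (a' | c')
    · exact kerForm_congr_ae _ (h2 a) (h2 a')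
    · exact hEpair a c'
    · exact hEpair' a' c
    · exact (hpair c c').symm


end PoleWeight

end

section

open Polynomial

/-! ### One Pfaffian evaluated in two bases -/

section Core

variable {α : ℝ → ℂ} (hα : HasAllMoments α) {k l : ℕ} {kap : Fin k → ℂ} {lam : Fin l → ℂ}

theorem even_mod_two_add {M N : ℕ} (h : Even (M + N)) : Even (M % 2 + N) := by
  rw [Nat.even_iff] at h ⊢
  omega

theorem prod_rootPoly_eval : ∏ b, (rootPoly kap).eval (lam b) =
    (-1) ^ (k * l) * ∏ a, ∏ b, (kap a - lam b) := by
  simp only [rootPoly_eval]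
  rw [Finset.prod_comm]
  have e : ∀ a b, lam b - kap a = -1 * (kap a - lam b) := by
    intro a b
    ring
  simp only [e, Finset.prod_mul_distrib, Finset.prod_const]
  simp [← pow_mul, mul_comm]

/-- Normalized evaluation at the points `lam`. -/
noncomputable def evalAt (kap : Fin k → ℂ) (lam : Fin l → ℂ) : ℂ[X] →ₗ[ℂ] Fin l → ℂ :=
  LinearMap.pi fun b => ((rootPoly kap).eval (lam b))⁻¹ • leval (lam b)

theorem evalAt_apply (P : ℂ[X]) (b : Fin l) :
    evalAt kap lam P b = ((rootPoly kap).eval (lam b))⁻¹ * P.eval (lam b) := by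
  simp [evalAt]

theorem det_evalAt : (Matrix.of fun i c : Fin l => evalAt kap lam (X ^ (i : ℕ)) c).det =
    (∏ b, (rootPoly kap).eval (lam b))⁻¹ * vand lam := by
  rw [← det_pow_eq_vand, ← Finset.prod_inv_distrib, ← Matrix.det_mul_row]
  congr 1
  ext i c
  simp [evalAt_apply]

theorem eval_rootPoly_ne_zero (h : ∀ i j, kap i ≠ lam j) (b : Fin l) :
    (rootPoly kap).eval (lam b) ≠ 0 := by
  rw [rootPoly_eval]
  exact Finset.prod_ne_zero_iff.mpr fun a _ => sub_ne_zero.mpr (h a b).symm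

/-- The normalization makes `evalAt` see a polynomial as its quotient by `rootPoly kap`, which for
`coRootPoly kap a` is `1 / (z - κ_a)`. -/
theorem evalAt_coRootPoly (h : ∀ i j, kap i ≠ lam j) (a : Fin k) (b : Fin l) :
    evalAt kap lam (coRootPoly kap a) b = (lam b - kap a)⁻¹ := by
  have h0 := eval_rootPoly_ne_zero h b
  rw [evalAt_apply]
  rw [rootPoly_eq_mul kap a, eval_mul] at h0 ⊢
  rw [mul_inv, mul_assoc, inv_mul_cancel₀ (right_ne_zero_of_mul h0)]
  simp

theorem evalAt_rootPoly_mul (h : ∀ i j, kap i ≠ lam j) (P : ℂ[X]) (b : Fin l) :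
    evalAt kap lam (rootPoly kap * P) b = P.eval (lam b) := by
  rw [evalAt_apply, eval_mul, inv_mul_cancel_left₀ (eval_rootPoly_ne_zero h b)]

theorem evalAt_rootPoly_lam_mul (P : ℂ[X]) : evalAt kap lam (rootPoly lam * P) = 0 := by
  ext b
  rw [evalAt_apply, eval_mul, rootPoly_eval lam, Finset.prod_eq_zero (Finset.mem_univ b)
    (sub_self _)]
  simp

include hα in
/-- The Pfaffian of the point kernel for an even number of points. -/
theorem ZB_zero_mul_pfOn_even (h : Admissible kap lam) {M N : ℕ} (hkl : Even (k + l))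
    (hMN : M + k = N + l) (hZ : ZB₀ α M ≠ 0) :
    ZB₀ α M * pfOn (sumEnum (Equiv.refl (Fin k)) (Equiv.refl (Fin l)))
      (pointMatrix α M (Sum.elim (fun a => .pole (kap a)) fun b => .root (lam b))) =
    (-1) ^ (k * (k - 1) / 2 + l * (l - 1) / 2 + k * l) * berB kap lam * ZB α N kap lam := by
  obtain ⟨hκ, hinj, -, hne⟩ := h
  have hβ := hα.div_prod hκ
  have hpN : Even (M % 2 + N) := even_mod_two_add (by rw [Nat.even_iff] at *; omega)
  -- Basis adapted to the poles: `M` multiples of `rootPoly kap`, which are eliminated, and the `k`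
  -- polynomials `coRootPoly`.
  have h1 := bigPf_rootPoly_schur hα hκ hZ (evalAt kap lam) (fun b => .root (lam b))
    (fun a c => evalAt_coRootPoly hne a c)
    (fun a c => congrArg Neg.neg (evalAt_coRootPoly hne a c)) (fun _ _ => rfl)
    (fun i c => by rw [evalAt_rootPoly_mul hne]; simp [pointCol]) (fun _ _ => rfl)
  rw [← h1, bigPf_append_of_natDegree_lt _ _ (aLin_antisymm _) _ (rootPoly_monic kap)
    (rootPoly_natDegree kap) _ (fun i => by rw [coRootPoly_natDegree]; have := i.2; omega),
    det_coRootPoly hinj]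
  -- Basis adapted to the zeros: `N` multiples of `rootPoly lam`, which every evaluation kills, and
  -- `l` monomials. Both bases span the polynomials of degree below `M + k = N + l`.
  have h2 := bigPf_append_pow (bLin hβ) (evalAt kap lam) (aLin_antisymm hβ) (M % 2) (n := N)
    (rootPoly_monic lam) (rootPoly_natDegree lam)
  rw [bigPf_append_constraint _ _ (aLin_antisymm _) (by omega) hpN _ _
    (fun i => evalAt_rootPoly_lam_mul _), extPf_rootPoly_lam hα hκ, det_evalAt,
    prod_rootPoly_eval, show l + N = k + M by omega] at h2
  have hs : ∀ n : ℕ, ((-1 : ℂ) ^ n) * (-1) ^ n = 1 := fun n => by rw [← mul_pow]; simp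
  -- As `k` and `l` have the same parity, so do `M` and `N`.
  have hsgn : (-1 : ℂ) ^ (M * k) = (-1) ^ (N * l) := by
    refine neg_one_pow_congr ?_
    have : (M + k) % 2 = (N + l) % 2 := by rw [hMN]
    rw [Nat.even_mul, Nat.even_mul]
    simp only [Nat.even_iff] at *
    omega
  have h3 : bigPf (aLin hβ) (bLin hβ) (evalAt kap lam) (M % 2)
      (fun i : Fin (k + M) => X ^ (i : ℕ)) = (-1) ^ (N * l) * (ZB α N kap lam *
        ((-1) ^ (l * (l - 1) / 2) * (((-1) ^ (k * l) *
          ∏ a, ∏ b, (kap a - lam b))⁻¹ * vand lam))) := by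
    rw [h2, ← mul_assoc, hs, one_mul]
  have hinv : ((-1 : ℂ) ^ (k * l))⁻¹ = (-1) ^ (k * l) := by
    rw [← inv_pow]; norm_num
  rw [h3, berB, hsgn, mul_inv, hinv, pow_add, pow_add]
  linear_combination (((-1) ^ (k * (k - 1) / 2) * vand kap * ZB α N kap lam *
    ((-1) ^ (l * (l - 1) / 2) * ((-1) ^ (k * l) * (∏ a, ∏ b, (kap a - lam b))⁻¹ * vand lam)))) *
    hs (N * l)

/-- Normalized evaluation at the points `lam`, together with a multiple of a coefficient. -/
noncomputable def evalAtInfty (kap : Fin k → ℂ) (lam : Fin l → ℂ) (c : ℂ) (n : ℕ) :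
    ℂ[X] →ₗ[ℂ] Fin (l + 1) → ℂ :=
  LinearMap.pi (Fin.snoc (fun b => LinearMap.proj b ∘ₗ evalAt kap lam) (c • lcoeff ℂ n) :
    Fin (l + 1) → ℂ[X] →ₗ[ℂ] ℂ)

theorem evalAtInfty_castSucc (c : ℂ) (n : ℕ) (P : ℂ[X]) (b : Fin l) :
    evalAtInfty kap lam c n P b.castSucc = evalAt kap lam P b := by
  simp [evalAtInfty]

theorem evalAtInfty_last (c : ℂ) (n : ℕ) (P : ℂ[X]) :
    evalAtInfty kap lam c n P (Fin.last l) = c * P.coeff n := by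
  simp [evalAtInfty]

theorem det_evalAtInfty (c : ℂ) {n : ℕ} (hn : l ≤ n) :
    (Matrix.of fun i j : Fin (l + 1) => evalAtInfty kap lam c n
      ((Fin.snoc (fun j : Fin l => X ^ (j : ℕ)) (X ^ n) : Fin (l + 1) → ℂ[X]) i) j).det =
    c * ((∏ b, (rootPoly kap).eval (lam b))⁻¹ * vand lam) := by
  rw [Matrix.det_succ_column _ (Fin.last l), Fin.sum_univ_castSucc, Finset.sum_eq_zero, zero_add,
    ← det_evalAt]
  · simp only [Matrix.of_apply, Fin.snoc_last, evalAtInfty_last, coeff_X_pow_self, Fin.val_last,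
      mul_one, ← two_mul, pow_mul]
    rw [neg_one_sq, one_pow, one_mul]
    congr 2
    ext i j
    simp [evalAtInfty_castSucc]
  · intro i _
    have : n ≠ (i : ℕ) := by have := i.2; omega
    simp [evalAtInfty_last, coeff_X_pow, this]

include hα in
/-- The Pfaffian of the point kernel for an odd number of points and the point at infinity. -/
theorem ZB_zero_mul_pfOn_odd (h : Admissible kap lam) {M N : ℕ} (hkl : Odd (k + l))
    (hMN : M + k = N + l + 1) (hZ : ZB₀ α M ≠ 0) :
    ZB₀ α M * pfOn (sumEnum (Equiv.refl (Fin k)) (Equiv.refl (Fin (l + 1))))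
      (pointMatrix α M (Sum.elim (fun a => .pole (kap a))
        (Fin.snoc (fun b => .root (lam b)) .infinity : Fin (l + 1) → CharPoint))) =
    (-1) ^ (k * (k - 1) / 2 + (l + 1) * l / 2 + k * l) * berB kap lam * ZB α N kap lam := by
  obtain ⟨hκ, hinj, -, hne⟩ := h
  have hβ := hα.div_prod hκ
  have hpN : Even (M % 2 + N) := even_mod_two_add (by rw [Nat.even_iff, Nat.odd_iff] at *; omega)
  -- The functional at infinity takes the coefficient of degree `l + N = M + k - 1`, the top degree
  -- of the space. Multiples of `rootPoly lam` by `X ^ i` with `i < N` do not reach it.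
  let E := evalAtInfty kap lam ((-1) ^ M) (l + N)
  have hEl : ∀ a, E (coRootPoly kap a) (Fin.last l) = if M = 0 then 1 else 0 := by
    intro a
    rw [evalAtInfty_last]
    split_ifs with hM
    · have e : l + N = (coRootPoly kap a).natDegree := by rw [coRootPoly_natDegree]; omega
      rw [e, (coRootPoly_monic kap a).coeff_natDegree, hM]
      simp
    · rw [coeff_eq_zero_of_natDegree_lt, mul_zero]
      rw [coRootPoly_natDegree]
      have := a.2
      omega
  have hE : ∀ a c, E (coRootPoly kap a) c = pointPair α M (.pole (kap a))
      ((Fin.snoc (fun b => .root (lam b)) .infinity : Fin (l + 1) → CharPoint) c) := by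
    intro a c
    refine Fin.lastCases ?_ (fun c => ?_) c
    · rw [hEl, Fin.snoc_last]
      rfl
    · rw [evalAtInfty_castSucc, evalAt_coRootPoly hne, Fin.snoc_castSucc]
      rfl
  have hE' : ∀ a c, -E (coRootPoly kap a) c = pointPair α M
      ((Fin.snoc (fun b => .root (lam b)) .infinity : Fin (l + 1) → CharPoint) c)
      (.pole (kap a)) := by
    intro a c
    refine Fin.lastCases ?_ (fun c => ?_) c
    · rw [hEl, Fin.snoc_last]
      rfl
    · rw [evalAtInfty_castSucc, evalAt_coRootPoly hne, Fin.snoc_castSucc]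
      rfl
  have hpair : ∀ c c', pointPair α M
      ((Fin.snoc (fun b => .root (lam b)) .infinity : Fin (l + 1) → CharPoint) c)
      ((Fin.snoc (fun b => .root (lam b)) .infinity : Fin (l + 1) → CharPoint) c') = 0 := by
    intro c c'
    refine Fin.lastCases ?_ (fun c => ?_) c <;> refine Fin.lastCases ?_ (fun c' => ?_) c' <;>
      simp only [Fin.snoc_last, Fin.snoc_castSucc] <;> rfl
  have hcol : ∀ u c, pointCol α M
      ((Fin.snoc (fun b => .root (lam b)) .infinity : Fin (l + 1) → CharPoint) c) (.inl u) = 0 := by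
    intro u c
    refine Fin.lastCases ?_ (fun c => ?_) c <;>
      simp only [Fin.snoc_last, Fin.snoc_castSucc] <;> rfl
  have hEcol : ∀ (i : Fin M) c, E (rootPoly kap * X ^ (i : ℕ)) c = pointCol α M
      ((Fin.snoc (fun b => .root (lam b)) .infinity : Fin (l + 1) → CharPoint) c) (.inr i) := by
    intro i c
    have := i.2
    refine Fin.lastCases ?_ (fun c => ?_) c
    · rw [evalAtInfty_last, Fin.snoc_last, pointCol, coeff_mul_X_pow']
      split_ifs with h1 h2 h2
      · have e : l + N - i = (rootPoly kap).natDegree := by rw [rootPoly_natDegree]; omega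
        rw [e, (rootPoly_monic kap).coeff_natDegree, mul_one]
      · rw [coeff_eq_zero_of_natDegree_lt, mul_zero]
        rw [rootPoly_natDegree]
        omega
      · omega
      · rw [mul_zero]
    · rw [evalAtInfty_castSucc, evalAt_rootPoly_mul hne, Fin.snoc_castSucc]
      simp [pointCol]
  have hE0 : ∀ i : Fin N, E (rootPoly lam * X ^ (i : ℕ)) = 0 := by
    intro i
    have := i.2
    ext c
    refine Fin.lastCases ?_ (fun c => ?_) c
    · rw [evalAtInfty_last, coeff_eq_zero_of_natDegree_lt, mul_zero]
      · rfl
      · rw [(rootPoly_monic lam).natDegree_mul (monic_X_pow _), rootPoly_natDegree, natDegree_X_pow]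
        omega
    · rw [evalAtInfty_castSucc, evalAt_rootPoly_lam_mul]
      rfl
  have h1 := bigPf_rootPoly_schur hα hκ hZ E _ hE hE' hpair hEcol hcol
  rw [← h1, bigPf_append_of_natDegree_lt _ _ (aLin_antisymm _) _ (rootPoly_monic kap)
    (rootPoly_natDegree kap) _ (fun i => by rw [coRootPoly_natDegree]; have := i.2; omega),
    det_coRootPoly hinj]
  have h2 := bigPf_append_snoc_pow (bLin hβ) E (aLin_antisymm hβ) (M % 2) (n := N)
    (rootPoly_monic lam) (rootPoly_natDegree lam)
  rw [bigPf_append_constraint _ _ (aLin_antisymm _) (by omega) hpN _ _ hE0,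
    extPf_rootPoly_lam hα hκ, det_evalAtInfty _ (by omega),
    prod_rootPoly_eval, show l + N + 1 = k + M by omega] at h2
  have hs : ∀ n : ℕ, ((-1 : ℂ) ^ n) * (-1) ^ n = 1 := fun n => by rw [← mul_pow]; simp
  have hsgn : (-1 : ℂ) ^ (M * k) = (-1) ^ (N * l) * (-1) ^ M := by
    rw [← pow_add]
    refine neg_one_pow_congr ?_
    have : (M + k) % 2 = (N + l + 1) % 2 := by rw [hMN]
    rw [Nat.even_mul, Nat.even_add, Nat.even_mul]
    simp only [Nat.even_iff, Nat.odd_iff] at *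
    omega
  have h3 : bigPf (aLin hβ) (bLin hβ) E (M % 2)
      (fun i : Fin (k + M) => X ^ (i : ℕ)) = (-1) ^ (N * l) * (ZB α N kap lam *
        ((-1) ^ ((l + 1) * l / 2) * ((-1) ^ M * (((-1) ^ (k * l) *
          ∏ a, ∏ b, (kap a - lam b))⁻¹ * vand lam)))) := by
    rw [Nat.add_sub_cancel] at h2
    rw [h2, ← mul_assoc, hs, one_mul]
  have hinv : ((-1 : ℂ) ^ (k * l))⁻¹ = (-1) ^ (k * l) := by
    rw [← inv_pow]; norm_num
  rw [h3, berB, hsgn, mul_inv, hinv, pow_add, pow_add]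
  linear_combination (((-1) ^ (k * (k - 1) / 2) * vand kap * ZB α N kap lam *
    ((-1) ^ ((l + 1) * l / 2) *
      ((-1) ^ (k * l) * (∏ a, ∏ b, (kap a - lam b))⁻¹ * vand lam)))) *
    (hs (N * l) * (-1) ^ M * (-1) ^ M + hs M)

end Core

end

theorem pfOn_two {ι : Type*} (e : ι ≃ Fin 2) {A : Matrix ι ι ℂ} (hA : A.transpose = -A) :
    pfOn e A = A (e.symm 0) (e.symm 1) := by
  have h : A (e.symm 1) (e.symm 0) = -A (e.symm 0) (e.symm 1) := congrFun (congrFun hA _) _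
  have hu : (Finset.univ : Finset (Equiv.Perm (Fin 2))) = {1, Equiv.swap 0 1} := by decide
  rw [pfOn, pfaffian, if_pos even_two, hu, Finset.sum_pair (by decide)]
  simp [h]
  ring

theorem pfOn_diagonal {ι : Type*} [Fintype ι] {n : ℕ} (e : ι ≃ Fin n) (c : ι → ℂ)
    {A : Matrix ι ι ℂ} (hA : A.transpose = -A) :
    pfOn e (Matrix.of fun i j => c i * A i j * c j) = (∏ i, c i) * pfOn e A := by
  have h := pfaffian_diagonal_mul_mul_diagonal (fun i => c (e.symm i)) (A.submatrix e.symm e.symm)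
    (by rw [Matrix.transpose_submatrix, hA]; rfl)
  rw [Equiv.prod_comp e.symm c] at h
  exact h

theorem vand_of_isEmpty (u : Fin 0 → ℂ) : vand u = 1 := by
  simp [vand]

theorem vand_singleton (u : Fin 1 → ℂ) : vand u = 1 := by
  simp [vand]

theorem vand_pair (u v : ℂ) : vand ![u, v] = v - u := by
  simp [vand, Fin.prod_univ_two, show Finset.Ioi (0 : Fin 2) = {1} by decide,
    show Finset.Ioi (1 : Fin 2) = ∅ by decide]

/-! ### The kernels of both ensembles as values of the point kernel -/

section Kernels

variable {α : ℝ → ℂ} (hα : HasAllMoments α)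
include hα

theorem pointMatrix_transpose (M : ℕ) {ι : Type*} {pt : ι → CharPoint}
    (h : ∀ i κ, pt i = .pole κ → ∀ t : ℝ, 0 ≤ t → κ ≠ t) :
    (pointMatrix α M pt).transpose = -pointMatrix α M pt := by
  ext i j
  exact pointKernel_antisymm hα M _ _ (h j) (h i)

/-- With at most one monomial, only a diagonal entry of the antisymmetric inverse can contribute,
and it is zero. This matches the kernels at the truncated index `M - 1 = 0`. -/
theorem pointKernel_eq_zero_of_le_one {M : ℕ} (hM : M ≤ 1) {x y : CharPoint}
    (hx : ∀ u, pointCol α M x (.inl u) = 0) (hy : ∀ u, pointCol α M y (.inl u) = 0)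
    (hxy : pointPair α M x y = 0) : pointKernel α M x y = 0 := by
  rw [pointKernel, hxy, zero_add]
  refine Finset.sum_eq_zero fun v _ => ?_
  rcases v with v | v
  · rw [hy, mul_zero]
  · rw [Finset.sum_eq_zero, zero_mul]
    rintro (u | u) _
    · rw [hx, zero_mul]
    · obtain rfl : u = v := by ext; have := u.2; have := v.2; omega
      have h := momentGram_inv_antisymm hα M (.inr u) (.inr u)
      rw [self_eq_neg] at h
      rw [h, mul_zero]

variable {M : ℕ} (hZ : ZB₀ α M ≠ 0)
include hZ

theorem ZC_zero_ne_zero : ZC₀ α M ≠ 0 := by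
  intro h
  have := two_pow_mul_ZC_zero hα M
  rw [h, mul_zero] at this
  exact hZ (pow_eq_zero_iff two_ne_zero |>.mp this.symm)

/-- The general identity for just two points: a Pfaffian of size two is its single entry, so a value
of the point kernel is itself a Bures partition function. The next four lemmas use the same device.
-/
theorem ZB_zero_mul_pointKernel_poles {κ₁ κ₂ : ℂ} (h : Admissible ![κ₁, κ₂] ![]) :
    ZB₀ α M * pointKernel α M (.pole κ₁) (.pole κ₂) =
      (κ₁ - κ₂) * ZB α (M + 2) ![κ₁, κ₂] ![] := by
  have h1 := ZB_zero_mul_pfOn_even hα h (M := M) (N := M + 2) (by decide) rfl hZ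
  rw [pfOn_two _ (pointMatrix_transpose hα M (by
    rintro (i | i) κ hi
    · cases hi
      exact h.1 i
    · exact i.elim0))] at h1
  change ZB₀ α M * pointKernel α M (.pole κ₁) (.pole κ₂) = _ at h1
  rw [h1, berB, vand_pair, vand_of_isEmpty]
  simp

theorem ZB_zero_mul_pointKernel_pole_root {κ lam : ℂ} (h : Admissible ![κ] ![lam]) :
    ZB₀ α M * pointKernel α M (.pole κ) (.root lam) = (lam - κ)⁻¹ * ZB α M ![κ] ![lam] := by
  have h1 := ZB_zero_mul_pfOn_even hα h (M := M) (N := M) (by decide) rfl hZ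
  rw [pfOn_two _ (pointMatrix_transpose hα M (by
    rintro (i | i) κ hi
    · cases hi
      exact h.1 i
    · cases hi))] at h1
  change ZB₀ α M * pointKernel α M (.pole κ) (.root lam) = _ at h1
  rw [h1, berB, vand_singleton, vand_singleton]
  simp
  rw [← neg_sub lam κ, inv_neg]
  ring

theorem ZB_zero_mul_pointKernel_roots {lam₁ lam₂ : ℂ} (h : lam₁ ≠ lam₂) {N : ℕ} (hM : M = N + 2) :
    ZB₀ α M * pointKernel α M (.root lam₁) (.root lam₂) =
      (lam₁ - lam₂) * ZB α N ![] ![lam₁, lam₂] := by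
  have hadm : Admissible ![] ![lam₁, lam₂] := by
    refine ⟨fun i => i.elim0, fun i => i.elim0, fun i j hij => ?_, fun i => i.elim0⟩
    fin_cases i <;> fin_cases j <;> simp_all
  have h1 := ZB_zero_mul_pfOn_even hα hadm (M := M) (N := N) (by decide) hM hZ
  rw [pfOn_two _ (pointMatrix_transpose hα M (by
    rintro (i | i) κ hi
    · exact i.elim0
    · cases hi))] at h1
  change ZB₀ α M * pointKernel α M (.root lam₁) (.root lam₂) = _ at h1
  rw [h1, berB, vand_pair, vand_of_isEmpty]
  simp

theorem ZB_zero_mul_pointKernel_pole_infinity {κ : ℂ} (h : Admissible ![κ] ![]) :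
    ZB₀ α M * pointKernel α M (.pole κ) .infinity = ZB α M ![κ] ![] := by
  have h1 := ZB_zero_mul_pfOn_odd hα h (M := M) (N := M) (by decide) rfl hZ
  rw [pfOn_two _ (pointMatrix_transpose hα M (by
    rintro (i | i) κ hi
    · cases hi
      exact h.1 i
    · obtain rfl : i = Fin.last 0 := Fin.ext (by omega)
      cases hi))] at h1
  change ZB₀ α M * pointKernel α M (.pole κ) .infinity = _ at h1
  rw [h1, berB, vand_singleton, vand_of_isEmpty]
  simp

theorem ZB_zero_mul_pointKernel_root_infinity (lam : ℂ) {N : ℕ} (hM : M = N + 2) :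
    ZB₀ α M * pointKernel α M (.root lam) .infinity = -ZB α N ![] ![lam] := by
  have hadm : Admissible ![] ![lam] :=
    ⟨fun i => i.elim0, fun i => i.elim0, Function.injective_of_subsingleton _, fun i => i.elim0⟩
  have h1 := ZB_zero_mul_pfOn_odd hα hadm (M := M) (N := N) (by decide) hM hZ
  rw [pfOn_two _ (pointMatrix_transpose hα M (by
    rintro (i | i) κ hi
    · exact i.elim0
    · revert hi
      refine Fin.lastCases ?_ (fun i => ?_) i <;> intro hi
      · rw [Sum.elim_inr, Fin.snoc_last] at hi
        cases hi
      · rw [Sum.elim_inr, Fin.snoc_castSucc] at hi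
        cases hi))] at h1
  change ZB₀ α M * pointKernel α M (.root lam) .infinity = _ at h1
  rw [h1, berB, vand_singleton, vand_of_isEmpty]
  simp

/-- Both sides are multiples of the Bures partition function with two poles, by the quadratic
relation and by the two-point identity; `2 ^ M * ZC₀ = ZB₀ ^ 2` converts the constants. -/
theorem K11_eq_pointKernel {κ₁ κ₂ : ℂ} (h : Admissible ![κ₁, κ₂] ![]) :
    K11 α (M + 1) κ₁ κ₂ = pointKernel α M (.pole κ₁) (.pole κ₂) / 2 := by
  have h1 := ZB_zero_mul_pointKernel_poles hα hZ h
  have hZC := two_pow_mul_ZC_zero hα M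
  have hZC0 := ZC_zero_ne_zero hα hZ
  have h2 := ZC_poles_sub_swap hα M (h.1 0) (h.1 1)
  have hp : (2 : ℂ) ^ M ≠ 0 := by positivity
  simp only [Matrix.cons_val_zero, Matrix.cons_val_one] at h2
  rw [K11, Nat.add_sub_cancel, div_eq_div_iff (mul_ne_zero two_ne_zero hZC0) two_ne_zero]
  refine mul_left_cancel₀ hp ?_
  linear_combination 2 * h2 - 2 * pointKernel α M (.pole κ₁) (.pole κ₂) * hZC - 2 * ZB₀ α M * h1

theorem K01_eq_pointKernel {κ lam : ℂ} (h : Admissible ![κ] ![lam]) :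
    K01 α M κ lam = pointKernel α M (.pole κ) (.root lam) := by
  have h1 := ZB_zero_mul_pointKernel_pole_root hα hZ h
  have hZC := two_pow_mul_ZC_zero hα M
  have hZC0 := ZC_zero_ne_zero hα hZ
  have h2 := ZC_pole_zero_add_swap hα M (h.1 0) lam
  have hp : (2 : ℂ) ^ M ≠ 0 := by positivity
  have hne : lam - κ ≠ 0 := sub_ne_zero.mpr (h.2.2.2 0 0).symm
  rw [inv_mul_eq_div, eq_div_iff hne] at h1
  simp only [Matrix.cons_val_fin_one] at h2
  rw [K01, div_eq_iff (mul_ne_zero (mul_ne_zero two_ne_zero hZC0) hne)]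
  refine mul_left_cancel₀ hp ?_
  linear_combination h2 - 2 * pointKernel α M (.pole κ) (.root lam) * (lam - κ) * hZC -
    2 * ZB₀ α M * h1

theorem K00_eq_pointKernel {lam₁ lam₂ : ℂ} (h : lam₁ ≠ lam₂) :
    K00 α (M - 1) lam₁ lam₂ = 2 * pointKernel α M (.root lam₁) (.root lam₂) := by
  by_cases hM : M ≤ 1
  · rw [pointKernel_eq_zero_of_le_one hα hM (fun _ => rfl) (fun _ => rfl) rfl,
      show M - 1 = 0 by omega, K00, ZC_size_zero, ZC_size_zero]
    simp
  · obtain ⟨N, rfl⟩ : ∃ N, M = N + 2 := ⟨M - 2, by omega⟩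
    have h1 := ZB_zero_mul_pointKernel_roots hα hZ h rfl
    have hZC := two_pow_mul_ZC_zero hα (N + 2)
    have hZC0 := ZC_zero_ne_zero hα hZ
    have h2 := ZC_zeros_sub_swap hα N lam₁ lam₂
    have hp : (2 : ℂ) ^ (N + 2) ≠ 0 := by positivity
    rw [K00, show N + 2 - 1 = N + 1 from rfl, div_eq_iff (mul_ne_zero two_ne_zero hZC0)]
    refine mul_left_cancel₀ hp ?_
    linear_combination -4 * h2 - 4 * pointKernel α (N + 2) (.root lam₁) (.root lam₂) * hZC -
      4 * ZB₀ α (N + 2) * h1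

theorem K1_eq_pointKernel {κ : ℂ} (h : Admissible ![κ] ![]) :
    K1 α M κ = -pointKernel α M (.pole κ) .infinity := by
  have h1 := ZB_zero_mul_pointKernel_pole_infinity hα hZ h
  have hZC := two_pow_mul_ZC_zero hα M
  have hZC0 := ZC_zero_ne_zero hα hZ
  have h2 := ZC_pole_add_swap hα M (h.1 0)
  have hp : (2 : ℂ) ^ M ≠ 0 := by positivity
  simp only [Matrix.cons_val_fin_one] at h2
  rw [K1, neg_inj, div_eq_iff (mul_ne_zero two_ne_zero hZC0)]
  refine mul_left_cancel₀ hp ?_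
  linear_combination h2 - 2 * pointKernel α M (.pole κ) .infinity * hZC - 2 * ZB₀ α M * h1

theorem K0_eq_pointKernel (lam : ℂ) :
    K0 α (M - 1) lam = -2 * pointKernel α M (.root lam) .infinity := by
  by_cases hM : M ≤ 1
  · rw [pointKernel_eq_zero_of_le_one hα hM (fun _ => rfl) (fun _ => rfl) rfl,
      show M - 1 = 0 by omega, K0, ZC_size_zero, ZC_size_zero]
    simp
  · obtain ⟨N, rfl⟩ : ∃ N, M = N + 2 := ⟨M - 2, by omega⟩
    have h1 := ZB_zero_mul_pointKernel_root_infinity hα hZ lam rfl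
    have hZC := two_pow_mul_ZC_zero hα (N + 2)
    have hZC0 := ZC_zero_ne_zero hα hZ
    have h2 := ZC_zero_sub_swap hα N lam
    have hp : (2 : ℂ) ^ (N + 2) ≠ 0 := by positivity
    rw [K0, show N + 2 - 1 = N + 1 from rfl, div_eq_iff (mul_ne_zero two_ne_zero hZC0)]
    refine mul_left_cancel₀ hp ?_
    linear_combination -4 * h2 + 4 * pointKernel α (N + 2) (.root lam) .infinity * hZC +
      4 * ZB₀ α (N + 2) * h1

end Kernels

/-! ### Diagonal scaling and the Pfaffian formulas -/

section Final

variable {α : ℝ → ℂ} (hα : HasAllMoments α) {k l M : ℕ} {kap : Fin k → ℂ} {lam : Fin l → ℂ}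

theorem Admissible.pair (h : Admissible kap lam) {i j : Fin k} (hij : i ≠ j) :
    Admissible ![kap i, kap j] ![] := by
  refine ⟨fun a => ?_, fun a c hac => ?_, fun a => a.elim0, fun _ c => c.elim0⟩
  · fin_cases a
    · exact h.1 i
    · exact h.1 j
  · have := h.2.1.ne hij
    have := h.2.1.ne hij.symm
    fin_cases a <;> fin_cases c <;> simp_all

theorem Admissible.pole_root (h : Admissible kap lam) (i : Fin k) (j : Fin l) :
    Admissible ![kap i] ![lam j] :=
  ⟨fun a => by simpa using h.1 i, Function.injective_of_subsingleton _,
    Function.injective_of_subsingleton _, fun a c => by simpa using h.2.2.2 i j⟩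

theorem Admissible.pole (h : Admissible kap lam) (i : Fin k) : Admissible ![kap i] ![] :=
  ⟨fun a => by simpa using h.1 i, Function.injective_of_subsingleton _, fun a => a.elim0,
    fun _ c => c.elim0⟩

theorem berB_ne_zero (h : Admissible kap lam) : berB kap lam ≠ 0 :=
  div_ne_zero (mul_ne_zero (vand_ne_zero h.2.1) (vand_ne_zero h.2.2.1))
    (Finset.prod_ne_zero_iff.mpr fun i _ => Finset.prod_ne_zero_iff.mpr fun j _ =>
      sub_ne_zero.mpr (h.2.2.2 i j))

/-- The points of the kernel matrix for an even number of arguments. -/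
def evenPoint (kap : Fin k → ℂ) (lam : Fin l → ℂ) : Fin k ⊕ Fin l → CharPoint :=
  Sum.elim (fun a => .pole (kap a)) fun b => .root (lam b)

/-- The points of the kernel matrix for an odd number of arguments. -/
def oddPoint (kap : Fin k → ℂ) (lam : Fin l → ℂ) : (Fin k ⊕ Fin l) ⊕ Fin 1 → CharPoint :=
  Sum.elim (evenPoint kap lam) fun _ => .infinity

/-- The square root of two. -/
noncomputable def sqrtTwo : ℂ := (Real.sqrt 2 : ℂ)

theorem sqrtTwo_mul_self : sqrtTwo * sqrtTwo = 2 := by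
  rw [sqrtTwo, ← Complex.ofReal_mul, Real.mul_self_sqrt zero_le_two]
  simp

theorem sqrtTwo_ne_zero : sqrtTwo ≠ 0 := by
  intro h
  have := sqrtTwo_mul_self
  simp [h] at this

/-- The diagonal scaling between the kernel matrix and the point kernel. -/
noncomputable def evenScale (k l : ℕ) : Fin k ⊕ Fin l → ℂ :=
  Sum.elim (fun _ => sqrtTwo⁻¹) fun _ => -sqrtTwo

theorem pointKernel_self (hα : HasAllMoments α) (x : CharPoint)
    (hx : ∀ κ, x = .pole κ → ∀ t : ℝ, 0 ≤ t → κ ≠ t) : pointKernel α M x x = 0 :=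
  self_eq_neg.mp (pointKernel_antisymm hα M x x hx hx)

include hα in
theorem kernelEven_eq (h : Admissible kap lam) (hZ : ZB₀ α M ≠ 0) :
    kernelEven α (-1) M kap lam = Matrix.of fun i j =>
      evenScale k l i * pointMatrix α M (evenPoint kap lam) i j * evenScale k l j := by
  have h2 := sqrtTwo_mul_self
  have h0 := sqrtTwo_ne_zero
  have h2' : sqrtTwo⁻¹ * sqrtTwo⁻¹ = 1 / 2 := by
    rw [← mul_inv, h2, one_div]
  have h1 : sqrtTwo⁻¹ * sqrtTwo = 1 := inv_mul_cancel₀ h0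
  ext (i | i) (j | j)
  · change -(-1) * K11 α (M + 1) (kap i) (kap j) = sqrtTwo⁻¹ *
      pointKernel α M (.pole (kap i)) (.pole (kap j)) * sqrtTwo⁻¹
    -- The two-point identities need distinct points; on the diagonal both sides vanish by
    -- antisymmetry.
    by_cases hij : i = j
    · subst hij
      rw [pointKernel_self hα _ (by rintro κ ⟨⟩; exact h.1 i), K11]
      simp
    · rw [K11_eq_pointKernel hα hZ (h.pair hij)]
      linear_combination -pointKernel α M (.pole (kap i)) (.pole (kap j)) * h2'
  · change -K01 α M (kap i) (lam j) = sqrtTwo⁻¹ *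
      pointKernel α M (.pole (kap i)) (.root (lam j)) * -sqrtTwo
    rw [K01_eq_pointKernel hα hZ (h.pole_root i j)]
    linear_combination pointKernel α M (.pole (kap i)) (.root (lam j)) * h1
  · change K01 α M (kap j) (lam i) = -sqrtTwo *
      pointKernel α M (.root (lam i)) (.pole (kap j)) * sqrtTwo⁻¹
    rw [K01_eq_pointKernel hα hZ (h.pole_root j i), pointKernel_antisymm hα M (.root (lam i))
      (.pole (kap j)) (by rintro κ ⟨⟩) (by rintro κ ⟨⟩; exact h.1 j)]
    linear_combination -pointKernel α M (.pole (kap j)) (.root (lam i)) * h1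
  · change -(-1) * K00 α (M - 1) (lam i) (lam j) = -sqrtTwo *
      pointKernel α M (.root (lam i)) (.root (lam j)) * -sqrtTwo
    by_cases hij : i = j
    · subst hij
      rw [pointKernel_self hα _ (by rintro κ ⟨⟩), K00]
      simp
    · rw [K00_eq_pointKernel hα hZ (h.2.2.1.ne hij)]
      linear_combination -pointKernel α M (.root (lam i)) (.root (lam j)) * h2

include hα in
theorem kernelOdd_eq (h : Admissible kap lam) (hZ : ZB₀ α M ≠ 0) :
    kernelOdd α (-1) M kap lam = Matrix.of fun i j =>
      Sum.elim (evenScale k l) (fun _ => sqrtTwo) i * pointMatrix α M (oddPoint kap lam) i j *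
        Sum.elim (evenScale k l) (fun _ => sqrtTwo) j := by
  have h2 := sqrtTwo_mul_self
  have h1 : sqrtTwo⁻¹ * sqrtTwo = 1 := inv_mul_cancel₀ sqrtTwo_ne_zero
  ext (i | i) (j | j)
  · exact congrFun (congrFun (kernelEven_eq hα h hZ) i) j
  · rcases i with i | i
    · change -K1 α M (kap i) = sqrtTwo⁻¹ * pointKernel α M (.pole (kap i)) .infinity * sqrtTwo
      rw [K1_eq_pointKernel hα hZ (h.pole i)]
      linear_combination -pointKernel α M (.pole (kap i)) .infinity * h1
    · change -(-1) * K0 α (M - 1) (lam i) = -sqrtTwo * pointKernel α M (.root (lam i)) .infinity *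
        sqrtTwo
      rw [K0_eq_pointKernel hα hZ]
      linear_combination pointKernel α M (.root (lam i)) .infinity * h2
  · rcases j with j | j
    · change K1 α M (kap j) = sqrtTwo * pointKernel α M .infinity (.pole (kap j)) * sqrtTwo⁻¹
      rw [K1_eq_pointKernel hα hZ (h.pole j), pointKernel_antisymm hα M .infinity
        (.pole (kap j)) (by rintro κ ⟨⟩) (by rintro κ ⟨⟩; exact h.1 j)]
      linear_combination pointKernel α M (.pole (kap j)) .infinity * h1
    · change -1 * K0 α (M - 1) (lam j) = sqrtTwo * pointKernel α M .infinity (.root (lam j)) *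
        -sqrtTwo
      rw [K0_eq_pointKernel hα hZ, pointKernel_antisymm hα M .infinity
        (.root (lam j)) (by rintro κ ⟨⟩) (by rintro κ ⟨⟩)]
      linear_combination -pointKernel α M (.root (lam j)) .infinity * h2
  · change (0 : ℂ) = sqrtTwo * pointKernel α M .infinity .infinity * sqrtTwo
    rw [pointKernel_self hα _ (by rintro κ ⟨⟩)]
    simp

theorem evenPoint_pole (h : Admissible kap lam) (i : Fin k ⊕ Fin l) (κ : ℂ)
    (hi : evenPoint kap lam i = .pole κ) (t : ℝ) (ht : 0 ≤ t) : κ ≠ t := by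
  rcases i with i | i <;> cases hi
  exact h.1 i t ht

theorem oddPoint_pole (h : Admissible kap lam) (i : (Fin k ⊕ Fin l) ⊕ Fin 1) (κ : ℂ)
    (hi : oddPoint kap lam i = .pole κ) (t : ℝ) (ht : 0 ≤ t) : κ ≠ t := by
  rcases i with i | i
  · exact evenPoint_pole h i κ hi t ht
  · cases hi

theorem prod_evenScale (k l : ℕ) : ∏ i, evenScale k l i = (sqrtTwo⁻¹) ^ k * (-sqrtTwo) ^ l := by
  simp [evenScale, Fintype.prod_sum_type]

theorem rpow_half_eq (N : ℕ) : (((2 : ℝ) ^ ((N : ℝ) / 2) : ℝ) : ℂ) = sqrtTwo ^ N := by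
  rw [sqrtTwo, ← Complex.ofReal_pow, Real.sqrt_eq_rpow, ← Real.rpow_mul_natCast zero_le_two]
  congr 2
  ring

include hα in
-- The positive square root of `2 ^ M * ZC₀ = ZB₀ ^ 2`; positivity of `ZB₀` selects the branch.
theorem sqrtTwo_pow_mul_sqrt_ZC (hZ : 0 < ZB₀ α M) :
    sqrtTwo ^ M * (Real.sqrt (ZC₀ α M).re : ℂ) = ZB₀ α M := by
  obtain ⟨x, hx⟩ : ∃ x : ℝ, ZB₀ α M = x := ⟨(ZB₀ α M).re, by
    rw [Complex.lt_def] at hZ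
    exact Complex.ext rfl hZ.2.symm⟩
  have h := two_pow_mul_ZC_zero hα M
  rw [hx] at hZ h ⊢
  have hx0 : 0 < x := Complex.zero_lt_real.mp hZ
  have hp : (2 : ℝ) ^ M ≠ 0 := by positivity
  have hC : ZC₀ α M = ((x ^ 2 / 2 ^ M : ℝ) : ℂ) := by
    push_cast
    rw [eq_div_iff (by exact_mod_cast hp), ← h, mul_comm]
  have hs : Real.sqrt 2 ^ M ≠ 0 := by positivity
  have hsq : Real.sqrt (x ^ 2 / 2 ^ M) = x / Real.sqrt 2 ^ M := by
    rw [Real.sqrt_div (sq_nonneg x), Real.sqrt_sq hx0.le]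
    congr 1
    rw [Real.sqrt_eq_iff_mul_self_eq (by positivity) (by positivity), ← mul_pow,
      Real.mul_self_sqrt zero_le_two]
  rw [hC, Complex.ofReal_re, hsq, sqrtTwo, ← Complex.ofReal_pow, ← Complex.ofReal_mul,
    mul_div_cancel₀ _ hs]

/-- Bookkeeping for both parities: `rM`, `rN`, `rk`, `rl` are powers of `√2`, which balance by the
relation between `M`, `N`, `k`, `l`, and `ε`, `ε'`, `δ` are signs. -/
theorem eq_mul_of_scaled {rM rN rk rl s B pf Z ε ε' δ : ℂ} (hk : rk ≠ 0) (hB : B ≠ 0)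
    (hpow : rM * rk = rN * rl) (hcore : rM * s * pf = ε' * B * Z) (hε : ε * δ * ε' = 1) :
    Z = ε * rN * (s / B) * (rk⁻¹ * (δ * rl) * pf) := by
  have h : ε * rN * (s / B) * (rk⁻¹ * (δ * rl) * pf) = ε * δ * (rM * s * pf) / B := by
    field_simp
    linear_combination -(ε * s * δ * pf) * hpow
  rw [h, hcore]
  field_simp
  linear_combination -Z * hε

include hα in
theorem ZB_eq_pfaffian_even (h : Admissible kap lam) (hZ : 0 < ZB₀ α M) {N : ℕ}
    (hkl : Even (k + l)) (hMN : M + k = N + l) :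
    ZB α N kap lam =
      (-1) ^ (k * (k - 1) / 2 + l * (l - 1) / 2) * (((2 : ℝ) ^ ((N : ℝ) / 2) : ℝ) : ℂ) *
        ((Real.sqrt (ZC₀ α M).re : ℂ) / berB kap lam) *
        pfaffian (Matrix.reindex finSumFinEquiv finSumFinEquiv (kernelEven α (-1) M kap lam)) := by
  have hcore := ZB_zero_mul_pfOn_even hα h hkl hMN hZ.ne'
  have hsq := sqrtTwo_pow_mul_sqrt_ZC hα hZ
  have hP : pfaffian (Matrix.reindex finSumFinEquiv finSumFinEquiv (kernelEven α (-1) M kap lam)) =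
      (sqrtTwo⁻¹) ^ k * (-sqrtTwo) ^ l *
        pfOn (sumEnum (Equiv.refl (Fin k)) (Equiv.refl (Fin l)))
          (pointMatrix α M (evenPoint kap lam)) := by
    rw [← prod_evenScale, ← pfOn_diagonal _ _ (pointMatrix_transpose hα M (evenPoint_pole h)),
      kernelEven_eq hα h hZ.ne']
    have he : sumEnum (Equiv.refl (Fin k)) (Equiv.refl (Fin l)) = finSumFinEquiv := by
      ext (i | i) <;> simp
    rw [he]
    rfl
  change ZB₀ α M * pfOn _ (pointMatrix α M (evenPoint kap lam)) = _ at hcore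
  rw [hP, rpow_half_eq]
  rw [← hsq] at hcore
  rw [inv_pow, neg_pow sqrtTwo]
  refine eq_mul_of_scaled (pow_ne_zero _ sqrtTwo_ne_zero) (berB_ne_zero h) ?_ hcore ?_
  · rw [← pow_add, ← pow_add, hMN]
  -- Modulo two the exponents add up to `(k + 1) * l`, which is even when `k` and `l` have the same
  -- parity.
  · rw [← pow_add, ← pow_add]
    refine Even.neg_one_pow ?_
    have e : k * (k - 1) / 2 + l * (l - 1) / 2 + l + (k * (k - 1) / 2 + l * (l - 1) / 2 + k * l) =
        2 * (k * (k - 1) / 2 + l * (l - 1) / 2) + (k + 1) * l := by ring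
    have h' : Even ((k + 1) * l) := by
      rw [Nat.even_mul, Nat.even_add_one]
      rw [Nat.even_add] at hkl
      tauto
    rw [e]
    exact (even_two_mul _).add h'

include hα in
theorem ZB_eq_pfaffian_odd (h : Admissible kap lam) (hZ : 0 < ZB₀ α M) {N : ℕ}
    (hkl : Odd (k + l)) (hMN : M + k = N + l + 1) :
    ZB α N kap lam =
      (-1) ^ (k * (k - 1) / 2 + l * (l - 1) / 2) * (((2 : ℝ) ^ ((N : ℝ) / 2) : ℝ) : ℂ) *
        ((Real.sqrt (ZC₀ α M).re : ℂ) / berB kap lam) *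
        pfaffian (Matrix.reindex
          ((finSumFinEquiv.sumCongr (Equiv.refl (Fin 1))).trans finSumFinEquiv)
          ((finSumFinEquiv.sumCongr (Equiv.refl (Fin 1))).trans finSumFinEquiv)
          (kernelOdd α (-1) M kap lam)) := by
  have hcore := ZB_zero_mul_pfOn_odd hα h hkl hMN hZ.ne'
  have hsq := sqrtTwo_pow_mul_sqrt_ZC hα hZ
  let e' : (Fin k ⊕ Fin l) ⊕ Fin 1 ≃ Fin (k + l + 1) :=
    (finSumFinEquiv.sumCongr (Equiv.refl (Fin 1))).trans finSumFinEquiv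
  let σ : (Fin k ⊕ Fin l) ⊕ Fin 1 ≃ Fin k ⊕ Fin (l + 1) :=
    (Equiv.sumAssoc _ _ _).trans ((Equiv.refl _).sumCongr finSumFinEquiv)
  rw [pfOn_congr _ e' σ (by rintro ((i | i) | i) <;> simp [e', σ])] at hcore
  have hpt : ∀ i, Sum.elim (fun a => CharPoint.pole (kap a))
      (Fin.snoc (fun b => .root (lam b)) .infinity : Fin (l + 1) → CharPoint) (σ i) =
      oddPoint kap lam i := by
    rintro ((i | i) | i)
    · rfl
    · exact Fin.snoc_castSucc (n := l) (α := fun _ => CharPoint) .infinity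
        (fun b => .root (lam b)) i
    · obtain rfl : i = 0 := Subsingleton.elim _ _
      exact Fin.snoc_last (n := l) (α := fun _ => CharPoint) .infinity fun b => .root (lam b)
  have hmat : (pointMatrix α M (Sum.elim (fun a => CharPoint.pole (kap a))
      (Fin.snoc (fun b => .root (lam b)) .infinity : Fin (l + 1) → CharPoint))).submatrix σ σ =
      pointMatrix α M (oddPoint kap lam) := by
    ext i j
    simp only [pointMatrix, Matrix.submatrix_apply, Matrix.of_apply, hpt]
  rw [hmat] at hcore
  have hP : pfaffian (Matrix.reindex e' e' (kernelOdd α (-1) M kap lam)) =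
      (sqrtTwo⁻¹) ^ k * ((-sqrtTwo) ^ l * sqrtTwo) *
        pfOn e' (pointMatrix α M (oddPoint kap lam)) := by
    have hprod : ∏ i, Sum.elim (evenScale k l) (fun _ : Fin 1 => sqrtTwo) i =
        (sqrtTwo⁻¹) ^ k * ((-sqrtTwo) ^ l * sqrtTwo) := by
      rw [Fintype.prod_sum_type]
      simp only [Sum.elim_inl, Sum.elim_inr, prod_evenScale, Finset.univ_unique,
        Finset.prod_singleton, mul_assoc]
    rw [← hprod, ← pfOn_diagonal _ _ (pointMatrix_transpose hα M (oddPoint_pole h)),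
      kernelOdd_eq hα h hZ.ne']
    rfl
  rw [hP, rpow_half_eq]
  rw [← hsq] at hcore
  rw [inv_pow, neg_pow sqrtTwo, mul_assoc ((-1) ^ l)]
  refine eq_mul_of_scaled (pow_ne_zero _ sqrtTwo_ne_zero) (berB_ne_zero h) ?_ hcore ?_
  · rw [← pow_succ, ← pow_add, ← pow_add, hMN]
    rfl
  -- The triangular number of `l + 1` exceeds that of `l` by `l`, which cancels the sign of the
  -- scaling. What remains is `k * l`, even because one of `k`, `l` is even.
  · rw [← pow_add, ← pow_add]
    refine Even.neg_one_pow ?_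
    have hl : (l + 1) * l / 2 = l * (l - 1) / 2 + l := by
      have := Finset.sum_range_id (l + 1)
      rw [Finset.sum_range_succ, Finset.sum_range_id] at this
      rw [← this.symm]
      rfl
    have e : k * (k - 1) / 2 + l * (l - 1) / 2 + l + (k * (k - 1) / 2 + (l * (l - 1) / 2 + l) +
        k * l) = 2 * (k * (k - 1) / 2 + l * (l - 1) / 2 + l) + k * l := by ring
    have h' : Even (k * l) := by
      rw [Nat.even_mul]
      rw [← Nat.not_even_iff_odd, Nat.even_add] at hkl
      tauto
    rw [hl, e]
    exact (even_two_mul _).add h'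

end Final

end CauchyBures

theorem mainTheorem3 (α : ℝ → ℂ) (hα : CauchyBures.HasAllMoments α) :
    -- nonnegative weights have positive normalization constants
    ((∀ᵐ z ∂(volume.restrict (Set.Ioi (0 : ℝ))), 0 ≤ α z) →
      (¬ ∀ᵐ z ∂(volume.restrict (Set.Ioi (0 : ℝ))), α z = 0) →
      ∀ L : ℕ, 0 < CauchyBures.ZB₀ α L) ∧
    -- the Pfaffian representations
    ((∀ L : ℕ, 0 < CauchyBures.ZB₀ α L) →
      (∀ L : ℕ, 0 < CauchyBures.ZC₀ α L) ∧
      (∀ L : ℕ, 1 ≤ L → (CauchyBures.ZHat α L).im = 0 ∧ (CauchyBures.ZHat α L).re ≠ 0) ∧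
      ∀ (L : ℕ), 1 ≤ L →
      ∀ (N k l : ℕ) (kap : Fin k → ℂ) (lam : Fin l → ℂ), CauchyBures.Admissible kap lam →
        (∀ M : ℕ, Even (k + l) → M + k = N + l →
          CauchyBures.ZB α N kap lam =
            (-1) ^ (k * (k - 1) / 2 + l * (l - 1) / 2) * (((2 : ℝ) ^ ((N : ℝ) / 2) : ℝ) : ℂ) *
              ((Real.sqrt (CauchyBures.ZC₀ α M).re : ℂ) / CauchyBures.berB kap lam) *
              CauchyBures.pfaffian
                (Matrix.reindex finSumFinEquiv finSumFinEquiv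
                  (CauchyBures.kernelEven α (CauchyBures.meanSign α L) M kap lam))) ∧
        (∀ M : ℕ, Odd (k + l) → M + k = N + l + 1 →
          CauchyBures.ZB α N kap lam =
            (-1) ^ (k * (k - 1) / 2 + l * (l - 1) / 2) * (((2 : ℝ) ^ ((N : ℝ) / 2) : ℝ) : ℂ) *
              ((Real.sqrt (CauchyBures.ZC₀ α M).re : ℂ) / CauchyBures.berB kap lam) *
              CauchyBures.pfaffian
                (Matrix.reindex
                  ((finSumFinEquiv.sumCongr (Equiv.refl (Fin 1))).trans finSumFinEquiv)
                  ((finSumFinEquiv.sumCongr (Equiv.refl (Fin 1))).trans finSumFinEquiv)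
                  (CauchyBures.kernelOdd α (CauchyBures.meanSign α L) M kap lam)))) ∧
    -- the kernels as partition functions of both ensembles
    (∀ (N : ℕ) (kap₁ kap₂ : ℂ), 2 ≤ N → CauchyBures.Admissible ![kap₁, kap₂] ![] →
      CauchyBures.ZB₀ α N ≠ 0 → CauchyBures.ZHat α (N - 1) ≠ 0 →
      CauchyBures.ZB α N ![kap₁, kap₂] ![] / CauchyBures.ZB₀ α N =
        1 / (kap₂ - kap₁) *
          ((CauchyBures.ZC α (N - 1) ![kap₁] ![] ![kap₂] ![] -
            CauchyBures.ZC α (N - 1) ![kap₂] ![] ![kap₁] ![]) / CauchyBures.ZHat α (N - 1))) ∧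
    (∀ (N : ℕ) (kap lam : ℂ), CauchyBures.Admissible ![kap] ![lam] →
      CauchyBures.ZB₀ α N ≠ 0 → CauchyBures.ZC₀ α N ≠ 0 →
      CauchyBures.ZB α N ![kap] ![lam] / CauchyBures.ZB₀ α N =
        (CauchyBures.ZC α N ![] ![] ![kap] ![lam] + CauchyBures.ZC α N ![kap] ![lam] ![] ![]) /
          (2 * CauchyBures.ZC₀ α N)) ∧
    (∀ (N : ℕ) (lam₁ lam₂ : ℂ), lam₁ ≠ lam₂ →
      CauchyBures.ZB₀ α N ≠ 0 → CauchyBures.ZHat α (N + 1) ≠ 0 →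
      CauchyBures.ZB α N ![] ![lam₁, lam₂] / CauchyBures.ZB₀ α N =
        1 / (lam₁ - lam₂) *
          ((CauchyBures.ZC α (N + 1) ![] ![lam₁] ![] ![lam₂] -
            CauchyBures.ZC α (N + 1) ![] ![lam₂] ![] ![lam₁]) / CauchyBures.ZHat α (N + 1))) ∧
    (∀ (N : ℕ) (kap : ℂ), CauchyBures.Admissible ![kap] ![] →
      CauchyBures.ZB₀ α N ≠ 0 → CauchyBures.ZC₀ α N ≠ 0 →
      CauchyBures.ZB α N ![kap] ![] / CauchyBures.ZB₀ α N =
        (CauchyBures.ZC α N ![] ![] ![kap] ![] + CauchyBures.ZC α N ![kap] ![] ![] ![]) /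
          (2 * CauchyBures.ZC₀ α N)) ∧
    (∀ (N : ℕ) (lam : ℂ),
      CauchyBures.ZB₀ α N ≠ 0 → CauchyBures.ZHat α (N + 1) ≠ 0 →
      CauchyBures.ZB α N ![] ![lam] / CauchyBures.ZB₀ α N =
        (CauchyBures.ZC α (N + 1) ![] ![lam] ![] ![] -
          CauchyBures.ZC α (N + 1) ![] ![] ![] ![lam]) / CauchyBures.ZHat α (N + 1)) := by
  refine ⟨CauchyBures.ZB_zero_pos hα, fun hpos => ⟨CauchyBures.ZC_zero_pos hα hpos,
    fun L hL => ?_, fun L hL N k l kap lam hadm => ?_⟩, ?_, ?_, ?_, ?_, ?_⟩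
  · have h := Complex.lt_def.mp (CauchyBures.ZHat_neg hα hpos hL)
    exact ⟨h.2, h.1.ne⟩
  -- The sign is `-1` whichever `L ≥ 1` defines it.
  · rw [CauchyBures.meanSign_eq hα hpos hL]
    exact ⟨fun M hkl hMN => CauchyBures.ZB_eq_pfaffian_even hα hadm (hpos M) hkl hMN,
      fun M hkl hMN => CauchyBures.ZB_eq_pfaffian_odd hα hadm (hpos M) hkl hMN⟩
  · intro N κ₁ κ₂ hN hadm hB hZ
    exact CauchyBures.ZB_two_poles_div hα N hN (hadm.1 0) (hadm.1 1)
      (fun h => absurd (hadm.2.1 (a₁ := 0) (a₂ := 1) h) (by decide)) hB hZ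
  · intro N κ lam hadm hB hC
    exact CauchyBures.ZB_pole_zero_div hα N (hadm.1 0) lam hB hC
  · intro N lam₁ lam₂ hne hB hZ
    exact CauchyBures.ZB_two_zeros_div hα N hne hB hZ
  · intro N κ hadm hB hC
    exact CauchyBures.ZB_pole_div hα N (hadm.1 0) hB hC
  · intro N lam hB hZ
    exact CauchyBures.ZB_zero_div hα N lam hB hZ
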